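/- Let $n\ge 2$ and let $e_1,\dots,e_n$ be the standard basis of $E=\mathbb R^n$ with its standard inner product $(\cdot,\cdot)$, extended bilinearly to $\mathbb C^n$. Let $R$ be the root system of type $BC_n$ with positive roots $R_+=\{e_p,\,2e_p,\,e_i\pm e_j : 1\le p\le n,\ 1\le i<j\le n\}$ and Weyl group $W$ (signed permutations). Let $k=(k_s,k_m,k_l)\in\mathbb C^3$ be a multiplicity function: $k_\gamma=k_s,k_m,k_l$ for $\gamma=\pm e_p$, $\pm e_i\pm e_j$, $\pm 2e_p$ respectively. Put $\gamma^\vee=2\gamma/(\gamma,\gamma)$, $k_{\gamma/2}=0$ if $\gamma/2\notin R$, $\rho(k)=\frac12\sum_{\gamma\in R_+}k_\gamma\gamma$, let $Q$ be the set of linear combinations of positive roots with coefficients in $\{0,1,2,\dots\}$, let $A=\exp E$, and let $A_+$ be the exponential of the positive Weyl chamber. Put $$L(k)=\sum_{j=1}^n\partial_{e_j}^2+\sum_{\gamma\in R_+}k_\gamma\frac{1+e^{-\gamma}}{1-e^{-\gamma}}\,\partial_\gamma ,\qquad \tilde c(\lambda,k)=\prod_{\gamma\in R_+}\frac{\Gamma\big((\lambda,\gamma^\vee)+\frac12k_{\gamma/2}\big)}{\Gamma\big((\lambda,\gamma^\vee)+\frac12k_{\gamma/2}+k_\gamma\big)},\qquad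 c(\lambda,k)=\frac{\tilde c(\lambda,k)}{\tilde c(\rho(k),k)},$$ where $\tilde c(\rho(k),k)$ is the value of the meromorphic function $k'\mapsto\tilde c(\rho(k'),k')$ at $k$ (a limit where Gamma factors have cancelling poles), which is required to exist and to be non-zero. For $\lambda\in\mathbb C^n$ with $-2(\lambda,\mu)+(\mu,\mu)\ne0$ for all $0\ne\mu\in Q$, let $\Phi(\lambda,k;a)$ be the solution on $A_+$ of $L(k)\Phi=\big((\lambda,\lambda)-(\rho(k),\rho(k))\big)\Phi$ with a convergent expansion $\Phi(\lambda,k;a)=\sum_{\mu\in Q}\Gamma_\mu a^{\lambda-\rho(k)-\mu}$, $\Gamma_0=1$. The Heckman–Opdam hypergeometric function $F(\lambda,k;a)$ is the function on $\mathbb C^n\times A$, holomorphic in $\lambda$ and real analytic in $a$, with $$F(\lambda,k;a)=\sum_{w\in W}c(w\lambda,k)\,\Phi(w\lambda,k;a)$$ for all $a\in A_+$ and all $\lambda$ such that, for every $w\in W$, the series $\Phi(w\lambda,k;\cdot)$ is defined as above and no numerator in $\tilde c(w\lambda,k)$ has a pole. For $t\in\mathbb R^n$ put $a_t=\exp(\sum_j2t_je_j)$,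 and for $\lambda\in\mathbb C^n$ put $\lambda_j=(\lambda,2e_j)$. Let $$\Delta_m(a_t)=\prod_{\gamma\in\{e_i\pm e_j\,:\,i<j\}}\big(e^{\gamma/2}-e^{-\gamma/2}\big)(a_t)=2^{n(n-1)/2}\prod_{i<j}(\cosh2t_i-\cosh2t_j),$$ and let $\varphi^{(\alpha,\beta)}_{\sqrt{-1}\,\nu}(t)={}_2F_1\big(\tfrac12(\alpha+\beta+1-\nu),\tfrac12(\alpha+\beta+1+\nu);\alpha+1;-\sinh^2t\big)$ be the Jacobi function, where ${}_2F_1$ is the Gauss hypergeometric function, analytically continued along the negative real axis. **Theorem.** Let $k_s,k_l\in\mathbb C$, $\alpha=k_s+k_l-\frac12$, $\beta=k_l-\frac12$, and assume $\alpha\notin\{0,-1,-2,\dots\}$. For $k_m=1$ and for $k_m=0$ the function $F(\lambda,k;a)$ exists and is unique, and the following holds. (1) If $k_m=1$, then for all $\lambda\in\mathbb C^n$ and $t\in\mathbb R^n$ with $\prod_{i<j}(\lambda_i^2-\lambda_j^2)\ne0$ and $\Delta_m(a_t)\ne0$, $$F(\lambda,k;a_t)=\frac{B}{\prod_{1\le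 i<j\le n}(\lambda_i^2-\lambda_j^2)}\cdot\frac{\det\big(\varphi^{(\alpha,\beta)}_{\sqrt{-1}\lambda_i}(t_j)\big)_{1\le i,j\le n}}{\Delta_m(a_t)},\qquad B=2^{2n(n-1)}\prod_{i=1}^{n-1}\big((\alpha+i)^{n-i}\,i!\big).$$ (2) If $k_m=0$, then for all $\lambda\in\mathbb C^n$ and $t\in\mathbb R^n$, $$F(\lambda,k;a_t)=\frac1{n!}\,\mathrm{perm}\big(\varphi^{(\alpha,\beta)}_{\sqrt{-1}\lambda_i}(t_j)\big)_{1\le i,j\le n},\qquad \mathrm{perm}(m_{ij})=\sum_{\sigma\in S_n}\prod_{i=1}^n m_{i\sigma(i)} .$$ -/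

import Mathlib

namespace BCn

noncomputable section

/-! ### The root system of type `BC_n`

`E = ℝⁿ` with its standard inner product; `𝔥* = ℂⁿ` through the complex bilinear extension of that
inner product, and `A = exp E` is identified with `E` through `log`. -/

/-- The standard bilinear pairing of `v ∈ ℂⁿ` with an integral vector. -/
def pairC {n : ℕ} (v : Fin n → ℂ) (a : Fin n → ℤ) : ℂ := ∑ i, v i * (a i : ℂ)

/-- The standard pairing of `y ∈ ℝⁿ` with an integral vector. -/
def pairR {n : ℕ} (y : Fin n → ℝ) (a : Fin n → ℤ) : ℝ := ∑ i, y i * (a i : ℝ)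

/-- The squared length `(a, a)` of an integral vector. -/
def normSq {n : ℕ} (a : Fin n → ℤ) : ℤ := ∑ i, a i * a i

/-- The standard basis vector `e_i`. -/
def e {n : ℕ} (i : Fin n) : Fin n → ℤ := Pi.single i 1

/-- The positive roots `e_p`, `2 e_p`, `e_i - e_j`, `e_i + e_j` (`i < j`) of type `BC_n`. -/
def posRoots (n : ℕ) : Finset (Fin n → ℤ) :=
  Finset.univ.image (fun p : Fin n => e p) ∪
  Finset.univ.image (fun p : Fin n => e p + e p) ∪
  (Finset.univ.filter (fun q : Fin n × Fin n => q.1 < q.2)).image (fun q => e q.1 - e q.2) ∪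
  (Finset.univ.filter (fun q : Fin n × Fin n => q.1 < q.2)).image (fun q => e q.1 + e q.2)

/-- A multiplicity function `k = (k_s, k_m, k_l)`: its values on the short, middle and long
roots. -/
abbrev Multiplicity := ℂ × ℂ × ℂ

/-- The multiplicity `k_a` of a root `a`. Short, middle and long roots have squared length
`1`, `2` and `4`. -/
def mult {n : ℕ} (k : Multiplicity) (a : Fin n → ℤ) : ℂ :=
  if normSq a = 1 then k.1
  else if normSq a = 2 then k.2.1
  else if normSq a = 4 then k.2.2
  else 0

/-- The multiplicity `k_{a/2}` for a root `a`. It is `k_s` if `a` is a long root `± 2 e_p`, and `0`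
if `a` is a short or a middle root, since then `a/2` is not a root. -/
def multHalf {n : ℕ} (k : Multiplicity) (a : Fin n → ℤ) : ℂ :=
  if normSq a = 4 then k.1 else 0

/-- `ρ(k) = (1/2) ∑_{a > 0} k_a a`. -/
def rho (n : ℕ) (k : Multiplicity) : Fin n → ℂ :=
  fun i => (1 / 2) * ∑ a ∈ posRoots n, mult k a * (a i : ℂ)

/-- The positive Weyl chamber. -/
def posChamber (n : ℕ) : Set (Fin n → ℝ) := {y | ∀ a ∈ posRoots n, 0 < pairR y a}

/-- The set of all linear combinations of the positive roots with coefficients in `ℕ`. -/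
def rootCone (n : ℕ) : AddSubmonoid (Fin n → ℤ) :=
  AddSubmonoid.closure (posRoots n : Set (Fin n → ℤ))

/-- The Weyl group of type `BC_n`: permutations together with signs. -/
abbrev Weyl (n : ℕ) := Equiv.Perm (Fin n) × (Fin n → ℤˣ)

/-- The action of a signed permutation on `ℂⁿ`. -/
def weylAct {n : ℕ} (w : Weyl n) (lam : Fin n → ℂ) : Fin n → ℂ :=
  fun i => ((w.2 i : ℤ) : ℂ) * lam (w.1 i)

/-! ### The operator `L(k)` and the Harish-Chandra series -/

/-- `L(k) = ∑_j ∂_{e_j}² + ∑_{a > 0} k_a (1 + e^{-a}) / (1 - e^{-a}) ∂_a`. -/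
def laplaceL {n : ℕ} (k : Multiplicity) (f : (Fin n → ℝ) → ℂ) (y : Fin n → ℝ) : ℂ :=
  (∑ j : Fin n, lineDeriv ℝ (fun z => lineDeriv ℝ f z (Pi.single j 1)) y (Pi.single j 1)) +
  ∑ a ∈ posRoots n,
    mult k a * (((1 + Real.exp (-pairR y a)) / (1 - Real.exp (-pairR y a)) : ℝ) : ℂ) *
      lineDeriv ℝ f y (fun i => (a i : ℝ))

/-- The exponential `a ↦ a^ν`, as a function of `y = log a`. -/
def expChar {n : ℕ} (nu : Fin n → ℂ) (y : Fin n → ℝ) : ℂ :=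
  Complex.exp (∑ i, nu i * (y i : ℂ))

/-- The condition `-2(λ, μ) + (μ, μ) ≠ 0` for all `μ ≠ 0` in the cone spanned by the positive
roots. -/
def IsGeneric {n : ℕ} (lam : Fin n → ℂ) : Prop :=
  ∀ mu ∈ rootCone n, mu ≠ 0 → -2 * pairC lam mu + (normSq mu : ℂ) ≠ 0

/-- `Φ` is a Harish-Chandra series `Φ(λ, k; ·)`: on the positive chamber it has a convergent
expansion `∑_μ Γ_μ a^{λ - ρ(k) - μ}` with `Γ_0 = 1`, and it solves
`L(k) Φ = ((λ, λ) - (ρ(k), ρ(k))) Φ`. -/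
def IsHarishChandraSeries {n : ℕ} (k : Multiplicity) (lam : Fin n → ℂ)
    (Phi : (Fin n → ℝ) → ℂ) : Prop :=
  (∃ Gam : rootCone n → ℂ, Gam 0 = 1 ∧
    ∀ y ∈ posChamber n,
      HasSum
        (fun mu : rootCone n =>
          Gam mu * expChar (fun i => lam i - rho n k i - ((mu : Fin n → ℤ) i : ℂ)) y)
        (Phi y)) ∧
  ∀ y ∈ posChamber n,
    laplaceL k Phi y = ((∑ i, lam i ^ 2) - ∑ i, rho n k i ^ 2) * Phi y

/-! ### The `c`-function and the hypergeometric function -/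

/-- `(λ, a^∨) + k_{a/2} / 2`, where `a^∨ = 2 a / (a, a)`. -/
def cArg {n : ℕ} (lam : Fin n → ℂ) (k : Multiplicity) (a : Fin n → ℤ) : ℂ :=
  2 * pairC lam a / (normSq a : ℂ) + (1 / 2) * multHalf k a

/-- `c̃(λ, k) = ∏_{a > 0} Γ((λ, a^∨) + k_{a/2}/2) / Γ((λ, a^∨) + k_{a/2}/2 + k_a)`.
Wherever no numerator has a pole this is the value of that meromorphic function: at the poles of a
denominator `Complex.Gamma` and the quotient are both `0`. -/
def cTilde {n : ℕ} (lam : Fin n → ℂ) (k : Multiplicity) : ℂ :=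
  ∏ a ∈ posRoots n, Complex.Gamma (cArg lam k a) / Complex.Gamma (cArg lam k a + mult k a)

/-- No Gamma function in a numerator of `c̃(λ, k)` is evaluated at a pole. -/
def NoPole {n : ℕ} (lam : Fin n → ℂ) (k : Multiplicity) : Prop :=
  ∀ a ∈ posRoots n, ∀ m : ℕ, cArg lam k a ≠ -(m : ℂ)

/-- `v` is the value at `k` of the meromorphic function `k' ↦ c̃(ρ(k'), k')`. At a `k` where Gamma
factors have poles which cancel, the value is the limit from nearby `k'` without poles. -/
def HasCRhoValue (n : ℕ) (k : Multiplicity) (v : ℂ) : Prop :=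
  Filter.Tendsto (fun k' : Multiplicity => cTilde (rho n k') k')
    (nhdsWithin k {k' | NoPole (rho n k') k'}) (nhds v)

/-- `F` is the Heckman-Opdam hypergeometric function `F(λ, k; a)` of type `BC_n` with multiplicity
`k`, as a function of `λ ∈ ℂⁿ` and `y = log a ∈ ℝⁿ`. For generic `λ` and `y` in the positive
chamber, `F = ∑_{w ∈ W} c(wλ, k) Φ(wλ, k; ·)` with `c(λ, k) = c̃(λ, k) / c̃(ρ(k), k)`; elsewhere
it is given by analytic continuation, holomorphic in `λ` and real analytic in `y`. The value of
`c̃(ρ(k), k)` is required to be non-zero. -/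
structure IsHypergeometricFunction (n : ℕ) (k : Multiplicity)
    (F : (Fin n → ℂ) → (Fin n → ℝ) → ℂ) : Prop where
  holomorphic : ∀ y, Differentiable ℂ (fun lam => F lam y)
  analytic : ∀ lam, AnalyticOnNhd ℝ (F lam) Set.univ
  eq_sum : ∃ c₀ : ℂ, HasCRhoValue n k c₀ ∧ c₀ ≠ 0 ∧
    ∀ lam : Fin n → ℂ, (∀ w : Weyl n, IsGeneric (weylAct w lam) ∧ NoPole (weylAct w lam) k) →
      ∃ Phi : Weyl n → (Fin n → ℝ) → ℂ,
        (∀ w, IsHarishChandraSeries k (weylAct w lam) (Phi w)) ∧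
        ∀ y ∈ posChamber n, F lam y = ∑ w, cTilde (weylAct w lam) k / c₀ * Phi w y

/-! ### Jacobi functions and the Weyl denominator -/

/-- The Gauss hypergeometric function `₂F₁(a, b; c; z)` on the unit disc and on the half plane
`Re z < 1/2`: the power series for `|z| < 1`, and outside the disc its analytic continuation
`(1 - z)^{-a} ₂F₁(a, c - b; c; z / (z - 1))`, for which `|z / (z - 1)| < 1`. It is used for
`z ≤ 0` only. -/
def gauss2F1 (a b c z : ℂ) : ℂ :=
  if ‖z‖ < 1 then ordinaryHypergeometric a b c z
  else (1 - z) ^ (-a) * ordinaryHypergeometric a (c - b) c (z / (z - 1))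

/-- The Jacobi function `φ_μ^{(α,β)}(t)
  = ₂F₁((α + β + 1 + iμ)/2, (α + β + 1 - iμ)/2; α + 1; -sinh² t)`. -/
def jacobiFunction (α β mu : ℂ) (t : ℝ) : ℂ :=
  gauss2F1 ((α + β + 1 + Complex.I * mu) / 2) ((α + β + 1 - Complex.I * mu) / 2) (α + 1)
    ((-(Real.sinh t) ^ 2 : ℝ) : ℂ)

/-- The Weyl denominator of the middle roots, as a function of `y = log a`. -/
def middleDenominator (n : ℕ) (y : Fin n → ℝ) : ℝ :=
  ∏ a ∈ (posRoots n).filter (fun a => normSq a = 2),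
    (Real.exp (pairR y a / 2) - Real.exp (-(pairR y a / 2)))

end

end BCn

namespace BCn

open Filter Topology Metric

local notation "HG" => ordinaryHypergeometric (𝕂 := ℂ) (𝔸 := ℂ)

/-- A power series in `z` whose coefficients are holomorphic functions of a parameter and satisfy a
uniform Cauchy bound is jointly analytic in the parameter and in `z`. -/
theorem analyticAt_tsum_mul_pow {U : Set ℂ} (hU : IsOpen U) {c : ℕ → ℂ → ℂ}
    (hc : ∀ m, DifferentiableOn ℂ (c m) U) {K r : ℝ} (hK : ∀ m, ∀ l ∈ U, ‖c m l‖ * r ^ m ≤ K)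
    {l z : ℂ} (hl : l ∈ U) (hz : ‖z‖ < r) :
    AnalyticAt ℂ (fun p : ℂ × ℂ => ∑' m, c m p.1 * p.2 ^ m) (l, z) := by
  obtain ⟨t, hzt, htr⟩ := exists_between hz
  obtain ⟨s, hts, hsr⟩ := exists_between htr
  have ht : 0 < t := (norm_nonneg z).trans_lt hzt
  have hs : 0 < s := ht.trans hts
  have hr : 0 < r := hs.trans hsr
  let X := lp (fun _ : ℕ => ℂ) 2
  let C : ℂ → X := fun l => ∑' m, lp.single 2 m (c m l * (s : ℂ) ^ m)
  let V : ℂ → (X →L[ℂ] ℂ) := fun z =>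
    ∑' m : ℕ, (z / s) ^ m • lp.evalCLM ℂ (fun _ : ℕ => ℂ) 2 m
  have hbC : ∀ m, ∀ l ∈ U, ‖(lp.single 2 m (c m l * (s : ℂ) ^ m) : X)‖ ≤ K * (s / r) ^ m := by
    intro m l hl
    rw [lp.norm_single (by norm_num), norm_mul, norm_pow, Complex.norm_real, Real.norm_of_nonneg hs.le,
      div_pow]
    have := hK m l hl
    rw [← le_div_iff₀ (by positivity)] at this
    calc _ ≤ K / r ^ m * s ^ m := by gcongr
      _ = _ := by ring
  have hsumC : Summable fun m => K * (s / r) ^ m :=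
    (summable_geometric_of_lt_one (by positivity) ((div_lt_one hr).2 hsr)).mul_left _
  have hbV : ∀ m : ℕ, ∀ z ∈ ball (0 : ℂ) t,
      ‖((z / s) ^ m • lp.evalCLM ℂ (fun _ : ℕ => ℂ) 2 m : X →L[ℂ] ℂ)‖ ≤ (t / s) ^ m := by
    intro m z hz
    have h1 : ‖(lp.evalCLM ℂ (fun _ : ℕ => ℂ) 2 m : X →L[ℂ] ℂ)‖ ≤ 1 := by
      refine ContinuousLinearMap.opNorm_le_bound _ zero_le_one fun x => ?_
      rw [one_mul]
      exact lp.norm_apply_le_norm (by norm_num) x m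
    rw [norm_smul, norm_pow, norm_div, Complex.norm_real, Real.norm_of_nonneg hs.le]
    have h2 : ‖z‖ ≤ t := (mem_ball_zero_iff.1 hz).le
    calc _ ≤ (t / s) ^ m * 1 := by gcongr
      _ = _ := mul_one _
  have hsumV : Summable fun m => (t / s) ^ m :=
    summable_geometric_of_lt_one (by positivity) ((div_lt_one hs).2 hts)
  have hdC : DifferentiableOn ℂ C U := by
    refine Complex.differentiableOn_tsum_of_summable_norm hsumC (fun m => ?_) hU hbC
    have := (lp.singleContinuousLinearMap ℂ (fun _ : ℕ => ℂ) 2 m).differentiable.comp_differentiableOn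
      ((hc m).mul_const ((s : ℂ) ^ m))
    exact this
  have hdV : DifferentiableOn ℂ V (ball 0 t) := by
    refine Complex.differentiableOn_tsum_of_summable_norm hsumV (fun m => ?_) isOpen_ball hbV
    fun_prop
  have haC : AnalyticAt ℂ C l := hdC.analyticAt (hU.mem_nhds hl)
  have hzb : z ∈ ball (0 : ℂ) t := mem_ball_zero_iff.2 hzt
  have haV : AnalyticAt ℂ V z := hdV.analyticAt (isOpen_ball.mem_nhds hzb)
  have h1 : AnalyticAt ℂ (fun p : ℂ × ℂ => V p.2 (C p.1)) (l, z) := by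
    have e1 : AnalyticAt ℂ (fun p : ℂ × ℂ => (C p.1, V p.2)) (l, z) :=
      (haC.comp_of_eq analyticAt_fst rfl).prod (haV.comp_of_eq analyticAt_snd rfl)
    exact ((ContinuousLinearMap.apply ℂ ℂ : X →L[ℂ] (X →L[ℂ] ℂ) →L[ℂ] ℂ).analyticAt_bilinear
      (C l, V z)).comp_of_eq e1 rfl
  refine h1.congr ?_
  have hn : U ×ˢ ball (0 : ℂ) t ∈ 𝓝 (l, z) :=
    (hU.prod isOpen_ball).mem_nhds ⟨hl, hzb⟩
  filter_upwards [hn] with p hp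
  have hV : HasSum (fun m : ℕ => ((p.2 / s) ^ m • lp.evalCLM ℂ (fun _ : ℕ => ℂ) 2 m : X →L[ℂ] ℂ))
      (V p.2) := (Summable.of_norm_bounded hsumV fun m => hbV m _ hp.2).hasSum
  have hC : HasSum (fun m => (lp.single 2 m (c m p.1 * (s : ℂ) ^ m) : X)) (C p.1) :=
    (Summable.of_norm_bounded hsumC fun m => hbC m _ hp.1).hasSum
  have hV' := (hV.mapL (ContinuousLinearMap.apply ℂ ℂ (C p.1)))
  simp only [ContinuousLinearMap.apply_apply] at hV'
  rw [← hV'.tsum_eq]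
  refine tsum_congr fun m => ?_
  have hCm := hC.mapL (lp.evalCLM ℂ (fun _ : ℕ => ℂ) 2 m)
  have hCm' : (C p.1 : ∀ _ : ℕ, ℂ) m = c m p.1 * (s : ℂ) ^ m := by
    refine hCm.unique ?_
    convert! hasSum_ite_eq m (c m p.1 * (s : ℂ) ^ m) using 2 with k
    split_ifs with h
    · subst h
      exact lp.single_apply_self (E := fun _ : ℕ => ℂ) 2 _ _
    · exact lp.single_apply_ne (E := fun _ : ℕ => ℂ) 2 _ _ (Ne.symm h)
  change (p.2 / s) ^ m * (C p.1 : ∀ _ : ℕ, ℂ) m = _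
  rw [hCm', div_pow]
  have : (s : ℂ) ≠ 0 := by exact_mod_cast hs.ne'
  field_simp

/-- Termwise differentiation of a power series on the unit disc. -/
theorem hasDerivAt_tsum_mul_pow {c : ℕ → ℂ}
    (hc : ∀ r : ℝ, 0 ≤ r → r < 1 → Summable fun n => ‖c n‖ * r ^ n) {z : ℂ} (hz : ‖z‖ < 1) :
    HasDerivAt (fun z => ∑' n, c n * z ^ n) (∑' n : ℕ, ((n : ℂ) + 1) * c (n + 1) * z ^ n) z := by
  obtain ⟨r, hzr, hr1⟩ := exists_between hz
  have hr0 : 0 ≤ r := (norm_nonneg z).trans hzr.le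
  have hd : ∀ n, DifferentiableOn ℂ (fun z => c n * z ^ n) (ball 0 r) := fun n => by fun_prop
  have hb : ∀ n, ∀ w ∈ ball (0 : ℂ) r, ‖c n * w ^ n‖ ≤ ‖c n‖ * r ^ n := fun n w hw => by
    rw [norm_mul, norm_pow]
    have := (mem_ball_zero_iff.1 hw).le
    gcongr
  have hzb := mem_ball_zero_iff.2 hzr
  have h1 := Complex.hasSum_deriv_of_summable_norm (hc r hr0 hr1) hd isOpen_ball hb hzb
  have h2 := (Complex.differentiableOn_tsum_of_summable_norm (hc r hr0 hr1) hd isOpen_ball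
    hb).differentiableAt (isOpen_ball.mem_nhds hzb)
  convert! h2.hasDerivAt using 1
  rw [← h1.tsum_eq, h1.summable.tsum_eq_zero_add]
  simp only [pow_zero, mul_one, deriv_const, zero_add]
  refine tsum_congr fun n => ?_
  simp
  ring

theorem summable_norm_succ_mul_pow {c : ℕ → ℂ}
    (hc : ∀ r : ℝ, 0 ≤ r → r < 1 → Summable fun n => ‖c n‖ * r ^ n) (r : ℝ) (h0 : 0 ≤ r)
    (h1 : r < 1) : Summable fun n : ℕ => ‖((n : ℂ) + 1) * c (n + 1)‖ * r ^ n := by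
  obtain ⟨s, hrs, hs1⟩ := exists_between h1
  have hs : 0 < s := h0.trans_lt hrs
  have hb : Tendsto (fun n : ℕ => (n : ℝ) * (r / s) ^ n) atTop (𝓝 0) :=
    tendsto_self_mul_const_pow_of_lt_one (by positivity) ((div_lt_one hs).2 hrs)
  obtain ⟨M, hM⟩ := hb.bddAbove_range
  have hM' : ∀ n : ℕ, (n : ℝ) * (r / s) ^ n ≤ M := fun n => hM ⟨n, rfl⟩
  have hg : ∀ n : ℕ, (r / s) ^ n ≤ 1 := fun n =>
    pow_le_one₀ (by positivity) ((div_le_one hs).2 hrs.le)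
  have hsum := ((summable_nat_add_iff 1).2 (hc s hs.le hs1)).mul_left ((M + 1) / s)
  refine Summable.of_nonneg_of_le (fun n => by positivity) (fun n => ?_) hsum
  rw [norm_mul]
  have e : ‖(n : ℂ) + 1‖ = n + 1 := by
    rw [← Nat.cast_succ, Complex.norm_natCast, Nat.cast_succ]
  rw [e]
  have h3 : ((n : ℝ) + 1) * r ^ n ≤ (M + 1) * s ^ n := by
    have : r ^ n = (r / s) ^ n * s ^ n := by rw [div_pow]; field_simp
    rw [this, ← mul_assoc]
    gcongr
    linarith [hM' n, hg n]
  calc _ = ‖c (n + 1)‖ * (((n : ℝ) + 1) * r ^ n) := by ring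
    _ ≤ ‖c (n + 1)‖ * ((M + 1) * s ^ n) := by gcongr
    _ = _ := by rw [pow_succ]; field_simp

/-- Termwise differentiation of a series of exponentials whose exponents have real differences. -/
theorem hasDerivAt_tsum_mul_exp {ι : Type*} {c : ι → ℂ} {m : ι → ℝ} (κ : ℂ) {δ : ℝ} (hδ : 0 < δ)
    (h1 : Summable fun i => ‖c i‖ * Real.exp (m i * δ))
    (h2 : Summable fun i => ‖c i‖ * Real.exp (m i * -δ)) :
    (Summable fun i => (κ - m i) * c i) ∧
    HasDerivAt (fun s : ℝ => ∑' i, c i * Complex.exp ((κ - m i) * s)) (∑' i, (κ - m i) * c i) 0 := by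
  have hd : ∀ i, DifferentiableOn ℂ (fun s => c i * Complex.exp ((κ - m i) * s)) (ball 0 δ) :=
    fun i => by fun_prop
  have hb : ∀ i, ∀ w ∈ ball (0 : ℂ) δ, ‖c i * Complex.exp ((κ - m i) * w)‖ ≤
      Real.exp (‖κ‖ * δ) * (‖c i‖ * Real.exp (m i * δ) + ‖c i‖ * Real.exp (m i * -δ)) := by
    intro i w hw
    have hw' := (mem_ball_zero_iff.1 hw).le
    have hre : |w.re| ≤ δ := (Complex.abs_re_le_norm w).trans hw'
    rw [norm_mul, Complex.norm_exp, sub_mul, Complex.sub_re, Complex.re_ofReal_mul]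
    have e1 : (κ * w).re ≤ ‖κ‖ * δ :=
      (Complex.re_le_norm _).trans (by rw [norm_mul]; gcongr)
    have e2 : Real.exp (-(m i * w.re)) ≤ Real.exp (m i * δ) + Real.exp (m i * -δ) := by
      rcases le_total 0 (m i) with h | h
      · refine le_add_of_le_of_nonneg (Real.exp_le_exp.2 ?_) (Real.exp_pos _).le
        nlinarith [abs_le.1 hre]
      · refine le_add_of_nonneg_of_le (Real.exp_pos _).le (Real.exp_le_exp.2 ?_)
        nlinarith [abs_le.1 hre]
    rw [sub_eq_add_neg, Real.exp_add]
    calc _ ≤ ‖c i‖ * (Real.exp (‖κ‖ * δ) * (Real.exp (m i * δ) + Real.exp (m i * -δ))) := by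
          gcongr
      _ = _ := by ring
  have hsum := (h1.add h2).mul_left (Real.exp (‖κ‖ * δ))
  have h0 : (0 : ℂ) ∈ ball (0 : ℂ) δ := mem_ball_self hδ
  have k1 := Complex.hasSum_deriv_of_summable_norm hsum hd isOpen_ball hb h0
  have k2 := ((Complex.differentiableOn_tsum_of_summable_norm hsum hd isOpen_ball
    hb).differentiableAt (isOpen_ball.mem_nhds h0)).hasDerivAt
  have e : ∀ i, deriv (fun s => c i * Complex.exp ((κ - m i) * s)) 0 = (κ - m i) * c i := by
    intro i
    have : HasDerivAt (fun s => c i * Complex.exp ((κ - m i) * s)) (c i * (Complex.exp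
        ((κ - m i) * 0) * ((κ - m i) * 1))) 0 :=
      (((hasDerivAt_id (0 : ℂ)).const_mul _).cexp).const_mul _
    rw [this.deriv]
    simp
    ring
  simp only [e] at k1
  refine ⟨k1.summable, ?_⟩
  rw [← k1.tsum_eq] at k2
  have := HasDerivAt.comp_ofReal (z := (0 : ℝ)) (by simpa using k2)
  simpa using this

theorem norm_le_mul_pow_of_recurrence {x : ℕ → ℂ} {A B : ℕ → ℝ} {K ρ : ℝ} {N : ℕ} (hρ : 1 ≤ ρ)
    (hA : ∀ m ≥ N, 0 ≤ A m) (hB : ∀ m ≥ N, 0 ≤ B m) (hAB : ∀ m ≥ N, A m + B m ≤ ρ)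
    (h0 : ∀ m ≤ N + 1, ‖x m‖ ≤ K)
    (h : ∀ m ≥ N, ‖x (m + 2)‖ ≤ A m * ‖x (m + 1)‖ + B m * ‖x m‖) (m : ℕ) : ‖x m‖ ≤ K * ρ ^ m := by
  have hK : 0 ≤ K := (norm_nonneg _).trans (h0 0 (Nat.zero_le _))
  induction m using Nat.strong_induction_on with
  | _ m ih =>
    by_cases hm : m ≤ N + 1
    · exact (h0 m hm).trans (le_mul_of_one_le_right hK (one_le_pow₀ hρ))
    · obtain ⟨k, rfl⟩ : ∃ k, m = k + 2 := ⟨m - 2, by omega⟩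
      have hk : N ≤ k := by omega
      have i1 := ih (k + 1) (by omega)
      have i0 := ih k (by omega)
      calc ‖x (k + 2)‖ ≤ A k * ‖x (k + 1)‖ + B k * ‖x k‖ := h k hk
        _ ≤ A k * (K * ρ ^ (k + 1)) + B k * (K * ρ ^ (k + 1)) := by
            have := hA k hk
            have := hB k hk
            have : K * ρ ^ k ≤ K * ρ ^ (k + 1) := by
              exact mul_le_mul_of_nonneg_left (pow_le_pow_right₀ hρ (Nat.le_succ k)) hK
            gcongr
            exact i0.trans this
        _ = (A k + B k) * (K * ρ ^ (k + 1)) := by ring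
        _ ≤ ρ * (K * ρ ^ (k + 1)) := by
            have := hAB k hk
            gcongr
        _ = K * ρ ^ (k + 2) := by ring

/-! ### The Gauss hypergeometric series -/

/-- The coefficients of the Gauss hypergeometric series. -/
noncomputable def hgc (a b c : ℂ) (n : ℕ) : ℂ :=
  (n.factorial : ℂ)⁻¹ * (ascPochhammer ℂ n).eval a * (ascPochhammer ℂ n).eval b *
    ((ascPochhammer ℂ n).eval c)⁻¹


theorem hgc_zero (a b c : ℂ) : hgc a b c 0 = 1 := by
  simp [hgc]

theorem hgc_succ (a b c : ℂ) (n : ℕ) :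
    hgc a b c (n + 1) = hgc a b c n * ((a + n) * (b + n) / ((c + n) * (n + 1))) := by
  simp only [hgc, ascPochhammer_succ_eval, Nat.factorial_succ,
    mul_inv, Nat.cast_mul, Nat.cast_succ, div_eq_mul_inv]
  ring

theorem hgc_comm (a b c : ℂ) (n : ℕ) : hgc a b c n = hgc b a c n := by
  simp only [hgc]
  ring

theorem hypergeometric_eq_tsum (a b c z : ℂ) : HG a b c z = ∑' n, hgc a b c n * z ^ n := by
  rw [ordinaryHypergeometric_eq_tsum]
  rfl

theorem hypergeometric_comm (a b c z : ℂ) : HG a b c z = HG b a c z := by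
  simp only [hypergeometric_eq_tsum, hgc_comm a b c]

/-- A majorant of the hypergeometric coefficients for parameters `a`, `b` of norm at most `R`. -/
noncomputable def hgMajorant (R : ℝ) (c : ℂ) (n : ℕ) : ℝ :=
  ∏ j ∈ Finset.range n, ((R + j) ^ 2 / (‖c + j‖ * (j + 1)))

theorem hgMajorant_nonneg (R : ℝ) (c : ℂ) (n : ℕ) : 0 ≤ hgMajorant R c n :=
  Finset.prod_nonneg fun _ _ => by positivity

theorem norm_hgc_le_hgMajorant {R : ℝ} {a b : ℂ} (c : ℂ) (ha : ‖a‖ ≤ R) (hb : ‖b‖ ≤ R) (n : ℕ) :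
    ‖hgc a b c n‖ ≤ hgMajorant R c n := by
  induction n with
  | zero => simp [hgc_zero, hgMajorant]
  | succ n ih =>
    have e : ‖(n : ℂ) + 1‖ = n + 1 := by
      rw [← Nat.cast_succ, Complex.norm_natCast, Nat.cast_succ]
    have h : ∀ x : ℂ, ‖x‖ ≤ R → ‖x + n‖ ≤ R + n := fun x hx =>
      (norm_add_le _ _).trans (by rw [Complex.norm_natCast]; linarith)
    rw [hgc_succ, hgMajorant, Finset.prod_range_succ, ← hgMajorant, norm_mul, norm_div, norm_mul,
      norm_mul, e, pow_two]
    have := hgMajorant_nonneg R c n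
    have := h a ha
    have := h b hb
    have : 0 ≤ R := (norm_nonneg _).trans ha
    gcongr

theorem summable_hgMajorant_mul_pow {R : ℝ} (hR : 0 ≤ R) (c : ℂ) {r : ℝ} (h0 : 0 ≤ r)
    (h1 : r < 1) : Summable fun n => hgMajorant R c n * r ^ n := by
  have t1 : Tendsto (fun n : ℕ => (R + n) ^ 2 / (‖c + n‖ * (n + 1)) * r) atTop (𝓝 r) := by
    have e1 : Tendsto (fun n : ℕ => ((R : ℂ) + 1 * n) / (c + 1 * n)) atTop (𝓝 (1 / 1)) :=
      tendsto_add_mul_div_add_mul_atTop_nhds _ _ _ one_ne_zero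
    have e2 : Tendsto (fun n : ℕ => ((R : ℂ) + 1 * n) / (1 + 1 * n)) atTop (𝓝 (1 / 1)) :=
      tendsto_add_mul_div_add_mul_atTop_nhds _ _ _ one_ne_zero
    have e3 := ((e1.mul e2).norm).mul_const r
    simp only [div_one, mul_one, norm_one, one_mul] at e3
    refine e3.congr fun n => ?_
    have f1 : ‖(R : ℂ) + n‖ = R + n := by
      rw [← Complex.ofReal_natCast, ← Complex.ofReal_add, Complex.norm_real,
        Real.norm_of_nonneg (by positivity)]
    have f2 : ‖(1 : ℂ) + n‖ = n + 1 := by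
      rw [add_comm, ← Nat.cast_succ, Complex.norm_natCast, Nat.cast_succ]
    rw [norm_mul, norm_div, norm_div, f1, f2, div_mul_div_comm, pow_two]
  obtain ⟨q, hq1, hq2⟩ := exists_between h1
  refine summable_of_ratio_norm_eventually_le hq2 ?_
  filter_upwards [t1.eventually_le_const hq1] with n hn
  have hM := hgMajorant_nonneg R c n
  rw [Real.norm_of_nonneg (mul_nonneg (hgMajorant_nonneg R c _) (by positivity)),
    Real.norm_of_nonneg (mul_nonneg hM (by positivity)), hgMajorant, Finset.prod_range_succ,
    ← hgMajorant, pow_succ]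
  calc _ = ((R + n) ^ 2 / (‖c + n‖ * (n + 1)) * r) * (hgMajorant R c n * r ^ n) := by ring
    _ ≤ _ := by gcongr

theorem summable_norm_hgc_mul_pow (a b c : ℂ) (r : ℝ) (h0 : 0 ≤ r) (h1 : r < 1) :
    Summable fun n => ‖hgc a b c n‖ * r ^ n := by
  refine Summable.of_nonneg_of_le (fun n => by positivity) (fun n => ?_)
    (summable_hgMajorant_mul_pow (R := max ‖a‖ ‖b‖) (by positivity) c h0 h1)
  have := norm_hgc_le_hgMajorant c (le_max_left ‖a‖ ‖b‖) (le_max_right ‖a‖ ‖b‖) n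
  gcongr

theorem analyticAt_hypergeometric {a b : ℂ → ℂ} (ha : Differentiable ℂ a) (hb : Differentiable ℂ b)
    (c : ℂ) (l : ℂ) {z : ℂ} (hz : ‖z‖ < 1) :
    AnalyticAt ℂ (fun p : ℂ × ℂ => HG (a p.1) (b p.1) c p.2) (l, z) := by
  obtain ⟨r, hzr, hr1⟩ := exists_between hz
  have hr0 : 0 ≤ r := (norm_nonneg z).trans hzr.le
  have hcont : Continuous fun l => max ‖a l‖ ‖b l‖ := by
    have := ha.continuous
    have := hb.continuous
    fun_prop
  let R := max ‖a l‖ ‖b l‖ + 1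
  have hR : 0 ≤ R := by positivity
  let U : Set ℂ := {x | max ‖a x‖ ‖b x‖ < R}
  have hU : IsOpen U := isOpen_lt hcont continuous_const
  have hs := summable_hgMajorant_mul_pow hR c hr0 hr1
  have key := analyticAt_tsum_mul_pow hU (c := fun m x => hgc (a x) (b x) c m) (K := ∑' n, hgMajorant R c n * r ^ n)
    (r := r) (fun m => ?_) (fun m x hx => ?_) (l := l) (z := z) (show max ‖a l‖ ‖b l‖ < R from lt_add_one _) hzr
  · simpa only [hypergeometric_eq_tsum] using key
  · have hp : ∀ m : ℕ, Differentiable ℂ fun x : ℂ => (ascPochhammer ℂ m).eval x := fun m =>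
      Polynomial.differentiable _
    have h1 := (hp m).comp ha
    have h2 := (hp m).comp hb
    simp only [Function.comp_def] at h1 h2
    simp only [hgc]
    exact (((h1.const_mul _).mul h2).mul_const _).differentiableOn
  · have hx' : max ‖a x‖ ‖b x‖ ≤ R := le_of_lt hx
    calc _ ≤ hgMajorant R c m * r ^ m := by
          have := norm_hgc_le_hgMajorant c ((le_max_left _ _).trans hx') ((le_max_right _ _).trans hx') m
          gcongr
      _ ≤ _ := hs.le_tsum m fun n _ => mul_nonneg (hgMajorant_nonneg R c n) (by positivity)

theorem analyticAt_hypergeometric_right (a b c : ℂ) {z : ℂ} (hz : ‖z‖ < 1) :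
    AnalyticAt ℂ (HG a b c) z :=
  (analyticAt_hypergeometric (differentiable_const a) (differentiable_const b) c 0 hz).comp_of_eq
    (analyticAt_const.prod analyticAt_id) rfl

theorem hasSum_of_hasSum_succ {f : ℕ → ℂ} {s : ℂ} (h : HasSum (fun n => f (n + 1)) s)
    (h0 : f 0 = 0) : HasSum f s := by
  simpa [h0] using (hasSum_nat_add_iff (f := f) 1).1 h

/-- The hypergeometric differential equation. -/
theorem hypergeometric_ode (a b : ℂ) {c : ℂ} (hc : ∀ m : ℕ, c ≠ -(m : ℂ)) :
    ∃ F₁ F₂ : ℂ → ℂ, ∀ z, ‖z‖ < 1 → HasDerivAt (HG a b c) (F₁ z) z ∧ HasDerivAt F₁ (F₂ z) z ∧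
      z * (1 - z) * F₂ z + (c - (a + b + 1) * z) * F₁ z = a * b * HG a b c z := by
  let h := hgc a b c
  let d : ℕ → ℂ := fun n => ((n : ℂ) + 1) * h (n + 1)
  let e : ℕ → ℂ := fun n => ((n : ℂ) + 1) * d (n + 1)
  have sh := summable_norm_hgc_mul_pow a b c
  have sd := summable_norm_succ_mul_pow sh
  have se := summable_norm_succ_mul_pow sd
  refine ⟨fun z => ∑' n, d n * z ^ n, fun z => ∑' n, e n * z ^ n, fun z hz => ⟨?_, ?_, ?_⟩⟩
  · have := hasDerivAt_tsum_mul_pow sh hz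
    simp only [← hypergeometric_eq_tsum] at this
    exact this
  · exact hasDerivAt_tsum_mul_pow sd hz
  · have hsum : ∀ f : ℕ → ℂ, (∀ r : ℝ, 0 ≤ r → r < 1 → Summable fun n => ‖f n‖ * r ^ n) →
        HasSum (fun n => f n * z ^ n) (∑' n, f n * z ^ n) := fun f hf => by
      refine (Summable.of_norm ?_).hasSum
      simpa only [norm_mul, norm_pow] using hf ‖z‖ (norm_nonneg z) hz
    have S0 := hsum h sh
    have S1 := hsum d sd
    have S2 := hsum e se
    rw [hypergeometric_eq_tsum]
    change z * (1 - z) * (∑' n, e n * z ^ n) + (c - (a + b + 1) * z) * (∑' n, d n * z ^ n) =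
      a * b * ∑' n, h n * z ^ n
    have T1 : HasSum (fun n : ℕ => n * h n * z ^ n) (z * ∑' n, d n * z ^ n) := by
      refine hasSum_of_hasSum_succ ?_ (by simp)
      convert! S1.mul_left z using 2 with n
      simp only [d]
      push_cast
      ring
    have T2 : HasSum (fun n : ℕ => n * d n * z ^ n) (z * ∑' n, e n * z ^ n) := by
      refine hasSum_of_hasSum_succ ?_ (by simp)
      convert! S2.mul_left z using 2 with n
      simp only [e]
      push_cast
      ring
    have T3 : HasSum (fun n : ℕ => n * (n - 1) * h n * z ^ n) (z * (z * ∑' n, e n * z ^ n)) := by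
      refine hasSum_of_hasSum_succ ?_ (by simp)
      convert! T2.mul_left z using 2 with n
      simp only [d]
      push_cast
      ring
    have T := ((T2.sub T3).add ((S1.mul_left c).sub (T1.mul_left (a + b + 1)))).sub
      (S0.mul_left (a * b))
    have hz0 : ∀ n : ℕ, n * d n * z ^ n - n * (n - 1) * h n * z ^ n +
        (c * (d n * z ^ n) - (a + b + 1) * (n * h n * z ^ n)) - a * b * (h n * z ^ n) = 0 := by
      intro n
      have hcn : c + n ≠ 0 := fun H => hc n (eq_neg_of_add_eq_zero_left H)
      have hn : (n : ℂ) + 1 ≠ 0 := Nat.cast_add_one_ne_zero n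
      have : (c + n) * d n = (a + n) * (b + n) * h n := by
        simp only [d, h]
        rw [hgc_succ]
        field_simp
      linear_combination z ^ n * this
    simp only [hz0] at T
    have := T.unique hasSum_zero
    linear_combination this

theorem ascPochhammer_eval_succ_left (x : ℂ) (n : ℕ) :
    (ascPochhammer ℂ (n + 1)).eval x = x * (ascPochhammer ℂ n).eval (x + 1) := by
  simp [ascPochhammer_succ_left]

theorem ascPochhammer_eval_add (x : ℂ) (k j : ℕ) :
    (ascPochhammer ℂ (k + j)).eval x =
      (ascPochhammer ℂ k).eval x * (ascPochhammer ℂ j).eval (x + k) := by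
  rw [← ascPochhammer_mul]
  simp

theorem ascPochhammer_eval_ne_zero {c : ℂ} (hc : ∀ m : ℕ, c ≠ -(m : ℂ)) (n : ℕ) :
    (ascPochhammer ℂ n).eval c ≠ 0 := fun h => by
  obtain ⟨k, -, hk⟩ := (ascPochhammer_eval_eq_zero_iff n c).1 h
  exact hc k (by rw [hk, neg_neg])

theorem sum_alternating_choose_succ (f : ℕ → ℂ) (n : ℕ) :
    ∑ k ∈ Finset.range (n + 2), (-1) ^ k * ((n + 1).choose k : ℂ) * f k =
      ∑ k ∈ Finset.range (n + 1), (-1) ^ k * (n.choose k : ℂ) * (f k - f (k + 1)) := by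
  have h1 : ∑ k ∈ Finset.range (n + 1), (-1) ^ k * (n.choose k : ℂ) * f k =
      ∑ k ∈ Finset.range (n + 1), (-1) ^ (k + 1) * (n.choose (k + 1) : ℂ) * f (k + 1) + f 0 := by
    have := Finset.sum_range_succ' (fun k => (-1) ^ k * (n.choose k : ℂ) * f k) (n + 1)
    rw [Finset.sum_range_succ] at this
    simpa using this
  rw [Finset.sum_range_succ']
  simp only [mul_sub, Finset.sum_sub_distrib, h1, Nat.choose_succ_succ, Nat.cast_add, mul_add,
    add_mul, Finset.sum_add_distrib, pow_succ]
  simp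
  ring

/-- The Chu-Vandermonde identity. -/
theorem chu_vandermonde (b : ℂ) (n : ℕ) : ∀ {c : ℂ}, (∀ m : ℕ, c ≠ -(m : ℂ)) →
    ∑ k ∈ Finset.range (n + 1), (-1) ^ k * (n.choose k : ℂ) *
      ((ascPochhammer ℂ k).eval b / (ascPochhammer ℂ k).eval c) =
      (ascPochhammer ℂ n).eval (c - b) / (ascPochhammer ℂ n).eval c := by
  induction n with
  | zero => intro c _; simp
  | succ n ih =>
    intro c hc
    have hc1 : ∀ m : ℕ, c + 1 ≠ -(m : ℂ) := fun m h => hc (m + 1) (by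
      push_cast
      linear_combination h)
    have hc0 : c ≠ 0 := by simpa using hc 0
    rw [sum_alternating_choose_succ, ascPochhammer_eval_succ_left, ascPochhammer_eval_succ_left,
      mul_div_mul_comm, show c - b + 1 = c + 1 - b by ring, ← ih hc1, Finset.mul_sum]
    refine Finset.sum_congr rfl fun k _ => ?_
    have h1 := ascPochhammer_eval_ne_zero hc k
    have h2 := ascPochhammer_eval_ne_zero hc1 k
    have hck : c + k ≠ 0 := fun H => hc k (eq_neg_of_add_eq_zero_left H)
    have e : (ascPochhammer ℂ k).eval c * (c + k) = c * (ascPochhammer ℂ k).eval (c + 1) := by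
      rw [← ascPochhammer_eval_succ_left, ascPochhammer_succ_eval]
    rw [ascPochhammer_succ_eval, ascPochhammer_succ_eval, e]
    have e' : (ascPochhammer ℂ k).eval c = c * (ascPochhammer ℂ k).eval (c + 1) / (c + k) := by
      rw [← e]; field_simp
    rw [e']
    field_simp
    ring

theorem ringChoose_eq_ascPochhammer_div (a : ℂ) (n : ℕ) :
    Ring.choose (a + n - 1) n = (ascPochhammer ℂ n).eval a / n.factorial := by
  rw [Ring.choose, show a + n - 1 - n + 1 = a by ring,
    eq_div_iff (Nat.cast_ne_zero.2 n.factorial_ne_zero), mul_comm, ← nsmul_eq_mul,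
    Ring.factorial_nsmul_multichoose_eq_ascPochhammer, ← ascPochhammer_map (algebraMap ℕ ℂ)]
  rw [Polynomial.eval_map_algebraMap, Polynomial.aeval_eq_smeval]

theorem hasSum_one_sub_cpow_neg (a : ℂ) {z : ℂ} (hz : ‖z‖ < 1) :
    HasSum (fun n : ℕ => (ascPochhammer ℂ n).eval a / n.factorial * z ^ n) ((1 - z) ^ (-a)) := by
  have h := (Complex.one_div_one_sub_cpow_hasFPowerSeriesOnBall_zero a).hasSum (y := z)
    (by simpa [enorm_eq_nnnorm, ← NNReal.coe_lt_coe] using hz)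
  simp only [FormalMultilinearSeries.ofScalars_apply_eq, smul_eq_mul, zero_add,
    ringChoose_eq_ascPochhammer_div, one_div, ← Complex.cpow_neg] at h
  exact h

theorem norm_ascPochhammer_div_factorial_le {a : ℂ} {N : ℕ} (ha : ‖a‖ ≤ N) (j : ℕ) :
    ‖(ascPochhammer ℂ j).eval a / j.factorial‖ ≤ 2 ^ (N + j) := by
  have h : ‖(ascPochhammer ℂ j).eval a‖ ≤ ((N + 1).ascFactorial j : ℝ) := by
    induction j with
    | zero => simp
    | succ j ih =>
      rw [ascPochhammer_succ_eval, norm_mul, Nat.ascFactorial_succ, mul_comm, Nat.cast_mul]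
      have : ‖a + j‖ ≤ ((N + 1 + j : ℕ) : ℝ) := (norm_add_le _ _).trans (by
        rw [Complex.norm_natCast]
        push_cast
        linarith)
      gcongr
  rw [norm_div, Complex.norm_natCast, div_le_iff₀ (by positivity)]
  refine h.trans ?_
  rw [Nat.ascFactorial_eq_factorial_mul_choose, Nat.cast_mul, mul_comm]
  have := Nat.choose_le_two_pow (N + j) j
  gcongr
  exact_mod_cast this

/-- Pfaff's transformation near the origin. -/
theorem hypergeometric_pfaff_of_norm_lt (a b : ℂ) {c : ℂ} (hc : ∀ m : ℕ, c ≠ -(m : ℂ)) {z : ℂ}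
    (hz : ‖z‖ < 1 / 4) : HG a b c z = (1 - z) ^ (-a) * HG a (c - b) c (z / (z - 1)) := by
  have hz1 : ‖z‖ < 1 := by linarith
  have hz0 : 1 - z ≠ 0 := fun h => by
    rw [← sub_eq_zero.1 h, norm_one] at hz
    linarith
  let h := hgc a (c - b) c
  let T : ℕ × ℕ → ℂ := fun p => h p.1 * (-1) ^ p.1 * ((ascPochhammer ℂ p.2).eval (a + p.1) /
    p.2.factorial) * z ^ (p.1 + p.2)
  obtain ⟨M, hM⟩ := exists_nat_ge ‖a‖
  have hT : Summable T := by
    have s1 := summable_norm_hgc_mul_pow a (c - b) c (2 * ‖z‖) (by positivity) (by linarith)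
    have s2 : Summable fun j : ℕ => (2 * ‖z‖) ^ j :=
      summable_geometric_of_lt_one (by positivity) (by linarith)
    refine Summable.of_norm_bounded ((s1.mul_of_nonneg s2 (fun k => ?_) (fun j => ?_)).mul_left
      ((2 : ℝ) ^ M)) fun p => ?_
    · positivity
    · positivity
    · have hk : ‖a + p.1‖ ≤ ((M + p.1 : ℕ) : ℝ) := (norm_add_le _ _).trans (by
        rw [Complex.norm_natCast]
        push_cast
        linarith)
      have := norm_ascPochhammer_div_factorial_le hk p.2
      simp only [T, norm_mul, norm_pow, norm_neg, norm_one, one_pow, mul_one]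
      calc _ ≤ ‖h p.1‖ * 2 ^ (M + p.1 + p.2) * ‖z‖ ^ (p.1 + p.2) := by gcongr
        _ = _ := by simp only [h]; ring
  have hin : ∀ k, HasSum (fun j => T (k, j)) ((1 - z) ^ (-a) * (h k * (z / (z - 1)) ^ k)) := by
    intro k
    convert! (hasSum_one_sub_cpow_neg (a + k) hz1).mul_left (h k * (-1) ^ k * z ^ k) using 1
    · funext j
      simp only [T]
      ring
    · rw [neg_add, Complex.cpow_add _ _ hz0, Complex.cpow_neg _ (k : ℂ), Complex.cpow_natCast,
        ← neg_sub 1 z, div_neg, neg_pow, div_pow]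
      field_simp
  have e1 : (1 - z) ^ (-a) * HG a (c - b) c (z / (z - 1)) = ∑' p, T p := by
    rw [hypergeometric_eq_tsum, ← tsum_mul_left]
    exact (hT.hasSum.prod_fiberwise hin).tsum_eq
  have e2 := (Finset.HasAntidiagonal.sigmaAntidiagonalEquivProd.hasSum_iff.2 hT.hasSum).sigma
    (fun n => hasSum_fintype _)
  rw [e1, hypergeometric_eq_tsum, ← e2.tsum_eq]
  refine tsum_congr fun n => ?_
  have e3 : ∑ p : Finset.HasAntidiagonal.antidiagonal n, T p = ∑ k ∈ Finset.range (n + 1), T (k, n - k) := by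
    rw [Finset.sum_coe_sort, Finset.Nat.sum_antidiagonal_eq_sum_range_succ_mk]
  refine Eq.trans ?_ e3.symm
  have cv := chu_vandermonde (c - b) n hc
  rw [sub_sub_cancel] at cv
  have : hgc a b c n * z ^ n = (ascPochhammer ℂ n).eval a / n.factorial * z ^ n *
      ((ascPochhammer ℂ n).eval b / (ascPochhammer ℂ n).eval c) := by
    simp only [hgc]
    ring
  rw [this, ← cv, Finset.mul_sum]
  refine Finset.sum_congr rfl fun k hk => ?_
  have hkn : k ≤ n := Nat.lt_succ_iff.1 (Finset.mem_range.1 hk)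
  have ea := ascPochhammer_eval_add a k (n - k)
  rw [Nat.add_sub_cancel' hkn] at ea
  simp only [T, h, hgc, Nat.add_sub_cancel' hkn, ea, Nat.cast_choose ℂ hkn]
  have f1 : (n.factorial : ℂ) ≠ 0 := Nat.cast_ne_zero.2 n.factorial_ne_zero
  have f2 : (k.factorial : ℂ) ≠ 0 := Nat.cast_ne_zero.2 k.factorial_ne_zero
  have f3 : ((n - k).factorial : ℂ) ≠ 0 := Nat.cast_ne_zero.2 (n - k).factorial_ne_zero
  have f4 := ascPochhammer_eval_ne_zero hc k
  field_simp

/-- The hypergeometric function as a function of `u = z / (z - 1)`, on the unit disc. -/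
noncomputable def psi (a b c u : ℂ) : ℂ := (1 - u) ^ a * HG a (c - b) c u

theorem one_sub_mem_slitPlane {u : ℂ} (hu : ‖u‖ < 1) : 1 - u ∈ Complex.slitPlane := by
  rw [sub_eq_add_neg]
  exact Complex.mem_slitPlane_of_norm_lt_one (by rwa [norm_neg])

theorem analyticAt_psi_param {a b : ℂ → ℂ} (ha : Differentiable ℂ a) (hb : Differentiable ℂ b)
    (c l : ℂ) {u : ℂ} (hu : ‖u‖ < 1) :
    AnalyticAt ℂ (fun p : ℂ × ℂ => psi (a p.1) (b p.1) c p.2) (l, u) := by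
  have h1 := analyticAt_hypergeometric ha ((differentiable_const c).sub hb) c l hu
  have h2 : AnalyticAt ℂ (fun p : ℂ × ℂ => a p.1) (l, u) :=
    (ha.analyticAt l).comp_of_eq analyticAt_fst rfl
  have h3 : AnalyticAt ℂ (fun p : ℂ × ℂ => 1 - p.2) (l, u) := analyticAt_const.sub analyticAt_snd
  exact (h3.cpow h2 (one_sub_mem_slitPlane hu)).mul h1

theorem analyticAt_psi (a b c : ℂ) {u : ℂ} (hu : ‖u‖ < 1) : AnalyticAt ℂ (psi a b c) u :=
  (analyticAt_psi_param (differentiable_const a) (differentiable_const b) c 0 hu).comp_of_eq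
    (analyticAt_const.prod analyticAt_id) rfl

theorem psi_eq_hypergeometric_of_norm_lt (a b : ℂ) {c : ℂ} (hc : ∀ m : ℕ, c ≠ -(m : ℂ)) {u : ℂ}
    (hu : ‖u‖ < 1 / 5) : psi a b c u = HG a b c (u / (u - 1)) := by
  have hu1 : ‖u‖ < 1 := by linarith
  have hs := one_sub_mem_slitPlane hu1
  have hu0 : 1 - u ≠ 0 := Complex.slitPlane_ne_zero hs
  have hu0' : u - 1 ≠ 0 := by rwa [← neg_sub, neg_ne_zero]
  have hn : ‖u / (u - 1)‖ < 1 / 4 := by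
    rw [norm_div, div_lt_iff₀ (norm_pos_iff.2 hu0')]
    have := norm_sub_norm_le 1 u
    rw [norm_one, norm_sub_rev] at this
    linarith
  have e1 : 1 - u / (u - 1) = (1 - u)⁻¹ := by
    rw [← neg_sub u 1]
    field_simp
    ring
  have e2 : u / (u - 1) / (u / (u - 1) - 1) = u := by
    have : u / (u - 1) - 1 = 1 / (u - 1) := by field_simp; ring
    rw [this]
    field_simp
  rw [hypergeometric_pfaff_of_norm_lt a b hc hn, e1, e2, psi, Complex.inv_cpow _ _
    (Complex.slitPlane_arg_ne_pi hs), Complex.cpow_neg, inv_inv]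

/-- Euler's transformation. -/
theorem psi_comm (a b : ℂ) {c : ℂ} (hc : ∀ m : ℕ, c ≠ -(m : ℂ)) {u : ℂ} (hu : ‖u‖ < 1) :
    psi a b c u = psi b a c u := by
  have h := AnalyticOnNhd.eqOn_of_preconnected_of_eventuallyEq (𝕜 := ℂ) (f := psi a b c)
    (g := psi b a c) (U := ball 0 1) (fun u hu => analyticAt_psi a b c (mem_ball_zero_iff.1 hu))
    (fun u hu => analyticAt_psi b a c (mem_ball_zero_iff.1 hu))
    (convex_ball _ _).isPreconnected (mem_ball_self one_pos) ?_
  · exact h (mem_ball_zero_iff.2 hu)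
  · filter_upwards [ball_mem_nhds (0 : ℂ) (show (0 : ℝ) < 1 / 5 by norm_num)] with u hu
    have hu' := mem_ball_zero_iff.1 hu
    rw [psi_eq_hypergeometric_of_norm_lt a b hc hu', psi_eq_hypergeometric_of_norm_lt b a hc hu',
      hypergeometric_comm]

/-- Pfaff's transformation on the half plane where both series converge. -/
theorem psi_eq_hypergeometric (a b : ℂ) {c : ℂ} (hc : ∀ m : ℕ, c ≠ -(m : ℂ)) {u : ℂ}
    (hu : ‖u‖ < 1) (hu2 : u.re < 1 / 2) : psi a b c u = HG a b c (u / (u - 1)) := by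
  have hmem : ∀ u ∈ ball (0 : ℂ) 1 ∩ {u | u.re < 1 / 2}, ‖u‖ < 1 ∧ u - 1 ≠ 0 ∧
      ‖u / (u - 1)‖ < 1 := by
    intro u hu
    have h1 := mem_ball_zero_iff.1 hu.1
    have h0 : u - 1 ≠ 0 := fun h => by
      rw [sub_eq_zero.1 h, norm_one] at h1
      exact lt_irrefl _ h1
    refine ⟨h1, h0, ?_⟩
    rw [norm_div, div_lt_one (norm_pos_iff.2 h0)]
    refine lt_of_pow_lt_pow_left₀ 2 (norm_nonneg _) ?_
    rw [← Complex.normSq_eq_norm_sq, ← Complex.normSq_eq_norm_sq, Complex.normSq_apply,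
      Complex.normSq_apply]
    have : u.re < 1 / 2 := hu.2
    simp
    nlinarith
  have h := AnalyticOnNhd.eqOn_of_preconnected_of_eventuallyEq (𝕜 := ℂ) (f := psi a b c)
    (g := fun u => HG a b c (u / (u - 1))) (U := ball 0 1 ∩ {u | u.re < 1 / 2})
    (fun u hu => analyticAt_psi a b c (hmem u hu).1)
    (fun u hu => (analyticAt_hypergeometric_right a b c (hmem u hu).2.2).comp_of_eq
      (analyticAt_id.div (analyticAt_id.sub analyticAt_const) (hmem u hu).2.1) rfl)
    ((convex_ball _ _).inter (convex_halfSpace_re_lt _)).isPreconnected (z₀ := 0)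
    ⟨mem_ball_self one_pos, by norm_num⟩ ?_
  · exact h ⟨mem_ball_zero_iff.2 hu, hu2⟩
  · filter_upwards [ball_mem_nhds (0 : ℂ) (show (0 : ℝ) < 1 / 5 by norm_num)] with u hu
    exact psi_eq_hypergeometric_of_norm_lt a b hc (mem_ball_zero_iff.1 hu)

theorem gauss2F1_neg_sinh_sq (a b : ℂ) {c : ℂ} (hc : ∀ m : ℕ, c ≠ -(m : ℂ)) (t : ℝ) :
    gauss2F1 a b c ((-(Real.sinh t) ^ 2 : ℝ) : ℂ) = psi a b c ((Real.tanh t ^ 2 : ℝ) : ℂ) := by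
  have hch := Real.cosh_sq t
  have hpos : 0 < Real.cosh t ^ 2 := pow_pos (Real.cosh_pos t) 2
  have hu : Real.tanh t ^ 2 = Real.sinh t ^ 2 / Real.cosh t ^ 2 := by
    rw [Real.tanh_eq_sinh_div_cosh, div_pow]
  have e1 : (Real.tanh t ^ 2) / (Real.tanh t ^ 2 - 1) = -(Real.sinh t) ^ 2 := by
    have : Real.tanh t ^ 2 - 1 = -1 / Real.cosh t ^ 2 := by
      rw [hu, hch]
      field_simp
      ring
    rw [this, hu]
    field_simp
  have e2 : -(Real.sinh t) ^ 2 / (-(Real.sinh t) ^ 2 - 1) = Real.tanh t ^ 2 := by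
    rw [hu, hch]
    have : -(Real.sinh t) ^ 2 - 1 ≠ 0 := by nlinarith [sq_nonneg (Real.sinh t)]
    have : Real.sinh t ^ 2 + 1 ≠ 0 := by nlinarith [sq_nonneg (Real.sinh t)]
    rw [div_eq_div_iff ‹_› ‹_›]
    ring
  have e3 : 1 - -(Real.sinh t) ^ 2 = (1 - Real.tanh t ^ 2)⁻¹ := by
    rw [hu, hch]
    have : Real.sinh t ^ 2 + 1 ≠ 0 := by nlinarith [sq_nonneg (Real.sinh t)]
    field_simp
    ring
  have hlt : Real.tanh t ^ 2 < 1 := by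
    rw [hu, div_lt_one hpos]
    linarith
  have h0 : 0 ≤ Real.tanh t ^ 2 := sq_nonneg _
  have hn : ‖((Real.tanh t ^ 2 : ℝ) : ℂ)‖ < 1 := by
    rwa [Complex.norm_real, Real.norm_of_nonneg h0]
  rw [gauss2F1]
  split_ifs with h
  · rw [Complex.norm_real, Real.norm_eq_abs, abs_neg, abs_of_nonneg (sq_nonneg _)] at h
    rw [psi_eq_hypergeometric a b hc hn]
    · congr 1
      rw [← e1]
      push_cast
      ring
    · rw [Complex.ofReal_re, hu, div_lt_iff₀ hpos]
      linarith
  · have := congrArg (fun x : ℝ => (x : ℂ)) e2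
    have h3 := congrArg (fun x : ℝ => (x : ℂ)) e3
    simp only [Complex.ofReal_div, Complex.ofReal_sub, Complex.ofReal_one, Complex.ofReal_inv]
      at this h3
    rw [this, h3, psi, Complex.inv_cpow _ _ (Complex.slitPlane_arg_ne_pi
      (one_sub_mem_slitPlane hn)), Complex.cpow_neg, inv_inv]

theorem tendsto_inv_GammaSeq (s : ℂ) :
    Tendsto (fun n => (Complex.GammaSeq s n)⁻¹) atTop (𝓝 (Complex.Gamma s)⁻¹) := by
  by_cases hs : Complex.Gamma s = 0
  · obtain ⟨m, hm⟩ := (Complex.Gamma_eq_zero_iff s).1 hs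
    rw [hs, inv_zero]
    refine tendsto_const_nhds.congr' ?_
    filter_upwards [eventually_ge_atTop m] with n hn
    rw [Complex.GammaSeq, Finset.prod_eq_zero (Finset.mem_range.2 (Nat.lt_succ_of_le hn))
      (by rw [hm]; ring), div_zero, inv_zero]
  · exact (Complex.GammaSeq_tendsto_Gamma s).inv₀ hs

theorem ascPochhammer_eval_eq_GammaSeq (s : ℂ) {n : ℕ} (hn : n ≠ 0) :
    (ascPochhammer ℂ (n + 1)).eval s =
      (n : ℂ) ^ s * n.factorial * (Complex.GammaSeq s n)⁻¹ := by
  have h1 : (n : ℂ) ^ s ≠ 0 := by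
    rw [Complex.cpow_ne_zero_iff]
    exact Or.inl (Nat.cast_ne_zero.2 hn)
  have h2 : (n.factorial : ℂ) ≠ 0 := Nat.cast_ne_zero.2 n.factorial_ne_zero
  rw [Complex.GammaSeq, inv_div, mul_div_cancel₀ _ (mul_ne_zero h1 h2)]
  generalize n + 1 = m
  induction m with
  | zero => simp
  | succ m ih => rw [ascPochhammer_succ_eval, ih, Finset.prod_range_succ]

theorem hgc_succ_eq_GammaSeq (a b c : ℂ) {n : ℕ} (hn : n ≠ 0) :
    hgc a b c (n + 1) = (n : ℂ) ^ (a + b - c) / (n + 1) *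
      ((Complex.GammaSeq a n)⁻¹ * (Complex.GammaSeq b n)⁻¹ * Complex.GammaSeq c n) := by
  have hn' : (n : ℂ) ≠ 0 := Nat.cast_ne_zero.2 hn
  have h1 : (n : ℂ) ^ c ≠ 0 := by
    rw [Complex.cpow_ne_zero_iff]
    exact Or.inl hn'
  have h2 : (n.factorial : ℂ) ≠ 0 := Nat.cast_ne_zero.2 n.factorial_ne_zero
  have h3 : (n : ℂ) + 1 ≠ 0 := Nat.cast_add_one_ne_zero n
  rw [hgc, ascPochhammer_eval_eq_GammaSeq a hn, ascPochhammer_eval_eq_GammaSeq b hn,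
    ascPochhammer_eval_eq_GammaSeq c hn, Complex.cpow_sub _ _ hn', Complex.cpow_add _ _ hn',
    Nat.factorial_succ, mul_inv, inv_inv, Nat.cast_mul, Nat.cast_succ]
  field_simp

theorem exists_norm_hgc_succ_le (a b c : ℂ) : ∃ C : ℝ, 0 ≤ C ∧ ∀ n : ℕ, n ≠ 0 →
    ‖hgc a b c (n + 1)‖ ≤ C * ((n : ℝ) ^ (-(c - a - b).re) / (n + 1)) := by
  have ht := (((tendsto_inv_GammaSeq a).mul (tendsto_inv_GammaSeq b)).mul
    (Complex.GammaSeq_tendsto_Gamma c)).norm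
  obtain ⟨C, hC⟩ := ht.bddAbove_range
  have hC' : ∀ n, ‖(Complex.GammaSeq a n)⁻¹ * (Complex.GammaSeq b n)⁻¹ * Complex.GammaSeq c n‖ ≤ C :=
    fun n => hC ⟨n, rfl⟩
  refine ⟨C, (norm_nonneg _).trans (hC' 0), fun n hn => ?_⟩
  rw [hgc_succ_eq_GammaSeq a b c hn, norm_mul, norm_div, mul_comm,
    Complex.norm_natCast_cpow_of_pos (Nat.pos_of_ne_zero hn)]
  have e : ‖(n : ℂ) + 1‖ = n + 1 := by
    rw [← Nat.cast_succ, Complex.norm_natCast, Nat.cast_succ]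
  have e2 : (a + b - c).re = -(c - a - b).re := by simp; ring
  rw [e, e2]
  gcongr
  exact hC' n

theorem summable_norm_hgc {a b c : ℂ} (h : 0 < (c - a - b).re) :
    Summable fun n => ‖hgc a b c n‖ := by
  obtain ⟨C, hC0, hC⟩ := exists_norm_hgc_succ_le a b c
  rw [← summable_nat_add_iff 2]
  have hs : Summable fun n : ℕ => C * (1 / ((n + 1 : ℕ) : ℝ) ^ ((c - a - b).re + 1)) :=
    ((summable_nat_add_iff 1).2 (Real.summable_one_div_nat_rpow.2 (by linarith))).mul_left C
  refine Summable.of_nonneg_of_le (fun n => norm_nonneg _) (fun n => ?_) hs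
  refine (hC (n + 1) (Nat.succ_ne_zero n)).trans ?_
  have hp : (0 : ℝ) < ((n + 1 : ℕ) : ℝ) := by positivity
  rw [Real.rpow_add hp, Real.rpow_one, one_div, mul_inv, Real.rpow_neg hp.le, div_eq_mul_inv]
  gcongr
  linarith

theorem tendsto_natCast_mul_hgc {a b c : ℂ} (h : 0 < (c - a - b).re) :
    Tendsto (fun n : ℕ => (n : ℂ) * hgc a b c n) atTop (𝓝 0) := by
  obtain ⟨C, hC0, hC⟩ := exists_norm_hgc_succ_le a b c
  rw [← tendsto_add_atTop_iff_nat 1]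
  have ht : Tendsto (fun n : ℕ => C * (n : ℝ) ^ (-(c - a - b).re)) atTop (𝓝 0) := by
    simpa using ((tendsto_rpow_neg_atTop h).comp tendsto_natCast_atTop_atTop).const_mul C
  refine squeeze_zero_norm' ?_ ht
  filter_upwards [eventually_ne_atTop 0] with n hn
  have hp : (0 : ℝ) < (n : ℝ) + 1 := by positivity
  rw [norm_mul, Complex.norm_natCast]
  calc _ ≤ ((n + 1 : ℕ) : ℝ) * (C * ((n : ℝ) ^ (-(c - a - b).re) / (n + 1))) := by
        gcongr
        exact hC n hn
    _ = _ := by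
        push_cast
        field_simp

theorem hgc_add_one_right (a b : ℂ) {c : ℂ} (hc : ∀ m : ℕ, c ≠ -(m : ℂ)) (n : ℕ) :
    hgc a b (c + 1) n = hgc a b c n * (c / (c + n)) := by
  have h0 : c ≠ 0 := by simpa using hc 0
  have hck : c + n ≠ 0 := fun H => hc n (eq_neg_of_add_eq_zero_left H)
  have e : (ascPochhammer ℂ n).eval c * (c + n) = c * (ascPochhammer ℂ n).eval (c + 1) := by
    rw [← ascPochhammer_eval_succ_left, ascPochhammer_succ_eval]
  have e' : (ascPochhammer ℂ n).eval c = c * (ascPochhammer ℂ n).eval (c + 1) / (c + n) := by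
    rw [← e]; field_simp
  rw [hgc, hgc, e', inv_div]
  field_simp

/-- The contiguity relation between the values at `1` for the parameters `c` and `c + 1`. -/
theorem tsum_hgc_contiguous {a b c : ℂ} (hc : ∀ m : ℕ, c ≠ -(m : ℂ)) (h : 0 < (c - a - b).re) :
    (c - a) * (c - b) * ∑' n, hgc a b (c + 1) n = c * (c - a - b) * ∑' n, hgc a b c n := by
  have h' : 0 < (c + 1 - a - b).re := by
    simp at h ⊢
    linarith
  have s0 := (summable_norm_hgc h).of_norm.hasSum
  have s1 := (summable_norm_hgc h').of_norm.hasSum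
  have s2 := (s1.mul_left ((c - a) * (c - b))).sub (s0.mul_left (c * (c - a - b)))
  have ht : ∀ N : ℕ, ∑ n ∈ Finset.range N, ((c - a) * (c - b) * hgc a b (c + 1) n -
      c * (c - a - b) * hgc a b c n) = c * (N * hgc a b c N) := by
    intro N
    induction N with
    | zero => simp
    | succ N ih =>
      have hck : c + N ≠ 0 := fun H => hc N (eq_neg_of_add_eq_zero_left H)
      have hN : (N : ℂ) + 1 ≠ 0 := Nat.cast_add_one_ne_zero N
      rw [Finset.sum_range_succ, ih, hgc_add_one_right a b hc, hgc_succ]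
      push_cast
      field_simp
      ring
  have t := s2.tendsto_sum_nat
  simp only [ht] at t
  have t0 := (tendsto_natCast_mul_hgc h).const_mul c
  rw [mul_zero] at t0
  have := tendsto_nhds_unique t t0
  linear_combination this

theorem norm_ascPochhammer_eval_le (a : ℂ) (n : ℕ) :
    ‖(ascPochhammer ℂ n).eval a‖ ≤ ‖(ascPochhammer ℂ n).eval (‖a‖ : ℂ)‖ := by
  induction n with
  | zero => simp
  | succ n ih =>
    rw [ascPochhammer_succ_eval, ascPochhammer_succ_eval, norm_mul, norm_mul]
    have : ‖a + n‖ ≤ ‖(‖a‖ : ℂ) + n‖ := by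
      rw [← Complex.ofReal_natCast, ← Complex.ofReal_add, Complex.norm_real, Real.norm_of_nonneg
        (by positivity)]
      exact (norm_add_le _ _).trans (by simp)
    gcongr

theorem norm_ascPochhammer_eval_ge {x : ℝ} (hx : 0 < x) {c : ℂ} (hc : x ≤ c.re) (n : ℕ) :
    0 < ‖(ascPochhammer ℂ n).eval (x : ℂ)‖ ∧
      ‖(ascPochhammer ℂ n).eval (x : ℂ)‖ ≤ ‖(ascPochhammer ℂ n).eval c‖ := by
  induction n with
  | zero => simp
  | succ n ih =>
    rw [ascPochhammer_succ_eval, ascPochhammer_succ_eval, norm_mul, norm_mul]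
    have e : ‖(x : ℂ) + n‖ = x + n := by
      rw [← Complex.ofReal_natCast, ← Complex.ofReal_add, Complex.norm_real, Real.norm_of_nonneg
        (by positivity)]
    have : ‖(x : ℂ) + n‖ ≤ ‖c + n‖ := by
      rw [e]
      refine le_trans ?_ (Complex.re_le_norm _)
      simpa using hc
    have hp : 0 < ‖(x : ℂ) + n‖ := by rw [e]; positivity
    exact ⟨mul_pos ih.1 hp, mul_le_mul ih.2 this hp.le (norm_nonneg _)⟩

theorem tendsto_tsum_hgc_add_natCast (a b c : ℂ) :
    Tendsto (fun N : ℕ => ∑' n, hgc a b (c + N) n) atTop (𝓝 1) := by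
  let x : ℝ := ‖a‖ + ‖b‖ + 1
  have hx : 0 < x := by positivity
  have hs : Summable fun n => ‖hgc (‖a‖ : ℂ) (‖b‖ : ℂ) (x : ℂ) n‖ := summable_norm_hgc (by simp [x]; linarith)
  have hlim : ∀ n, Tendsto (fun N : ℕ => hgc a b (c + N) n) atTop
      (𝓝 (if n = 0 then 1 else 0)) := by
    intro n
    cases n with
    | zero => simp [hgc_zero]
    | succ n =>
      simp only [Nat.succ_ne_zero, if_false, hgc]
      have h1 : Tendsto (fun N : ℕ => (ascPochhammer ℂ (n + 1)).eval (c + N)) atTop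
          (Bornology.cobounded ℂ) := by
        have hd : 0 < (ascPochhammer ℂ (n + 1)).degree := by
          rw [Polynomial.degree_eq_natDegree (monic_ascPochhammer ℂ (n + 1)).ne_zero,
            ascPochhammer_natDegree]
          exact_mod_cast Nat.succ_pos n
        have hcN : Tendsto (fun N : ℕ => ‖c + N‖) atTop atTop := by
          refine tendsto_atTop_mono (fun N => ?_) (tendsto_atTop_add_const_right atTop (-‖c‖)
            (tendsto_natCast_atTop_atTop (R := ℝ)))
          have := norm_sub_le (c + N) c
          rw [add_sub_cancel_left, Complex.norm_natCast] at this
          linarith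
        rw [← tendsto_norm_atTop_iff_cobounded]
        exact Polynomial.tendsto_norm_atTop _ hd hcN
      simpa using (tendsto_inv₀_cobounded.comp h1).const_mul
        (((n + 1).factorial : ℂ)⁻¹ * (ascPochhammer ℂ (n + 1)).eval a *
          (ascPochhammer ℂ (n + 1)).eval b)
  have h1 : ∑' n : ℕ, (if n = 0 then (1 : ℂ) else 0) = 1 := by simp
  rw [← h1]
  refine tendsto_tsum_of_dominated_convergence hs hlim ?_
  obtain ⟨N₀, hN₀⟩ := exists_nat_ge (x - c.re)
  filter_upwards [eventually_ge_atTop N₀] with N hN n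
  have hre : x ≤ (c + N).re := by
    have : (N₀ : ℝ) ≤ N := by exact_mod_cast hN
    simp
    linarith
  obtain ⟨p1, p2⟩ := norm_ascPochhammer_eval_ge hx hre n
  simp only [hgc, norm_mul, norm_inv]
  have := norm_ascPochhammer_eval_le a n
  have := norm_ascPochhammer_eval_le b n
  gcongr

/-- Gauss's summation theorem. -/
theorem tsum_hgc_eq_Gamma {a b c : ℂ} (hc : ∀ m : ℕ, c ≠ -(m : ℂ)) (h : 0 < (c - a - b).re) :
    ∑' n, hgc a b c n = Complex.Gamma c * Complex.Gamma (c - a - b) /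
      (Complex.Gamma (c - a) * Complex.Gamma (c - b)) := by
  have hδ : ∀ m : ℕ, c - a - b ≠ -(m : ℂ) := fun m hm => by
    rw [hm] at h
    simp at h
    have : (0 : ℝ) ≤ m := Nat.cast_nonneg m
    linarith
  have hit : ∀ N : ℕ, (ascPochhammer ℂ N).eval c * (ascPochhammer ℂ N).eval (c - a - b) *
      ∑' n, hgc a b c n = (ascPochhammer ℂ N).eval (c - a) * (ascPochhammer ℂ N).eval (c - b) *
      ∑' n, hgc a b (c + N) n := by
    intro N
    induction N with
    | zero => simp
    | succ N ih =>
      have hcN : ∀ m : ℕ, c + N ≠ -(m : ℂ) := fun m hm => hc (m + N) (by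
        push_cast
        linear_combination hm)
      have hN : 0 < (c + N - a - b).re := by
        have : (0 : ℝ) ≤ N := Nat.cast_nonneg N
        simp at h ⊢
        linarith
      have := tsum_hgc_contiguous hcN hN
      simp only [ascPochhammer_succ_eval]
      push_cast
      rw [← add_assoc]
      linear_combination (c + N) * (c - a - b + N) * ih -
        (ascPochhammer ℂ N).eval (c - a) * (ascPochhammer ℂ N).eval (c - b) * this
  have t := ((tendsto_tsum_hgc_add_natCast a b c).comp (tendsto_add_atTop_nat 1)).mul
    ((((tendsto_inv_GammaSeq (c - a)).mul (tendsto_inv_GammaSeq (c - b))).mul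
      (Complex.GammaSeq_tendsto_Gamma c)).mul (Complex.GammaSeq_tendsto_Gamma (c - a - b)))
  have t' : Tendsto (fun _ : ℕ => ∑' n, hgc a b c n) atTop (𝓝 (1 * ((Complex.Gamma (c - a))⁻¹ *
      (Complex.Gamma (c - b))⁻¹ * Complex.Gamma c * Complex.Gamma (c - a - b)))) := by
    refine t.congr' ?_
    filter_upwards [eventually_ne_atTop 0] with n hn
    have e := hit (n + 1)
    have n1 := ascPochhammer_eval_ne_zero hc (n + 1)
    have n2 := ascPochhammer_eval_ne_zero hδ (n + 1)
    have hn' : (n : ℂ) ≠ 0 := Nat.cast_ne_zero.2 hn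
    rw [ascPochhammer_eval_eq_GammaSeq _ hn] at e n1 n2
    rw [ascPochhammer_eval_eq_GammaSeq _ hn, ascPochhammer_eval_eq_GammaSeq _ hn,
      ascPochhammer_eval_eq_GammaSeq _ hn] at e
    have g1 : Complex.GammaSeq c n ≠ 0 := fun h0 => n1 (by rw [h0]; simp)
    have g2 : Complex.GammaSeq (c - a - b) n ≠ 0 := fun h0 => n2 (by rw [h0]; simp)
    have p : ∀ s : ℂ, (n : ℂ) ^ s ≠ 0 := fun s => by
      rw [Complex.cpow_ne_zero_iff]
      exact Or.inl hn'
    have f : (n.factorial : ℂ) ≠ 0 := Nat.cast_ne_zero.2 n.factorial_ne_zero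
    have hp : (n : ℂ) ^ c * (n : ℂ) ^ (c - a - b) = (n : ℂ) ^ (c - a) * (n : ℂ) ^ (c - b) := by
      rw [← Complex.cpow_add _ _ hn', ← Complex.cpow_add _ _ hn']
      congr 1
      ring
    simp only [Function.comp_apply]
    have e' : ((n : ℂ) ^ (c - a) * (n : ℂ) ^ (c - b)) * (n.factorial : ℂ) ^ 2 *
        ((Complex.GammaSeq c n)⁻¹ * (Complex.GammaSeq (c - a - b) n)⁻¹ * ∑' n, hgc a b c n) =
        ((n : ℂ) ^ (c - a) * (n : ℂ) ^ (c - b)) * (n.factorial : ℂ) ^ 2 *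
        ((Complex.GammaSeq (c - a) n)⁻¹ * (Complex.GammaSeq (c - b) n)⁻¹ *
          ∑' k, hgc a b (c + (n + 1 : ℕ)) k) := by
      linear_combination e - ((n.factorial : ℂ) ^ 2 * (Complex.GammaSeq c n)⁻¹ *
        (Complex.GammaSeq (c - a - b) n)⁻¹ * ∑' k, hgc a b c k) * hp
    have e'' := mul_left_cancel₀ (mul_ne_zero (mul_ne_zero (p _) (p _)) (pow_ne_zero 2 f)) e'
    have : ∑' n, hgc a b c n = Complex.GammaSeq c n * Complex.GammaSeq (c - a - b) n *
        ((Complex.GammaSeq c n)⁻¹ * (Complex.GammaSeq (c - a - b) n)⁻¹ * ∑' n, hgc a b c n) := by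
      field_simp
    rw [this, e'']
    ring
  rw [tendsto_nhds_unique tendsto_const_nhds t']
  rw [div_eq_mul_inv, mul_inv]
  ring

theorem tendsto_hypergeometric_one {a b c : ℂ} (h : 0 < (c - a - b).re) :
    Tendsto (fun u : ℝ => HG a b c u) (𝓝[<] 1) (𝓝 (∑' n, hgc a b c n)) := by
  simp only [hypergeometric_eq_tsum]
  refine tendsto_tsum_of_dominated_convergence (summable_norm_hgc h) (fun n => ?_) ?_
  · have : Continuous fun u : ℝ => hgc a b c n * (u : ℂ) ^ n := by fun_prop
    have h1 := (this.tendsto 1).mono_left (nhdsWithin_le_nhds (s := Set.Iio 1))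
    simpa using h1
  · have h0 : ∀ᶠ u : ℝ in 𝓝[<] 1, 0 < u := nhdsWithin_le_nhds (lt_mem_nhds zero_lt_one)
    filter_upwards [h0, self_mem_nhdsWithin] with u hu hu1 n
    rw [norm_mul, norm_pow, Complex.norm_real, Real.norm_of_nonneg hu.le]
    exact mul_le_of_le_one_right (norm_nonneg _) (pow_le_one₀ hu.le (le_of_lt hu1))

/-! ### The Harish-Chandra series of rank one -/

/-- `ρ(k)` in rank one. -/
noncomputable def rho₁ (ks kl : ℂ) : ℂ := ks / 2 + kl

/-- The coefficients of the Harish-Chandra series of rank one. -/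
noncomputable def hcCoeff (ks kl : ℂ) : ℕ → ℂ → ℂ
  | 0, _ => 1
  | 1, l => -2 * ks * (l - rho₁ ks kl) / (1 - 2 * l)
  | (m + 2), l => (-2 * ks * (l - rho₁ ks kl - (m + 1)) * hcCoeff ks kl (m + 1) l +
      (m + 2 * rho₁ ks kl) * (m + 2 * rho₁ ks kl - 2 * l) * hcCoeff ks kl m l) /
      ((m + 2) * (m + 2 - 2 * l))

/-- The spectral parameters `l` with `2 l ∉ ℤ`. -/
def regularSet : Set ℂ := {l | 2 * l ∈ Complex.integerComplement}

theorem isOpen_regularSet : IsOpen regularSet :=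
  Complex.isOpen_compl_range_intCast.preimage (continuous_const.mul continuous_id)

theorem natCast_sub_ne_zero_of_mem_regularSet {l : ℂ} (hl : l ∈ regularSet) (m : ℤ) :
    (m : ℂ) - 2 * l ≠ 0 := fun h => hl ⟨m, sub_eq_zero.1 h⟩

theorem neg_mem_regularSet {l : ℂ} (hl : l ∈ regularSet) : -l ∈ regularSet := by
  rintro ⟨m, hm⟩
  exact hl ⟨-m, by push_cast; linear_combination -hm⟩

theorem ne_zero_of_mem_regularSet {l : ℂ} (hl : l ∈ regularSet) : l ≠ 0 := by
  rintro rfl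
  exact hl ⟨0, by simp⟩

theorem differentiableOn_hcCoeff (ks kl : ℂ) : ∀ m, DifferentiableOn ℂ (hcCoeff ks kl m) regularSet
  | 0 => by
    have : hcCoeff ks kl 0 = fun _ => 1 := by funext l; rw [hcCoeff]
    rw [this]
    exact differentiableOn_const _
  | 1 => by
    have : hcCoeff ks kl 1 = fun l => -2 * ks * (l - rho₁ ks kl) / (1 - 2 * l) := by
      funext l; rw [hcCoeff]
    rw [this]
    refine DifferentiableOn.div (by fun_prop) (by fun_prop) fun l hl => ?_
    simpa using natCast_sub_ne_zero_of_mem_regularSet hl 1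
  | (m + 2) => by
    have h1 := differentiableOn_hcCoeff ks kl (m + 1)
    have h0 := differentiableOn_hcCoeff ks kl m
    have : hcCoeff ks kl (m + 2) = fun l =>
        (-2 * ks * (l - rho₁ ks kl - (m + 1)) * hcCoeff ks kl (m + 1) l +
      (m + 2 * rho₁ ks kl) * (m + 2 * rho₁ ks kl - 2 * l) * hcCoeff ks kl m l) /
      ((m + 2) * (m + 2 - 2 * l)) := by
      funext l; rw [hcCoeff]
    rw [this]
    refine DifferentiableOn.div (by fun_prop) (by fun_prop) fun l hl => mul_ne_zero ?_ ?_
    · exact_mod_cast (Nat.succ_ne_zero (m + 1))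
    · simpa using natCast_sub_ne_zero_of_mem_regularSet hl (m + 2)

theorem exists_hcCoeff_bound (ks kl : ℂ) {l : ℂ} (hl : l ∈ regularSet) {r : ℝ} (h0 : 0 < r)
    (h1 : r < 1) : ∃ V : Set ℂ, IsOpen V ∧ l ∈ V ∧ V ⊆ regularSet ∧
      ∃ K, ∀ m, ∀ x ∈ V, ‖hcCoeff ks kl m x‖ * r ^ m ≤ K := by
  obtain ⟨ε, hε, hεU⟩ := nhds_basis_closedBall.mem_iff.1 (isOpen_regularSet.mem_nhds hl)
  let R : ℝ := ‖l‖ + ε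
  have hR : ∀ x ∈ closedBall l ε, ‖x‖ ≤ R := fun x hx => by
    have := norm_le_norm_add_norm_sub' x l
    rw [mem_closedBall, dist_eq_norm] at hx
    simp only [R]
    linarith
  let p : ℝ := ‖rho₁ ks kl‖
  let A : ℕ → ℝ := fun m => 2 * ‖ks‖ * (R + p + (m + 1)) / ((m + 2) * (m + 2 - 2 * R))
  let B : ℕ → ℝ := fun m => (m + 2 * p) * (m + 2 * p + 2 * R) / ((m + 2) * (m + 2 - 2 * R))
  have tA : Tendsto A atTop (𝓝 0) := by
    have e1 := tendsto_add_mul_div_add_mul_atTop_nhds (𝕜 := ℝ) (2 * ‖ks‖ * (R + p + 1)) 2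
      (2 * ‖ks‖) one_ne_zero
    have e2 := tendsto_add_mul_div_add_mul_atTop_nhds (𝕜 := ℝ) 1 (2 - 2 * R)
      0 one_ne_zero
    have := e1.mul e2
    rw [zero_div, mul_zero] at this
    refine this.congr fun m => ?_
    rw [div_mul_div_comm]
    simp only [A]
    congr 1 <;> ring
  have tB : Tendsto B atTop (𝓝 1) := by
    have e1 := tendsto_add_mul_div_add_mul_atTop_nhds (𝕜 := ℝ) (2 * p) 2 1 one_ne_zero
    have e2 := tendsto_add_mul_div_add_mul_atTop_nhds (𝕜 := ℝ) (2 * p + 2 * R) (2 - 2 * R)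
      1 one_ne_zero
    have := e1.mul e2
    rw [div_one, mul_one] at this
    refine this.congr fun m => ?_
    rw [div_mul_div_comm]
    simp only [B]
    congr 1 <;> ring
  have tAB : Tendsto (fun m => A m + B m) atTop (𝓝 1) := by simpa using tA.add tB
  obtain ⟨N₁, hN₁⟩ := eventually_atTop.1
    (tAB.eventually_le_const (show (1 : ℝ) < 1 / r by rwa [lt_div_iff₀ h0, one_mul]))
  obtain ⟨N₂, hN₂⟩ := exists_nat_ge (2 * R)
  let N := max N₁ N₂
  have hR0 : 0 ≤ R := by positivity
  have hden : ∀ m ≥ N, 0 < (m : ℝ) + 2 - 2 * R := fun m hm => by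
    have : (N₂ : ℝ) ≤ m := by exact_mod_cast (le_max_right _ _).trans hm
    linarith
  have hK : ∀ m, ∃ K, ∀ x ∈ closedBall l ε, ‖hcCoeff ks kl m x‖ ≤ K := fun m =>
    (isCompact_closedBall l ε).exists_bound_of_continuousOn
      ((differentiableOn_hcCoeff ks kl m).continuousOn.mono hεU)
  choose K hK using hK
  have hK0 : ∀ m, 0 ≤ K m := fun m => (norm_nonneg _).trans (hK m l (mem_closedBall_self hε.le))
  refine ⟨ball l ε, isOpen_ball, mem_ball_self hε, ball_subset_closedBall.trans hεU,
    ∑ m ∈ Finset.range (N + 2), K m, fun m x hx => ?_⟩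
  have hx' := ball_subset_closedBall hx
  have hxR := hR x hx'
  have hxU := hεU hx'
  have := norm_le_mul_pow_of_recurrence (x := fun m => hcCoeff ks kl m x) (A := A) (B := B)
    (K := ∑ m ∈ Finset.range (N + 2), K m) (ρ := 1 / r) (N := N)
    (by rw [le_div_iff₀ h0, one_mul]; exact h1.le) (fun m hm => ?_) (fun m hm => ?_)
    (fun m hm => hN₁ m ((le_max_left _ _).trans hm)) (fun m hm => ?_) (fun m hm => ?_) m
  · rw [one_div, inv_pow] at this
    calc _ ≤ ((∑ m ∈ Finset.range (N + 2), K m) * (r ^ m)⁻¹) * r ^ m := by gcongr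
      _ = _ := by field_simp
  · have := hden m hm
    positivity
  · have := hden m hm
    positivity
  · exact (hK m x hx').trans (Finset.single_le_sum (f := K) (fun m _ => hK0 m)
      (Finset.mem_range.2 (by omega)))
  · have hd := hden m hm
    have n1 : ‖x - rho₁ ks kl - (m + 1)‖ ≤ R + p + (m + 1) := by
      refine (norm_sub_le _ _).trans (add_le_add ((norm_sub_le _ _).trans (by gcongr)) ?_)
      rw [← Nat.cast_succ, Complex.norm_natCast, Nat.cast_succ]
    have n2 : ‖(m : ℂ) + 2 * rho₁ ks kl‖ ≤ m + 2 * p := by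
      refine (norm_add_le _ _).trans ?_
      simp [p]
    have n3 : ‖(m : ℂ) + 2 * rho₁ ks kl - 2 * x‖ ≤ m + 2 * p + 2 * R := by
      refine (norm_sub_le _ _).trans (add_le_add n2 ?_)
      simpa using hxR
    have n4 : (m : ℝ) + 2 - 2 * R ≤ ‖(m : ℂ) + 2 - 2 * x‖ := by
      have h := norm_sub_norm_le ((m : ℂ) + 2) (2 * x)
      have e : ‖(m : ℂ) + 2‖ = m + 2 := by
        rw [show (m : ℂ) + 2 = ((m + 2 : ℕ) : ℂ) by push_cast; rfl, Complex.norm_natCast]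
        push_cast
        rfl
      rw [e, norm_mul, Complex.norm_ofNat] at h
      linarith
    have n5 : ‖(m : ℂ) + 2‖ = m + 2 := by
      rw [show (m : ℂ) + 2 = ((m + 2 : ℕ) : ℂ) by push_cast; rfl, Complex.norm_natCast]
      push_cast
      rfl
    simp only [A, B]
    rw [hcCoeff, norm_div, norm_mul ((m : ℂ) + 2), n5]
    calc _ ≤ (2 * ‖ks‖ * (R + p + (m + 1)) * ‖hcCoeff ks kl (m + 1) x‖ +
          (m + 2 * p) * (m + 2 * p + 2 * R) * ‖hcCoeff ks kl m x‖) /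
          ((m + 2) * (m + 2 - 2 * R)) := by
          gcongr
          refine (norm_add_le _ _).trans ?_
          simp only [norm_mul, norm_neg, Complex.norm_ofNat]
          gcongr
      _ = _ := by ring

theorem summable_norm_hcCoeff_mul_pow (ks kl : ℂ) {l : ℂ} (hl : l ∈ regularSet) (r : ℝ)
    (h0 : 0 ≤ r) (h1 : r < 1) : Summable fun m => ‖hcCoeff ks kl m l‖ * r ^ m := by
  obtain ⟨s, hrs, hs1⟩ := exists_between h1
  have hs : 0 < s := h0.trans_lt hrs
  obtain ⟨V, -, hlV, -, K, hK⟩ := exists_hcCoeff_bound ks kl hl hs hs1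
  refine Summable.of_nonneg_of_le (fun n => by positivity) (fun n => ?_)
    ((summable_geometric_of_lt_one (r := r / s) (by positivity)
      ((div_lt_one hs).2 hrs)).mul_left K)
  have := hK n l hlV
  rw [div_pow]
  calc _ = (‖hcCoeff ks kl n l‖ * s ^ n) * (r ^ n / s ^ n) := by field_simp
    _ ≤ _ := by gcongr

theorem analyticAt_hcSeries (ks kl : ℂ) {l q : ℂ} (hl : l ∈ regularSet) (hq : ‖q‖ < 1) :
    AnalyticAt ℂ (fun p : ℂ × ℂ => ∑' m, hcCoeff ks kl m p.1 * p.2 ^ m) (l, q) := by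
  obtain ⟨r, hqr, hr1⟩ := exists_between hq
  obtain ⟨V, hV, hlV, hVU, K, hK⟩ := exists_hcCoeff_bound ks kl hl ((norm_nonneg q).trans_lt hqr) hr1
  exact analyticAt_tsum_mul_pow hV (fun m => (differentiableOn_hcCoeff ks kl m).mono hVU) hK hlV hqr

/-- The Harish-Chandra series of rank one. -/
noncomputable def hcPhi (ks kl l y : ℂ) : ℂ :=
  Complex.exp ((l - rho₁ ks kl) * y) * ∑' m, hcCoeff ks kl m l * Complex.exp (-y) ^ m

theorem norm_exp_neg_lt_one {y : ℂ} (hy : 0 < y.re) : ‖Complex.exp (-y)‖ < 1 := by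
  rw [Complex.norm_exp, Real.exp_lt_one_iff]
  simpa using hy

theorem analyticAt_hcPhi (ks kl : ℂ) {l y : ℂ} (hl : l ∈ regularSet) (hy : 0 < y.re) :
    AnalyticAt ℂ (fun p : ℂ × ℂ => hcPhi ks kl p.1 p.2) (l, y) := by
  refine AnalyticAt.mul ?_ ?_
  · exact ((analyticAt_fst.sub analyticAt_const).mul analyticAt_snd).cexp
  · exact (analyticAt_hcSeries ks kl hl (norm_exp_neg_lt_one hy)).comp_of_eq
      (analyticAt_fst.prod analyticAt_snd.neg.cexp) rfl

/-- The first order coefficient of the radial part of the Laplacian in rank one. -/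
noncomputable def radialCoeff (ks kl y : ℂ) : ℂ :=
  ks * ((1 + Complex.exp (-y)) / (1 - Complex.exp (-y))) +
    2 * kl * ((1 + Complex.exp (-y) ^ 2) / (1 - Complex.exp (-y) ^ 2))

theorem hcPhi_ode (ks kl : ℂ) {l : ℂ} (hl : l ∈ regularSet) :
    ∃ f₁ f₂ : ℂ → ℂ, (∀ y, 0 < y.re → HasDerivAt (hcPhi ks kl l) (f₁ y) y ∧
      HasDerivAt f₁ (f₂ y) y ∧
      f₂ y + radialCoeff ks kl y * f₁ y = (l ^ 2 - rho₁ ks kl ^ 2) * hcPhi ks kl l y) ∧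
      Tendsto (fun y : ℝ => Complex.exp (-((l - rho₁ ks kl) * y)) * hcPhi ks kl l y) atTop (𝓝 1) ∧
      Tendsto (fun y : ℝ => Complex.exp (-((l - rho₁ ks kl) * y)) * f₁ y) atTop
        (𝓝 (l - rho₁ ks kl)) := by
  set ρ := rho₁ ks kl with hρ
  let g : ℕ → ℂ := fun m => hcCoeff ks kl m l
  let d : ℕ → ℂ := fun n => ((n : ℂ) + 1) * g (n + 1)
  let e : ℕ → ℂ := fun n => ((n : ℂ) + 1) * d (n + 1)
  have sg : ∀ r : ℝ, 0 ≤ r → r < 1 → Summable fun n => ‖g n‖ * r ^ n :=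
    summable_norm_hcCoeff_mul_pow ks kl hl
  have sd := summable_norm_succ_mul_pow sg
  have se := summable_norm_succ_mul_pow sd
  let G : ℂ → ℂ := fun q => ∑' n, g n * q ^ n
  let G₁ : ℂ → ℂ := fun q => ∑' n, d n * q ^ n
  let G₂ : ℂ → ℂ := fun q => ∑' n, e n * q ^ n
  have hG : ∀ q, ‖q‖ < 1 → HasDerivAt G (G₁ q) q := fun q hq => hasDerivAt_tsum_mul_pow sg hq
  have hG₁ : ∀ q, ‖q‖ < 1 → HasDerivAt G₁ (G₂ q) q := fun q hq => hasDerivAt_tsum_mul_pow sd hq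
  have hq : ∀ y, HasDerivAt (fun y : ℂ => Complex.exp (-y)) (-Complex.exp (-y)) y := fun y => by
    simpa using (hasDerivAt_neg y).cexp
  have hE : ∀ y, HasDerivAt (fun y : ℂ => Complex.exp ((l - ρ) * y))
      ((l - ρ) * Complex.exp ((l - ρ) * y)) y := fun y => by
    simpa [mul_comm] using ((hasDerivAt_id y).const_mul (l - ρ)).cexp
  let f₁ : ℂ → ℂ := fun y => Complex.exp ((l - ρ) * y) *
    ((l - ρ) * G (Complex.exp (-y)) - Complex.exp (-y) * G₁ (Complex.exp (-y)))
  let f₂ : ℂ → ℂ := fun y => Complex.exp ((l - ρ) * y) *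
    ((l - ρ) ^ 2 * G (Complex.exp (-y)) - (2 * (l - ρ) - 1) * (Complex.exp (-y) *
      G₁ (Complex.exp (-y))) + Complex.exp (-y) ^ 2 * G₂ (Complex.exp (-y)))
  have hqt : Tendsto (fun y : ℝ => Complex.exp (-y)) atTop (𝓝 0) := by
    have := (Complex.continuous_ofReal.tendsto 0).comp (Real.tendsto_exp_neg_atTop_nhds_zero)
    simpa [Function.comp_def] using this
  have h00 : ‖(0 : ℂ)‖ < 1 := by simp
  have hG0 : G 0 = 1 := by
    simp only [G]
    rw [tsum_eq_single 0 (fun n hn => by simp [hn])]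
    simp [g, hcCoeff]
  have tG := (hG 0 h00).continuousAt.tendsto.comp hqt
  have tG₁ := (hG₁ 0 h00).continuousAt.tendsto.comp hqt
  rw [hG0] at tG
  refine ⟨f₁, f₂, fun y hy => ?_, ?_, ?_⟩
  · have hy1 := norm_exp_neg_lt_one hy
    have dG : HasDerivAt (fun y => G (Complex.exp (-y)))
        (G₁ (Complex.exp (-y)) * -Complex.exp (-y)) y :=
      HasDerivAt.comp (h₂ := G) y (hG _ hy1) (hq y)
    have dG₁ : HasDerivAt (fun y => G₁ (Complex.exp (-y)))
        (G₂ (Complex.exp (-y)) * -Complex.exp (-y)) y :=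
      HasDerivAt.comp (h₂ := G₁) y (hG₁ _ hy1) (hq y)
    refine ⟨?_, ?_, ?_⟩
    · convert! (hE y).mul dG using 1
      simp only [f₁]
      ring
    · convert! (hE y).mul ((dG.const_mul (l - ρ)).sub ((hq y).mul dG₁)) using 1
      simp only [f₂, Pi.sub_apply, Pi.mul_apply]
      ring
    · change f₂ y + _ * f₁ y = _ * (Complex.exp ((l - ρ) * y) * G (Complex.exp (-y)))
      simp only [f₁, f₂, radialCoeff]
      generalize Complex.exp ((l - ρ) * y) = E
      generalize Complex.exp (-y) = q at hy1
      have hq1 : 1 - q ≠ 0 := Complex.slitPlane_ne_zero (one_sub_mem_slitPlane hy1)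
      have hq2 : 1 - q ^ 2 ≠ 0 := Complex.slitPlane_ne_zero (one_sub_mem_slitPlane (by
        rw [norm_pow]
        exact pow_lt_one₀ (norm_nonneg q) hy1 two_ne_zero))
      have hsum : ∀ f : ℕ → ℂ, (∀ r : ℝ, 0 ≤ r → r < 1 → Summable fun n => ‖f n‖ * r ^ n) →
          HasSum (fun n => f n * q ^ n) (∑' n, f n * q ^ n) := fun f hf => by
        refine (Summable.of_norm ?_).hasSum
        simpa only [norm_mul, norm_pow] using hf ‖q‖ (norm_nonneg q) hy1
      have S0 : HasSum (fun n => g n * q ^ n) (G q) := hsum g sg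
      have S1 : HasSum (fun n => d n * q ^ n) (G₁ q) := hsum d sd
      have S2 : HasSum (fun n => e n * q ^ n) (G₂ q) := hsum e se
      have T1 : HasSum (fun n : ℕ => n * g n * q ^ n) (q * G₁ q) := by
        refine hasSum_of_hasSum_succ ?_ (by simp)
        convert! S1.mul_left q using 2 with n
        simp only [d]
        push_cast
        ring
      have T2 : HasSum (fun n : ℕ => n * d n * q ^ n) (q * G₂ q) := by
        refine hasSum_of_hasSum_succ ?_ (by simp)
        convert! S2.mul_left q using 2 with n
        simp only [e]
        push_cast
        ring
      have T3 : HasSum (fun n : ℕ => n * (n - 1) * g n * q ^ n) (q * (q * G₂ q)) := by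
        refine hasSum_of_hasSum_succ ?_ (by simp)
        convert! T2.mul_left q using 2 with n
        simp only [d]
        push_cast
        ring
      let SX := ((l - ρ) ^ 2 - (l ^ 2 - ρ ^ 2)) * G q - (2 * (l - ρ) - 1) * (q * G₁ q) +
        q * (q * G₂ q)
      let SY := (l - ρ) * G q - q * G₁ q
      have HY : HasSum (fun n : ℕ => (l - ρ - n) * g n * q ^ n) SY := by
        convert! (S0.mul_left (l - ρ)).sub T1 using 2 with n
        ring
      have HX : HasSum (fun n : ℕ => ((l - ρ - n) ^ 2 - (l ^ 2 - ρ ^ 2)) * g n * q ^ n) SX := by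
        convert! ((S0.mul_left ((l - ρ) ^ 2 - (l ^ 2 - ρ ^ 2))).sub
          (T1.mul_left (2 * (l - ρ) - 1))).add T3 using 2 with n
        ring
      have HZ := HX.add (HY.mul_left (2 * ρ))
      rw [← hasSum_nat_add_iff' 2] at HZ
      have HY' := HY
      rw [← hasSum_nat_add_iff' 1] at HY'
      have HW := ((HY'.mul_left (-2 * ks * q)).add (HX.mul_left (q ^ 2))).sub
        (HY.mul_left (2 * ρ * q ^ 2))
      have hg1 : (1 - 2 * l) * g 1 = -2 * ks * (l - ρ) * g 0 := by
        have := natCast_sub_ne_zero_of_mem_regularSet hl 1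
        simp only [g, hcCoeff, ← hρ]
        push_cast at this
        field_simp
      have hrec : ∀ n : ℕ, ((n : ℂ) + 2) * (n + 2 - 2 * l) * g (n + 2) =
          -2 * ks * (l - ρ - (n + 1)) * g (n + 1) +
          (n + 2 * ρ) * (n + 2 * ρ - 2 * l) * g n := fun n => by
        have h1 := natCast_sub_ne_zero_of_mem_regularSet hl (n + 2)
        push_cast at h1
        have h2 : (n : ℂ) + 2 ≠ 0 := by exact_mod_cast (Nat.succ_ne_zero (n + 1))
        simp only [g]
        rw [hcCoeff, ← hρ]
        field_simp
      have hu := HZ.unique (by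
        convert! HW using 2 with n
        push_cast
        linear_combination q ^ (n + 2) * hrec n)
      simp [Finset.sum_range_succ] at hu
      have key : (1 - q ^ 2) * SX + (2 * ρ + 2 * ks * q + 2 * ρ * q ^ 2) * SY = 0 := by
        linear_combination hu + q * hg1
      have hρ' : 2 * ρ = ks + 2 * kl := by rw [hρ, rho₁]; ring
      have key' : SX + (ks * ((1 + q) / (1 - q)) + 2 * kl * ((1 + q ^ 2) / (1 - q ^ 2))) * SY
          = 0 := by
        have h3 : (1 + q) / (1 - q) = (1 + q) ^ 2 / (1 - q ^ 2) := by
          rw [div_eq_div_iff hq1 hq2]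
          ring
        rw [h3]
        field_simp
        linear_combination key - SY * (1 + q ^ 2) * hρ'
      simp only [SX, SY] at key'
      linear_combination E * key'
  · refine tG.congr fun y => ?_
    change G _ = _ * (Complex.exp ((l - ρ) * y) * G _)
    rw [← mul_assoc, ← Complex.exp_add]
    simp
  · have := (tG.const_mul (l - ρ)).sub (hqt.mul tG₁)
    simp only [mul_one, zero_mul, sub_zero] at this
    refine this.congr fun y => ?_
    simp only [f₁]
    rw [← mul_assoc, ← Complex.exp_add]
    simp

/-! ### The hypergeometric function of rank one -/

/-- A neighbourhood of the real line on which the rank one hypergeometric function is holomorphic. -/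
def tubeDomain : Set ℂ := {y | Complex.cosh (y / 2) ≠ 0 ∧ ‖Complex.tanh (y / 2) ^ 2‖ < 1}

/-- The hypergeometric function of rank one. -/
noncomputable def phi₁ (ks kl l y : ℂ) : ℂ :=
  psi (rho₁ ks kl - l) (rho₁ ks kl + l) (ks + kl + 1 / 2) (Complex.tanh (y / 2) ^ 2)

theorem analyticAt_tanh_half_sq {y : ℂ} (hy : Complex.cosh (y / 2) ≠ 0) :
    AnalyticAt ℂ (fun y : ℂ => Complex.tanh (y / 2) ^ 2) y := by
  have h : AnalyticAt ℂ (fun y : ℂ => y / 2) y := analyticAt_id.div analyticAt_const two_ne_zero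
  have h1 : AnalyticAt ℂ (fun y : ℂ => Complex.sinh (y / 2)) y :=
    (Complex.differentiable_sinh.analyticAt _).comp_of_eq h rfl
  have h2 : AnalyticAt ℂ (fun y : ℂ => Complex.cosh (y / 2)) y :=
    (Complex.differentiable_cosh.analyticAt _).comp_of_eq h rfl
  exact (h1.div h2 hy).pow 2

theorem isOpen_tubeDomain : IsOpen tubeDomain := by
  rw [isOpen_iff_mem_nhds]
  rintro y ⟨h1, h2⟩
  have c1 : ContinuousAt (fun y : ℂ => Complex.cosh (y / 2)) y := by fun_prop
  have c2 := (analyticAt_tanh_half_sq h1).continuousAt.norm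
  filter_upwards [c1.eventually_ne h1, c2.eventually_lt continuousAt_const h2] with z h3 h4
  exact ⟨h3, h4⟩

theorem tanh_ofReal_half_sq (y : ℝ) :
    Complex.tanh ((y : ℂ) / 2) ^ 2 = ((Real.tanh (y / 2) ^ 2 : ℝ) : ℂ) := by
  push_cast
  rfl

theorem tanh_sq_lt_one (t : ℝ) : Real.tanh t ^ 2 < 1 := by
  rw [Real.tanh_eq_sinh_div_cosh, div_pow, div_lt_one (pow_pos (Real.cosh_pos t) 2), Real.cosh_sq]
  linarith

theorem ofReal_mem_tubeDomain (y : ℝ) : (y : ℂ) ∈ tubeDomain := by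
  refine ⟨?_, ?_⟩
  · have : Complex.cosh ((y : ℂ) / 2) = ((Real.cosh (y / 2) : ℝ) : ℂ) := by push_cast; rfl
    rw [this]
    exact_mod_cast (Real.cosh_pos _).ne'
  · rw [tanh_ofReal_half_sq, Complex.norm_real, Real.norm_of_nonneg (sq_nonneg _)]
    exact tanh_sq_lt_one _

theorem analyticAt_phi₁ (ks kl l : ℂ) {y : ℂ} (hy : y ∈ tubeDomain) :
    AnalyticAt ℂ (fun p : ℂ × ℂ => phi₁ ks kl p.1 p.2) (l, y) := by
  have h1 := analyticAt_psi_param (a := fun l => rho₁ ks kl - l) (b := fun l => rho₁ ks kl + l)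
    (by fun_prop) (by fun_prop) (ks + kl + 1 / 2) l hy.2
  have h2 : AnalyticAt ℂ (fun p : ℂ × ℂ => Complex.tanh (p.2 / 2) ^ 2) (l, y) :=
    (analyticAt_tanh_half_sq hy.1).comp_of_eq analyticAt_snd rfl
  exact h1.comp_of_eq (analyticAt_fst.prod h2) rfl

theorem analyticAt_phi₁_right (ks kl l : ℂ) {y : ℂ} (hy : y ∈ tubeDomain) :
    AnalyticAt ℂ (phi₁ ks kl l) y :=
  (analyticAt_phi₁ ks kl l hy).curry_right

theorem phi₁_neg {ks kl : ℂ} (hc : ∀ m : ℕ, ks + kl + 1 / 2 ≠ -(m : ℂ)) (l : ℂ) {y : ℂ}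
    (hy : y ∈ tubeDomain) : phi₁ ks kl (-l) y = phi₁ ks kl l y := by
  rw [phi₁, psi_comm _ _ hc hy.2, phi₁, sub_neg_eq_add, ← sub_eq_add_neg]

theorem phi₁_neg_right (ks kl l y : ℂ) : phi₁ ks kl l (-y) = phi₁ ks kl l y := by
  rw [phi₁, neg_div, Complex.tanh_neg, neg_sq, phi₁]

theorem jacobiFunction_eq_phi₁ {ks kl α β : ℂ} (hα : α = ks + kl - 1 / 2) (hβ : β = kl - 1 / 2)
    (hc : ∀ m : ℕ, ks + kl + 1 / 2 ≠ -(m : ℂ)) (l : ℂ) (t : ℝ) :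
    jacobiFunction α β (Complex.I * l) t = phi₁ ks kl (l / 2) ((2 * t : ℝ) : ℂ) := by
  have e1 : α + 1 = ks + kl + 1 / 2 := by rw [hα]; ring
  have e2 : (α + β + 1 + Complex.I * (Complex.I * l)) / 2 = rho₁ ks kl - l / 2 := by
    rw [hα, hβ, rho₁, ← mul_assoc, Complex.I_mul_I]
    ring
  have e3 : (α + β + 1 - Complex.I * (Complex.I * l)) / 2 = rho₁ ks kl + l / 2 := by
    rw [hα, hβ, rho₁, ← mul_assoc, Complex.I_mul_I]
    ring
  rw [jacobiFunction, e1, e2, e3, gauss2F1_neg_sinh_sq _ _ hc, phi₁, tanh_ofReal_half_sq]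
  norm_num

theorem analyticAt_comp_ofReal {h : ℂ → ℂ} {y : ℝ} (hh : AnalyticAt ℂ h y) :
    AnalyticAt ℝ (fun y : ℝ => h y) y :=
  (hh.restrictScalars (𝕜 := ℝ)).comp_of_eq (Complex.ofRealCLM.analyticAt y) rfl

theorem one_sub_exp_neg_ne_zero {y : ℂ} (hy : 0 < y.re) : 1 - Complex.exp (-y) ≠ 0 :=
  Complex.slitPlane_ne_zero (one_sub_mem_slitPlane (norm_exp_neg_lt_one hy))

theorem one_sub_exp_neg_sq_ne_zero {y : ℂ} (hy : 0 < y.re) : 1 - Complex.exp (-y) ^ 2 ≠ 0 :=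
  Complex.slitPlane_ne_zero (one_sub_mem_slitPlane (by
    rw [norm_pow]
    exact pow_lt_one₀ (norm_nonneg _) (norm_exp_neg_lt_one hy) two_ne_zero))

theorem radialCoeff_mul_sinh (ks kl : ℂ) {y : ℂ} (hy : 0 < y.re) :
    radialCoeff ks kl y * Complex.sinh y =
      ks * (Complex.cosh y + 1) + 2 * kl * Complex.cosh y := by
  have h1 := one_sub_exp_neg_ne_zero hy
  have h2 := one_sub_exp_neg_sq_ne_zero hy
  have e : Complex.exp y = (Complex.exp (-y))⁻¹ := by rw [Complex.exp_neg, inv_inv]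
  rw [radialCoeff, Complex.sinh, Complex.cosh, e]
  have h3 := Complex.exp_ne_zero (-y)
  generalize Complex.exp (-y) = q at *
  field_simp
  ring

theorem analyticAt_radialCoeff (ks kl : ℂ) {y : ℂ} (hy : 0 < y.re) :
    AnalyticAt ℂ (radialCoeff ks kl) y := by
  have h1 := one_sub_exp_neg_ne_zero hy
  have h2 := one_sub_exp_neg_sq_ne_zero hy
  have hq : AnalyticAt ℂ (fun y : ℂ => Complex.exp (-y)) y := analyticAt_id.neg.cexp
  exact (analyticAt_const.mul ((analyticAt_const.add hq).div (analyticAt_const.sub hq) h1)).add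
    (analyticAt_const.mul ((analyticAt_const.add (hq.pow 2)).div (analyticAt_const.sub (hq.pow 2))
      h2))

/-- The domain on which `phi₁` is given by the hypergeometric series in `(1 - cosh y) / 2`. -/
def smallDomain : Set ℂ :=
  {y | y ∈ tubeDomain ∧ (Complex.tanh (y / 2) ^ 2).re < 1 / 2 ∧ ‖(1 - Complex.cosh y) / 2‖ < 1}

theorem isOpen_smallDomain : IsOpen smallDomain := by
  rw [isOpen_iff_mem_nhds]
  rintro y ⟨h1, h2, h3⟩
  have c2 := Complex.continuous_re.continuousAt.comp (analyticAt_tanh_half_sq h1.1).continuousAt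
  have c3 : ContinuousAt (fun y : ℂ => ‖(1 - Complex.cosh y) / 2‖) y := by fun_prop
  filter_upwards [isOpen_tubeDomain.mem_nhds h1, c2.eventually_lt continuousAt_const h2,
    c3.eventually_lt continuousAt_const h3] with z h4 h5 h6
  exact ⟨h4, h5, h6⟩

theorem phi₁_eq_hypergeometric {ks kl : ℂ} (hc : ∀ m : ℕ, ks + kl + 1 / 2 ≠ -(m : ℂ)) (l : ℂ)
    {y : ℂ} (hy : y ∈ smallDomain) : phi₁ ks kl l y =
      HG (rho₁ ks kl - l) (rho₁ ks kl + l) (ks + kl + 1 / 2) ((1 - Complex.cosh y) / 2) := by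
  rw [phi₁, psi_eq_hypergeometric _ _ hc hy.1.2 hy.2.1]
  congr 1
  have h0 := hy.1.1
  have e : Complex.cosh y = 2 * Complex.cosh (y / 2) ^ 2 - 1 := by
    have := Complex.cosh_two_mul (y / 2)
    rw [mul_div_cancel₀ y two_ne_zero] at this
    rw [this, Complex.sinh_sq]
    ring
  have e2 : Complex.tanh (y / 2) ^ 2 - 1 = -1 / Complex.cosh (y / 2) ^ 2 := by
    rw [Complex.tanh, div_pow, Complex.sinh_sq]
    field_simp
    ring
  rw [e2, e, Complex.tanh, div_pow, Complex.sinh_sq]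
  field_simp
  ring

theorem phi₁_ode {ks kl : ℂ} (hc : ∀ m : ℕ, ks + kl + 1 / 2 ≠ -(m : ℂ)) (l : ℂ) {y : ℝ}
    (hy : 0 < y) : deriv (deriv (phi₁ ks kl l)) y + radialCoeff ks kl y * deriv (phi₁ ks kl l) y =
      (l ^ 2 - rho₁ ks kl ^ 2) * phi₁ ks kl l y := by
  set ρ := rho₁ ks kl with hρ
  set c := ks + kl + 1 / 2 with hcdef
  obtain ⟨F₁, F₂, hF⟩ := hypergeometric_ode (ρ - l) (ρ + l) hc
  have hsmall : ∀ y ∈ smallDomain, 0 < y.re → deriv (deriv (phi₁ ks kl l)) y +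
      radialCoeff ks kl y * deriv (phi₁ ks kl l) y = (l ^ 2 - ρ ^ 2) * phi₁ ks kl l y := by
    intro y hy hre
    have hz : ∀ y : ℂ, HasDerivAt (fun y : ℂ => (1 - Complex.cosh y) / 2) (-Complex.sinh y / 2) y :=
      fun y => by simpa using ((Complex.hasDerivAt_cosh y).const_sub 1).div_const 2
    have d1 : ∀ y ∈ smallDomain, HasDerivAt (phi₁ ks kl l)
        (F₁ ((1 - Complex.cosh y) / 2) * (-Complex.sinh y / 2)) y := fun y hy => by
      refine (HasDerivAt.comp (h₂ := HG (ρ - l) (ρ + l) c) y (hF _ hy.2.2).1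
        (hz y)).congr_of_eventuallyEq ?_
      filter_upwards [isOpen_smallDomain.mem_nhds hy] with z hz'
      exact phi₁_eq_hypergeometric hc l hz'
    have d2 : HasDerivAt (deriv (phi₁ ks kl l)) (F₂ ((1 - Complex.cosh y) / 2) *
        (-Complex.sinh y / 2) * (-Complex.sinh y / 2) +
        F₁ ((1 - Complex.cosh y) / 2) * (-Complex.cosh y / 2)) y := by
      have h1 := HasDerivAt.comp (h₂ := F₁) y (hF _ hy.2.2).2.1 (hz y)
      have h2 := h1.mul ((Complex.hasDerivAt_sinh y).neg.div_const 2)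
      refine h2.congr_of_eventuallyEq ?_
      filter_upwards [isOpen_smallDomain.mem_nhds hy] with z hz'
      exact (d1 z hz').deriv
    rw [d2.deriv, (d1 y hy).deriv, phi₁_eq_hypergeometric hc l hy]
    have h := (hF _ hy.2.2).2.2
    have hr := radialCoeff_mul_sinh ks kl hre
    have hsq := Complex.cosh_sq y
    have hρ' : ρ = ks / 2 + kl := rfl
    rw [← hρ, ← hcdef]
    generalize HG (ρ - l) (ρ + l) c ((1 - Complex.cosh y) / 2) = H at *
    generalize F₁ ((1 - Complex.cosh y) / 2) = H₁ at *
    generalize F₂ ((1 - Complex.cosh y) / 2) = H₂ at *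
    rw [hcdef] at h
    linear_combination -h - (H₁ / 2) * hr - H₂ / 4 * hsq + H₁ * (Complex.cosh y - 1) * hρ'
  let D : ℂ → ℂ := fun y => deriv (deriv (phi₁ ks kl l)) y +
      radialCoeff ks kl y * deriv (phi₁ ks kl l) y - (l ^ 2 - ρ ^ 2) * phi₁ ks kl l y
  have hD : AnalyticOnNhd ℝ (fun y : ℝ => D y) (Set.Ioi 0) := fun y hy => by
    have h0 := analyticAt_phi₁_right ks kl l (ofReal_mem_tubeDomain y)
    exact analyticAt_comp_ofReal (h := D) ((h0.deriv.deriv.add ((analyticAt_radialCoeff ks kl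
      (by simpa using hy)).mul h0.deriv)).sub (analyticAt_const.mul h0))
  have h0 : (0 : ℂ) ∈ smallDomain := by
    refine ⟨by simpa using ofReal_mem_tubeDomain 0, ?_, ?_⟩ <;> simp
  have hO : ∀ᶠ y : ℝ in 𝓝 0, (y : ℂ) ∈ smallDomain :=
    Complex.continuous_ofReal.continuousAt.eventually_mem
      (isOpen_smallDomain.mem_nhds (by simpa using h0))
  obtain ⟨ε, hε, hεO⟩ := Metric.eventually_nhds_iff.1 hO
  have hev : (fun y : ℝ => D y) =ᶠ[𝓝 (ε / 2)] 0 := by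
    filter_upwards [Ioo_mem_nhds (show (0 : ℝ) < ε / 2 by positivity) (half_lt_self hε)] with y hy
    have := hsmall y (hεO (by
      rw [Real.dist_eq, sub_zero, abs_of_pos hy.1]
      exact hy.2)) (by simpa using hy.1)
    simp only [D, this, sub_self, Pi.zero_apply]
  have := hD.eqOn_zero_of_preconnected_of_eventuallyEq_zero isPreconnected_Ioi
    (show ε / 2 ∈ Set.Ioi 0 from half_pos hε) hev (show y ∈ Set.Ioi 0 from hy)
  exact sub_eq_zero.1 this

/-! ### The connection formula -/

/-- The weight which makes the radial part of the Laplacian symmetric. -/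
noncomputable def weight (ks kl : ℂ) (y : ℝ) : ℂ :=
  Complex.exp (2 * rho₁ ks kl * y + 2 * ks * (Real.log (1 - Real.exp (-y)) : ℝ) +
    2 * kl * (Real.log (1 - Real.exp (-y) ^ 2) : ℝ))

theorem one_sub_exp_neg_pos {y : ℝ} (hy : 0 < y) : 0 < 1 - Real.exp (-y) := by
  have := Real.exp_lt_one_iff.2 (show -y < 0 by linarith)
  linarith

theorem one_sub_exp_neg_sq_pos {y : ℝ} (hy : 0 < y) : 0 < 1 - Real.exp (-y) ^ 2 := by
  have := pow_lt_one₀ (Real.exp_pos (-y)).le (Real.exp_lt_one_iff.2 (show -y < 0 by linarith)) two_ne_zero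
  linarith

theorem hasDerivAt_weight (ks kl : ℂ) {y : ℝ} (hy : 0 < y) :
    HasDerivAt (weight ks kl) (radialCoeff ks kl y * weight ks kl y) y := by
  have h1 := one_sub_exp_neg_pos hy
  have h2 := one_sub_exp_neg_sq_pos hy
  have hq : HasDerivAt (fun y : ℝ => Real.exp (-y)) (-Real.exp (-y)) y := by
    simpa using (hasDerivAt_neg y).exp
  have l1 := ((hq.const_sub 1).log h1.ne').ofReal_comp
  have l2 := (((hq.pow 2).const_sub 1).log h2.ne').ofReal_comp
  have l0 := (Complex.ofRealCLM.hasDerivAt (x := y)).const_mul (2 * rho₁ ks kl)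
  have := ((l0.add (l1.const_mul (2 * ks))).add (l2.const_mul (2 * kl))).cexp
  convert! this using 1
  have e1 := one_sub_exp_neg_ne_zero (y := (y : ℂ)) (by simpa using hy)
  have e2 := one_sub_exp_neg_sq_ne_zero (y := (y : ℂ)) (by simpa using hy)
  rw [mul_comm]
  congr 1
  simp only [radialCoeff, rho₁, Complex.ofRealCLM_apply, Pi.pow_apply]
  push_cast
  field_simp
  ring

theorem tendsto_exp_mul_weight (ks kl : ℂ) :
    Tendsto (fun y : ℝ => Complex.exp (-(2 * rho₁ ks kl * y)) * weight ks kl y) atTop (𝓝 1) := by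
  have hq : Tendsto (fun y : ℝ => Real.exp (-y)) atTop (𝓝 0) := Real.tendsto_exp_neg_atTop_nhds_zero
  have c : ContinuousAt (fun q : ℝ => Complex.exp (2 * ks * (Real.log (1 - q) : ℝ) +
      2 * kl * (Real.log (1 - q ^ 2) : ℝ))) 0 := by
    have a1 : ContinuousAt (fun q : ℝ => Real.log (1 - q)) 0 :=
      ContinuousAt.log (by fun_prop) (by simp)
    have a2 : ContinuousAt (fun q : ℝ => Real.log (1 - q ^ 2)) 0 :=
      ContinuousAt.log (by fun_prop) (by simp)
    have b1 := Complex.continuous_ofReal.continuousAt.comp a1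
    have b2 := Complex.continuous_ofReal.continuousAt.comp a2
    simp only [Function.comp_def] at b1 b2
    fun_prop
  have := c.tendsto.comp hq
  simp only [sub_zero, Real.log_one, Complex.ofReal_zero, mul_zero, add_zero, Complex.exp_zero,
    ne_eq, OfNat.ofNat_ne_zero, not_false_eq_true, zero_pow] at this
  refine this.congr fun y => ?_
  simp only [Function.comp_apply, weight]
  rw [← Complex.exp_add]
  congr 1
  ring

theorem weight_mul_wronskian_const {ks kl κ : ℂ} {f f₁ f₂ g g₁ g₂ : ℝ → ℂ}
    (hf : ∀ y, 0 < y → HasDerivAt f (f₁ y) y ∧ HasDerivAt f₁ (f₂ y) y ∧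
      f₂ y + radialCoeff ks kl y * f₁ y = κ * f y)
    (hg : ∀ y, 0 < y → HasDerivAt g (g₁ y) y ∧ HasDerivAt g₁ (g₂ y) y ∧
      g₂ y + radialCoeff ks kl y * g₁ y = κ * g y) {x y : ℝ} (hx : 0 < x) (hy : 0 < y) :
    weight ks kl x * (f x * g₁ x - f₁ x * g x) = weight ks kl y * (f y * g₁ y - f₁ y * g y) := by
  have hd : ∀ y, 0 < y → HasDerivAt (fun y => weight ks kl y * (f y * g₁ y - f₁ y * g y)) 0 y := by
    intro y hy
    obtain ⟨a1, a2, a3⟩ := hf y hy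
    obtain ⟨b1, b2, b3⟩ := hg y hy
    convert! (hasDerivAt_weight ks kl hy).mul ((a1.mul b2).sub (a2.mul b1)) using 1
    simp only [Pi.sub_apply, Pi.mul_apply]
    linear_combination weight ks kl y * (g y * a3 - f y * b3)
  exact isOpen_Ioi.is_const_of_deriv_eq_zero isPreconnected_Ioi
    (fun y hy => (hd y hy).differentiableAt.differentiableWithinAt) (fun y hy => (hd y hy).deriv)
    (show x ∈ Set.Ioi 0 from hx) (show y ∈ Set.Ioi 0 from hy)

theorem analyticAt_deriv_param {h : ℂ × ℂ → ℂ} {l y : ℂ} (hh : AnalyticAt ℂ h (l, y)) :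
    AnalyticAt ℂ (fun l => deriv (fun y => h (l, y)) y) l := by
  have h1 : AnalyticAt ℂ (fun l => fderiv ℂ h (l, y) (0, 1)) l := by
    have e1 : AnalyticAt ℂ (fun l : ℂ => fderiv ℂ h (l, y)) l :=
      hh.fderiv.comp_of_eq (analyticAt_id.prod analyticAt_const) rfl
    exact ((ContinuousLinearMap.apply ℂ ℂ ((0, 1) : ℂ × ℂ)).analyticAt _).comp_of_eq e1 rfl
  refine h1.congr ?_
  have c : ContinuousAt (fun l : ℂ => (l, y)) l := by fun_prop
  filter_upwards [c.eventually hh.eventually_analyticAt] with x hx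
  have hd := hx.differentiableAt.hasFDerivAt.comp_hasDerivAt y
    ((hasDerivAt_const y x).prodMk (hasDerivAt_id y))
  exact hd.deriv.symm

/-- The connection coefficient of `phi₁`, as a Wronskian. -/
noncomputable def connCoeff (ks kl l : ℂ) : ℂ :=
  weight ks kl 1 * (phi₁ ks kl l 1 * deriv (hcPhi ks kl (-l)) 1 -
    deriv (phi₁ ks kl l) 1 * hcPhi ks kl (-l) 1) / (-2 * l)

theorem analyticOnNhd_connCoeff (ks kl : ℂ) : AnalyticOnNhd ℂ (connCoeff ks kl) regularSet := by
  intro l hl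
  have h1 : (1 : ℂ) ∈ tubeDomain := by simpa using ofReal_mem_tubeDomain 1
  have hp := analyticAt_phi₁ ks kl l h1
  have hh := analyticAt_hcPhi ks kl (neg_mem_regularSet hl) (y := 1) (by simp)
  have a1 : AnalyticAt ℂ (fun l => phi₁ ks kl l 1) l := hp.curry_left
  have a2 : AnalyticAt ℂ (fun l => deriv (phi₁ ks kl l) 1) l := analyticAt_deriv_param hp
  have a3 : AnalyticAt ℂ (fun l => hcPhi ks kl (-l) 1) l :=
    AnalyticAt.comp_of_eq (g := fun l => hcPhi ks kl l 1) hh.curry_left analyticAt_id.neg rfl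
  have a4 : AnalyticAt ℂ (fun l => deriv (hcPhi ks kl (-l)) 1) l :=
    AnalyticAt.comp_of_eq (g := fun l => deriv (hcPhi ks kl l) 1) (analyticAt_deriv_param hh)
      analyticAt_id.neg rfl
  exact (analyticAt_const.mul ((a1.mul a4).sub (a2.mul a3))).div
    (analyticAt_const.mul analyticAt_id)
    (mul_ne_zero (by norm_num) (ne_zero_of_mem_regularSet hl))

theorem phi₁_real_ode {ks kl : ℂ} (hc : ∀ m : ℕ, ks + kl + 1 / 2 ≠ -(m : ℂ)) (l : ℂ) (y : ℝ)
    (hy : 0 < y) : HasDerivAt (fun y : ℝ => phi₁ ks kl l y) (deriv (phi₁ ks kl l) y) y ∧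
      HasDerivAt (fun y : ℝ => deriv (phi₁ ks kl l) y) (deriv (deriv (phi₁ ks kl l)) y) y ∧
      deriv (deriv (phi₁ ks kl l)) y + radialCoeff ks kl y * deriv (phi₁ ks kl l) y =
      (l ^ 2 - rho₁ ks kl ^ 2) * phi₁ ks kl l y :=
  have h0 := analyticAt_phi₁_right ks kl l (ofReal_mem_tubeDomain y)
  ⟨h0.differentiableAt.hasDerivAt.comp_ofReal, h0.deriv.differentiableAt.hasDerivAt.comp_ofReal,
    phi₁_ode hc l hy⟩

theorem phi₁_eq_connCoeff {ks kl : ℂ} (hc : ∀ m : ℕ, ks + kl + 1 / 2 ≠ -(m : ℂ)) {l : ℂ}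
    (hl : l ∈ regularSet) {y : ℝ} (hy : 0 < y) : phi₁ ks kl l y =
      connCoeff ks kl l * hcPhi ks kl l y + connCoeff ks kl (-l) * hcPhi ks kl (-l) y := by
  obtain ⟨f₁, f₂, hf, hft, hft₁⟩ := hcPhi_ode ks kl hl
  obtain ⟨g₁, g₂, hg, hgt, hgt₁⟩ := hcPhi_ode ks kl (neg_mem_regularSet hl)
  rw [neg_sq] at hg
  have hf' : ∀ y : ℝ, 0 < y → HasDerivAt (fun y : ℝ => hcPhi ks kl l y) (f₁ y) y ∧
      HasDerivAt (fun y : ℝ => f₁ y) (f₂ y) y ∧ f₂ y + radialCoeff ks kl y * f₁ y =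
      (l ^ 2 - rho₁ ks kl ^ 2) * hcPhi ks kl l y := fun y hy => by
    obtain ⟨a1, a2, a3⟩ := hf y (by simpa using hy)
    exact ⟨a1.comp_ofReal, a2.comp_ofReal, a3⟩
  have hg' : ∀ y : ℝ, 0 < y → HasDerivAt (fun y : ℝ => hcPhi ks kl (-l) y) (g₁ y) y ∧
      HasDerivAt (fun y : ℝ => g₁ y) (g₂ y) y ∧ g₂ y + radialCoeff ks kl y * g₁ y =
      (l ^ 2 - rho₁ ks kl ^ 2) * hcPhi ks kl (-l) y := fun y hy => by
    obtain ⟨a1, a2, a3⟩ := hg y (by simpa using hy)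
    exact ⟨a1.comp_ofReal, a2.comp_ofReal, a3⟩
  have hp := phi₁_real_ode hc l
  have l0 := ne_zero_of_mem_regularSet hl
  have W1 : weight ks kl y * (hcPhi ks kl l y * g₁ y - f₁ y * hcPhi ks kl (-l) y) = -2 * l := by
    have ht : Tendsto (fun y : ℝ => weight ks kl y * (hcPhi ks kl l y * g₁ y -
        f₁ y * hcPhi ks kl (-l) y)) atTop (𝓝 (1 * (1 * (-l - rho₁ ks kl) -
          (l - rho₁ ks kl) * 1))) := by
      refine ((tendsto_exp_mul_weight ks kl).mul ((hft.mul hgt₁).sub (hft₁.mul hgt))).congr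
        fun y => ?_
      have e : Complex.exp (-(2 * rho₁ ks kl * y)) * (Complex.exp (-((l - rho₁ ks kl) * y)) *
          Complex.exp (-((-l - rho₁ ks kl) * y))) = 1 := by
        rw [← Complex.exp_add, ← Complex.exp_add, ← Complex.exp_zero]
        congr 1
        ring
      linear_combination weight ks kl y * (hcPhi ks kl l y * g₁ y -
        f₁ y * hcPhi ks kl (-l) y) * e
    have hcst : Tendsto (fun x : ℝ => weight ks kl x * (hcPhi ks kl l x * g₁ x -
        f₁ x * hcPhi ks kl (-l) x)) atTop (𝓝 (weight ks kl y * (hcPhi ks kl l y * g₁ y -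
          f₁ y * hcPhi ks kl (-l) y))) := by
      refine tendsto_const_nhds.congr' ?_
      filter_upwards [eventually_gt_atTop 0] with x hx
      exact weight_mul_wronskian_const hf' hg' hy hx
    rw [tendsto_nhds_unique hcst ht]
    ring
  have W2 : weight ks kl y * (phi₁ ks kl l y * g₁ y - deriv (phi₁ ks kl l) y *
      hcPhi ks kl (-l) y) = -2 * l * connCoeff ks kl l := by
    have h := weight_mul_wronskian_const hp hg' hy one_pos
    have e : deriv (hcPhi ks kl (-l)) 1 = g₁ 1 := (hg 1 (by simp)).1.deriv
    rw [h, connCoeff, e]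
    push_cast
    field_simp
  have W3 : weight ks kl y * (phi₁ ks kl l y * f₁ y - deriv (phi₁ ks kl l) y *
      hcPhi ks kl l y) = 2 * l * connCoeff ks kl (-l) := by
    have h := weight_mul_wronskian_const hp hf' hy one_pos
    have e : deriv (hcPhi ks kl l) 1 = f₁ 1 := (hf 1 (by simp)).1.deriv
    have h1 : (1 : ℂ) ∈ tubeDomain := by simpa using ofReal_mem_tubeDomain 1
    have e2 : deriv (phi₁ ks kl (-l)) 1 = deriv (phi₁ ks kl l) 1 := by
      refine Filter.EventuallyEq.deriv_eq ?_
      filter_upwards [isOpen_tubeDomain.mem_nhds h1] with z hz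
      exact phi₁_neg hc l hz
    rw [h, connCoeff, neg_neg, e, e2, phi₁_neg hc l h1]
    push_cast
    field_simp
  have l2 : -2 * l ≠ 0 := mul_ne_zero (by norm_num) l0
  refine mul_left_cancel₀ l2 ?_
  linear_combination -phi₁ ks kl l y * W1 + hcPhi ks kl l y * W2 - hcPhi ks kl (-l) y * W3

/-- The value of `connCoeff` in terms of Gamma functions. -/
noncomputable def gammaCoeff (ks kl l : ℂ) : ℂ :=
  (4 : ℂ) ^ (rho₁ ks kl - l) * (Complex.Gamma (ks + kl + 1 / 2) * Complex.Gamma (2 * l)) *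
    ((Complex.Gamma (rho₁ ks kl + l))⁻¹ * (Complex.Gamma (l + (ks + 1) / 2))⁻¹)

theorem gamma_ne_pole_of_mem_regularSet {l : ℂ} (hl : l ∈ regularSet) (m : ℕ) :
    2 * l ≠ -(m : ℂ) := fun h => hl ⟨-m, by rw [h]; push_cast; rfl⟩

theorem analyticOnNhd_gammaCoeff (ks kl : ℂ) :
    AnalyticOnNhd ℂ (gammaCoeff ks kl) regularSet := by
  have hd : DifferentiableOn ℂ (gammaCoeff ks kl) regularSet := by
    intro l hl
    refine DifferentiableAt.differentiableWithinAt ?_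
    have h4 : DifferentiableAt ℂ (fun l : ℂ => (4 : ℂ) ^ (rho₁ ks kl - l)) l :=
      DifferentiableAt.const_cpow (by fun_prop) (Or.inl (by norm_num))
    have hΓ : DifferentiableAt ℂ (fun l : ℂ => Complex.Gamma (2 * l)) l :=
      (Complex.differentiableAt_Gamma _ (gamma_ne_pole_of_mem_regularSet hl)).comp l
        (by fun_prop)
    have h1 : DifferentiableAt ℂ (fun l : ℂ => (Complex.Gamma (rho₁ ks kl + l))⁻¹) l :=
      DifferentiableAt.comp (g := fun s => (Complex.Gamma s)⁻¹) l
        (Complex.differentiable_one_div_Gamma (rho₁ ks kl + l)) (by fun_prop)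
    have h2 : DifferentiableAt ℂ (fun l : ℂ => (Complex.Gamma (l + (ks + 1) / 2))⁻¹) l :=
      DifferentiableAt.comp (g := fun s => (Complex.Gamma s)⁻¹) l
        (Complex.differentiable_one_div_Gamma (l + (ks + 1) / 2)) (by fun_prop)
    exact (h4.mul (hΓ.const_mul _)).mul (h1.mul h2)
  exact hd.analyticOnNhd isOpen_regularSet

theorem tendsto_exp_mul_phi₁ {ks kl l : ℂ} (hc : ∀ m : ℕ, ks + kl + 1 / 2 ≠ -(m : ℂ))
    (hl : 0 < l.re) :
    Tendsto (fun y : ℝ => Complex.exp (-((l - rho₁ ks kl) * y)) * phi₁ ks kl l y) atTop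
      (𝓝 (gammaCoeff ks kl l)) := by
  set ρ := rho₁ ks kl with hρ
  set c := ks + kl + 1 / 2 with hcdef
  have hgauss : 0 < (c - (ρ - l) - (c - (ρ + l))).re := by
    have : c - (ρ - l) - (c - (ρ + l)) = 2 * l := by ring
    rw [this]
    simpa using hl
  have hch : Tendsto Real.cosh atTop atTop := by
    refine tendsto_atTop_mono (fun x => ?_) (Real.tendsto_exp_atTop.const_mul_atTop
      (show (0 : ℝ) < 1 / 2 by norm_num))
    rw [Real.cosh_eq]
    linarith [Real.exp_pos (-x)]
  have hu : Tendsto (fun y : ℝ => Real.tanh (y / 2) ^ 2) atTop (𝓝[<] 1) := by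
    refine tendsto_nhdsWithin_iff.2 ⟨?_, Eventually.of_forall fun y => tanh_sq_lt_one _⟩
    have h1 : Tendsto (fun y : ℝ => 1 - (Real.cosh (y / 2) ^ 2)⁻¹) atTop (𝓝 (1 - 0)) :=
      tendsto_const_nhds.sub (tendsto_inv_atTop_zero.comp ((tendsto_pow_atTop two_ne_zero).comp
        (hch.comp (tendsto_id.atTop_div_const two_pos))))
    rw [sub_zero] at h1
    refine h1.congr fun y => ?_
    have := (Real.cosh_pos (y / 2)).ne'
    rw [Real.tanh_eq_sinh_div_cosh, div_pow, Real.sinh_sq]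
    field_simp
  have hH := (tendsto_hypergeometric_one hgauss).comp hu
  have hq : Tendsto (fun y : ℝ => Real.exp (-y)) atTop (𝓝 0) := Real.tendsto_exp_neg_atTop_nhds_zero
  have hE : Tendsto (fun y : ℝ => Complex.exp ((ρ - l) *
      ((Real.log 4 - 2 * Real.log (1 + Real.exp (-y)) : ℝ) : ℂ))) atTop (𝓝 ((4 : ℂ) ^ (ρ - l))) := by
    have c1 : ContinuousAt (fun q : ℝ => Complex.exp ((ρ - l) *
        ((Real.log 4 - 2 * Real.log (1 + q) : ℝ) : ℂ))) 0 := by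
      have a1 : ContinuousAt (fun q : ℝ => Real.log 4 - 2 * Real.log (1 + q)) 0 :=
        continuousAt_const.sub (continuousAt_const.mul (ContinuousAt.log (by fun_prop) (by simp)))
      have b1 := Complex.continuous_ofReal.continuousAt.comp a1
      simp only [Function.comp_def] at b1
      fun_prop
    have := c1.tendsto.comp hq
    convert! this using 2
    rw [add_zero, Real.log_one, mul_zero, sub_zero, Complex.cpow_def_of_ne_zero (by norm_num),
      mul_comm, Complex.ofReal_log (by norm_num)]
    norm_num
  have h := hE.mul hH
  rw [tsum_hgc_eq_Gamma hc hgauss] at h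
  convert! h.congr' ?_ using 2
  · rw [gammaCoeff, ← hρ, ← hcdef, show c - (ρ - l) - (c - (ρ + l)) = 2 * l by ring,
      show c - (c - (ρ + l)) = ρ + l by ring, show c - (ρ - l) = l + (ks + 1) / 2 by
        rw [hρ, hcdef, rho₁]; ring, div_eq_mul_inv (_ * _) (_ * _), mul_inv]
    ring
  · filter_upwards with y
    simp only [Function.comp_apply]
    rw [phi₁, ← hρ, ← hcdef, psi, tanh_ofReal_half_sq]
    have hpos : 0 < 1 - Real.tanh (y / 2) ^ 2 := sub_pos.2 (tanh_sq_lt_one _)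
    have hlog : Real.log (1 - Real.tanh (y / 2) ^ 2) =
        Real.log 4 - 2 * Real.log (1 + Real.exp (-y)) - y := by
      have e1 : 1 - Real.tanh (y / 2) ^ 2 = 4 * Real.exp (-y) / (1 + Real.exp (-y)) ^ 2 := by
        have hE' : Real.exp (-y) = Real.exp (-(y / 2)) ^ 2 := by
          rw [← Real.exp_nat_mul]
          congr 1
          push_cast
          ring
        have hX : Real.exp (y / 2) = (Real.exp (-(y / 2)))⁻¹ := by
          rw [Real.exp_neg, inv_inv]
        rw [Real.tanh_eq_sinh_div_cosh, Real.sinh_eq, Real.cosh_eq, hE', hX]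
        have := Real.exp_pos (-(y / 2))
        field_simp
        ring
      rw [e1, Real.log_div (by positivity) (by positivity), Real.log_mul (by norm_num)
        (Real.exp_ne_zero _), Real.log_exp, Real.log_pow]
      push_cast
      ring
    have hcp : (1 - ((Real.tanh (y / 2) ^ 2 : ℝ) : ℂ)) ^ (ρ - l) =
        Complex.exp ((ρ - l) * ((Real.log 4 - 2 * Real.log (1 + Real.exp (-y)) - y : ℝ) : ℂ)) := by
      rw [← hlog, Complex.ofReal_log hpos.le, Complex.cpow_def_of_ne_zero, mul_comm]
      · push_cast
        rfl
      · have := hpos.ne'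
        exact_mod_cast this
    rw [hcp, ← mul_assoc, ← Complex.exp_add]
    congr 2
    push_cast
    ring

theorem connCoeff_eq_gammaCoeff_of_re_pos {ks kl l : ℂ}
    (hc : ∀ m : ℕ, ks + kl + 1 / 2 ≠ -(m : ℂ)) (hl : l ∈ regularSet) (hre : 0 < l.re) :
    connCoeff ks kl l = gammaCoeff ks kl l := by
  obtain ⟨-, -, -, ht, -⟩ := hcPhi_ode ks kl hl
  obtain ⟨-, -, -, ht', -⟩ := hcPhi_ode ks kl (neg_mem_regularSet hl)
  have hdec : Tendsto (fun y : ℝ => Complex.exp (-(2 * l * y))) atTop (𝓝 0) := by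
    rw [tendsto_zero_iff_norm_tendsto_zero]
    have : Tendsto (fun y : ℝ => Real.exp (-(2 * l.re * y))) atTop (𝓝 0) :=
      Real.tendsto_exp_neg_atTop_nhds_zero.comp
        (tendsto_id.const_mul_atTop (by linarith))
    refine this.congr fun y => ?_
    rw [Complex.norm_exp]
    simp
  have h : Tendsto (fun y : ℝ => Complex.exp (-((l - rho₁ ks kl) * y)) * phi₁ ks kl l y) atTop
      (𝓝 (connCoeff ks kl l * 1 + connCoeff ks kl (-l) * (0 * 1))) := by
    refine ((ht.const_mul _).add ((hdec.mul ht').const_mul _)).congr' ?_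
    filter_upwards [eventually_gt_atTop 0] with y hy
    rw [phi₁_eq_connCoeff hc hl hy]
    have e : Complex.exp (-(2 * l * y)) * Complex.exp (-((-l - rho₁ ks kl) * y)) =
        Complex.exp (-((l - rho₁ ks kl) * y)) := by
      rw [← Complex.exp_add]
      congr 1
      ring
    linear_combination connCoeff ks kl (-l) * hcPhi ks kl (-l) y * e
  have := tendsto_nhds_unique h (tendsto_exp_mul_phi₁ hc hre)
  simpa using this

theorem isPreconnected_regularSet : IsPreconnected regularSet := by
  have hcount : (regularSet)ᶜ.Countable := by
    have : (regularSet)ᶜ ⊆ Set.range (fun m : ℤ => (m : ℂ) / 2) := by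
      intro l hl
      obtain ⟨m, hm⟩ := not_not.1 hl
      exact ⟨m, by simp only [hm]; ring⟩
    exact (Set.countable_range _).mono this
  have := (hcount.isConnected_compl_of_one_lt_rank (by
    rw [Complex.rank_real_complex]
    exact_mod_cast one_lt_two)).isPreconnected
  rwa [compl_compl] at this

theorem connCoeff_eq_gammaCoeff {ks kl l : ℂ} (hc : ∀ m : ℕ, ks + kl + 1 / 2 ≠ -(m : ℂ))
    (hl : l ∈ regularSet) : connCoeff ks kl l = gammaCoeff ks kl l := by
  have h0 : (1 + Complex.I) ∈ regularSet := by
    rintro ⟨m, hm⟩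
    have := congrArg Complex.im hm
    simp at this
  refine (analyticOnNhd_connCoeff ks kl).eqOn_of_preconnected_of_eventuallyEq
    (analyticOnNhd_gammaCoeff ks kl) isPreconnected_regularSet h0 ?_ hl
  have hre : ∀ᶠ l : ℂ in 𝓝 (1 + Complex.I), 0 < l.re :=
    Complex.continuous_re.continuousAt.eventually (lt_mem_nhds (by simp))
  filter_upwards [isOpen_regularSet.mem_nhds h0, hre] with l h1 h2
  exact connCoeff_eq_gammaCoeff_of_re_pos hc h1 h2

/-- The `c`-function of rank one, not normalized. -/
noncomputable def cTilde₁ (ks kl l : ℂ) : ℂ :=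
  Complex.Gamma (2 * l) / Complex.Gamma (2 * l + ks) *
    (Complex.Gamma (l + ks / 2) / Complex.Gamma (l + ks / 2 + kl))

/-- The value of the `c`-function of rank one at `ρ`. -/
noncomputable def cRho₁ (ks kl : ℂ) : ℂ :=
  (Real.sqrt Real.pi : ℂ) * (2 : ℂ) ^ (1 - 2 * (ks + kl)) * (Complex.Gamma (ks + kl + 1 / 2))⁻¹

theorem Gamma_div_Gamma_two_mul {z : ℂ} (hz : ∀ m : ℕ, z ≠ -(m : ℂ)) :
    Complex.Gamma z / Complex.Gamma (2 * z) =
      (Real.sqrt Real.pi : ℂ) * (2 : ℂ) ^ (1 - 2 * z) * (Complex.Gamma (z + 1 / 2))⁻¹ := by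
  have h := Complex.Gamma_mul_Gamma_add_half z
  have hz0 := Complex.Gamma_ne_zero hz
  have hp : (Real.sqrt Real.pi : ℂ) ≠ 0 := by
    exact_mod_cast (Real.sqrt_pos.2 Real.pi_pos).ne'
  have h2 : (2 : ℂ) ^ (1 - 2 * z) ≠ 0 := by
    rw [Complex.cpow_ne_zero_iff]
    exact Or.inl two_ne_zero
  by_cases h0 : Complex.Gamma (z + 1 / 2) = 0
  · rw [h0, mul_zero] at h
    have : Complex.Gamma (2 * z) = 0 := by
      rcases mul_eq_zero.1 h.symm with h | h
      · rcases mul_eq_zero.1 h with h | h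
        · exact h
        · exact absurd h h2
      · exact absurd h hp
    rw [this, h0]
    simp
  · have : Complex.Gamma (2 * z) ≠ 0 := fun h' => by
      rw [h', zero_mul, zero_mul] at h
      exact (mul_ne_zero hz0 h0) h
    generalize Complex.Gamma (z + 1 / 2) = G at *
    field_simp
    linear_combination h

theorem cRho₁_ne_zero {ks kl : ℂ} (hc : ∀ m : ℕ, ks + kl + 1 / 2 ≠ -(m : ℂ)) :
    cRho₁ ks kl ≠ 0 := by
  refine mul_ne_zero (mul_ne_zero ?_ ?_) (inv_ne_zero (Complex.Gamma_ne_zero hc))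
  · exact_mod_cast (Real.sqrt_pos.2 Real.pi_pos).ne'
  · rw [Complex.cpow_ne_zero_iff]
    exact Or.inl two_ne_zero

theorem gammaCoeff_eq_cTilde₁ {ks kl l : ℂ} (hc : ∀ m : ℕ, ks + kl + 1 / 2 ≠ -(m : ℂ))
    (hl : ∀ m : ℕ, l + ks / 2 ≠ -(m : ℂ)) :
    gammaCoeff ks kl l = cTilde₁ ks kl l / cRho₁ ks kl := by
  have h := Gamma_div_Gamma_two_mul hl
  have e : cTilde₁ ks kl l = Complex.Gamma (2 * l) * (Complex.Gamma (rho₁ ks kl + l))⁻¹ *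
      (Complex.Gamma (l + ks / 2) / Complex.Gamma (2 * (l + ks / 2))) := by
    rw [cTilde₁, rho₁, show 2 * l + ks = 2 * (l + ks / 2) by ring,
      show l + ks / 2 + kl = ks / 2 + kl + l by ring]
    ring
  have hp : (Real.sqrt Real.pi : ℂ) ≠ 0 := by
    exact_mod_cast (Real.sqrt_pos.2 Real.pi_pos).ne'
  have h2 : ∀ z : ℂ, (2 : ℂ) ^ z ≠ 0 := fun z => by
    rw [Complex.cpow_ne_zero_iff]
    exact Or.inl two_ne_zero
  have e4 : (4 : ℂ) ^ (rho₁ ks kl - l) * (2 : ℂ) ^ (1 - 2 * (ks + kl)) =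
      (2 : ℂ) ^ (1 - 2 * (l + ks / 2)) := by
    have : (4 : ℂ) ^ (rho₁ ks kl - l) = (2 : ℂ) ^ (2 * (rho₁ ks kl - l)) := by
      rw [Complex.cpow_ofNat_mul]
      rw [show (4 : ℂ) = 2 * 2 by norm_num]
      rw [pow_two]
      have := Complex.mul_cpow_ofReal_nonneg (a := 2) (b := 2) (by norm_num) (by norm_num)
        (rho₁ ks kl - l)
      push_cast at this
      exact this
    rw [this, ← Complex.cpow_add _ _ two_ne_zero]
    congr 1
    rw [rho₁]
    ring
  rw [eq_div_iff (cRho₁_ne_zero hc), e, h, gammaCoeff, cRho₁, ← e4,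
    show l + ks / 2 + 1 / 2 = l + (ks + 1) / 2 by ring]
  have := Complex.Gamma_ne_zero hc
  generalize Complex.Gamma (ks + kl + 1 / 2) = G at *
  field_simp

/-- The Harish-Chandra expansion of the rank one hypergeometric function. -/
theorem phi₁_eq_cTilde₁ {ks kl : ℂ} (hc : ∀ m : ℕ, ks + kl + 1 / 2 ≠ -(m : ℂ)) {l : ℂ}
    (hl : l ∈ regularSet) (h1 : ∀ m : ℕ, l + ks / 2 ≠ -(m : ℂ))
    (h2 : ∀ m : ℕ, -l + ks / 2 ≠ -(m : ℂ)) {y : ℝ} (hy : 0 < y) :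
    cRho₁ ks kl * phi₁ ks kl l y =
      cTilde₁ ks kl l * hcPhi ks kl l y + cTilde₁ ks kl (-l) * hcPhi ks kl (-l) y := by
  have h0 := cRho₁_ne_zero hc
  rw [phi₁_eq_connCoeff hc hl hy, connCoeff_eq_gammaCoeff hc hl,
    connCoeff_eq_gammaCoeff hc (neg_mem_regularSet hl), gammaCoeff_eq_cTilde₁ hc h1,
    gammaCoeff_eq_cTilde₁ hc h2]
  field_simp

/-! ### Division of analytic functions by linear forms -/

section Division

variable {E : Type*} [NormedAddCommGroup E] [NormedSpace ℂ E]

/-- The `n`-th coefficient of the quotient of a power series by a linear form `L` with `L v = 1`. -/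
noncomputable def quotientSeries (p : FormalMultilinearSeries ℂ E ℂ) (π : E →L[ℂ] E) (v : E) :
    FormalMultilinearSeries ℂ E ℂ := fun n =>
  ∑ i : Fin (n + 1), ContinuousMultilinearMap.curryMid (Ei := fun _ => E) i
    ((p (n + 1)).compContinuousLinearMap
      (fun j => if j < i then π else ContinuousLinearMap.id ℂ E)) v

theorem mul_quotientSeries_apply (p : FormalMultilinearSeries ℂ E ℂ) (L : E →L[ℂ] ℂ) (v : E)
    (n : ℕ) (h : E) :
    L h * quotientSeries p (ContinuousLinearMap.id ℂ E - L.smulRight v) v n (fun _ => h) =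
      p (n + 1) (fun _ => h) - p (n + 1) (fun _ => h - L h • v) := by
  let u : ℕ → Fin (n + 1) → E := fun i j => if (j : ℕ) < i then h - L h • v else h
  have h0 : p (n + 1) (fun _ => h) = p (n + 1) (u 0) := by simp [u]
  have h1 : p (n + 1) (fun _ => h - L h • v) = p (n + 1) (u (n + 1)) := by
    congr 1
    funext j
    simp only [u]
    rw [if_pos j.2]
  rw [h0, h1, ← Finset.sum_range_sub' (fun i => p (n + 1) (u i)), Finset.sum_range, quotientSeries,
    sum_apply, Finset.mul_sum]
  refine Finset.sum_congr rfl fun i _ => ?_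
  rw [ContinuousMultilinearMap.curryMid_apply,
    ContinuousMultilinearMap.compContinuousLinearMap_apply]
  have e1 : (fun j : Fin (n + 1) => (if j < i then ContinuousLinearMap.id ℂ E - L.smulRight v else
      ContinuousLinearMap.id ℂ E) ((i.insertNth v (fun _ => h) : Fin (n + 1) → E) j)) =
      Function.update (u i) i v := by
    funext j
    rcases eq_or_ne j i with rfl | hj
    · simp
    · obtain ⟨k, rfl⟩ := Fin.exists_succAbove_eq hj
      rw [Fin.insertNth_apply_succAbove, Function.update_of_ne hj]
      simp only [u, Fin.lt_def]
      split_ifs <;> simp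
  have e2 : u i = Function.update (u i) i h := by
    funext j
    rcases eq_or_ne j i with rfl | hj
    · simp [u]
    · rw [Function.update_of_ne hj]
  have e3 : u (i + 1) = Function.update (u i) i (h - L h • v) := by
    funext j
    rcases eq_or_ne j i with rfl | hj
    · simp [u]
    · rw [Function.update_of_ne hj]
      have : (j : ℕ) < i + 1 ↔ (j : ℕ) < i := by
        have := Fin.val_ne_of_ne hj
        omega
      simp only [u, this]
  rw [e1, e3]
  nth_rewrite 2 [e2]
  rw [← ContinuousMultilinearMap.map_update_sub, sub_sub_cancel,
    ContinuousMultilinearMap.map_update_smul, smul_eq_mul]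

theorem norm_quotientSeries_le (p : FormalMultilinearSeries ℂ E ℂ) (π : E →L[ℂ] E) (v : E) (n : ℕ) :
    ‖quotientSeries p π v n‖ ≤ (n + 1) * (‖p (n + 1)‖ * (‖π‖ + 1) ^ (n + 1) * ‖v‖) := by
  refine (norm_sum_le _ _).trans ((Finset.sum_le_card_nsmul _ _
    (‖p (n + 1)‖ * (‖π‖ + 1) ^ (n + 1) * ‖v‖) fun i _ => ?_).trans (by simp))
  refine (ContinuousLinearMap.le_opNorm _ _).trans ?_
  rw [ContinuousMultilinearMap.norm_curryMid]
  gcongr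
  refine (ContinuousMultilinearMap.norm_compContinuousLinearMap_le _ _).trans ?_
  gcongr
  refine (Finset.prod_le_prod (g := fun _ => ‖π‖ + 1) (fun j _ => norm_nonneg _)
    fun j _ => ?_).trans (by simp)
  split_ifs
  · linarith
  · exact ContinuousLinearMap.norm_id_le.trans (by linarith [norm_nonneg π])

theorem quotientSeries_radius_pos {p : FormalMultilinearSeries ℂ E ℂ} (hp : 0 < p.radius)
    (π : E →L[ℂ] E) (v : E) : 0 < (quotientSeries p π v).radius := by
  obtain ⟨C, r, hC, hr, hle⟩ := p.le_mul_pow_of_radius_pos hp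
  obtain ⟨a, hra⟩ : ∃ a : ℝ, a = r * (‖π‖ + 1) := ⟨_, rfl⟩
  have ha : 0 < a := by rw [hra]; positivity
  let s : NNReal := ⟨1 / (2 * a), by positivity⟩
  have hs : 0 < s := by
    rw [← NNReal.coe_pos]
    change 0 < 1 / (2 * a)
    positivity
  refine lt_of_lt_of_le (ENNReal.coe_pos.2 hs)
    (FormalMultilinearSeries.le_radius_of_bound _ (C * a * ‖v‖) fun n => ?_)
  have hb : ‖quotientSeries p π v n‖ ≤ (n + 1) * (C * a ^ (n + 1) * ‖v‖) := by
    refine (norm_quotientSeries_le p π v n).trans ?_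
    have := hle (n + 1)
    calc _ ≤ ((n : ℝ) + 1) * (C * r ^ (n + 1) * (‖π‖ + 1) ^ (n + 1) * ‖v‖) := by gcongr
      _ = _ := by rw [hra, mul_pow]; ring
  have h2 : ((n : ℝ) + 1) * (1 / 2) ^ n ≤ 1 := by
    have : (n : ℝ) + 1 ≤ 2 ^ n := by exact_mod_cast Nat.lt_two_pow_self (n := n)
    rw [one_div, inv_pow, ← div_eq_mul_inv, div_le_one (by positivity)]
    exact this
  calc _ ≤ ((n : ℝ) + 1) * (C * a ^ (n + 1) * ‖v‖) * (1 / (2 * a)) ^ n := by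
        change _ * (1 / (2 * a)) ^ n ≤ _
        gcongr
    _ = ((n + 1) * (1 / 2) ^ n) * (C * a * ‖v‖) := by
        rw [div_pow, div_pow, mul_pow, one_pow, pow_succ]
        field_simp
    _ ≤ 1 * (C * a * ‖v‖) := by gcongr
    _ = _ := one_mul _

theorem exists_analyticAt_eq_linear_mul {f : E → ℂ} {x₀ : E} (hf : AnalyticAt ℂ f x₀)
    (L : E →L[ℂ] ℂ) {v : E} (hv : L v = 1) (h0 : L x₀ = 0)
    (hz : ∀ᶠ x in 𝓝 x₀, L x = 0 → f x = 0) :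
    ∃ g, AnalyticAt ℂ g x₀ ∧ ∀ᶠ x in 𝓝 x₀, f x = L x * g x := by
  obtain ⟨p, r, hp⟩ := hf
  set π : E →L[ℂ] E := ContinuousLinearMap.id ℂ E - L.smulRight v with hπ
  have hq := quotientSeries_radius_pos hp.radius_pos π v
  have hqb := (quotientSeries p π v).hasFPowerSeriesOnBall hq
  refine ⟨fun x => (quotientSeries p π v).sum (x - x₀), ?_, ?_⟩
  · exact hqb.analyticAt.comp_of_eq (analyticAt_id.sub analyticAt_const) (sub_self x₀)
  · have t0 : Tendsto (fun x => x - x₀) (𝓝 x₀) (𝓝 0) := by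
      have : ContinuousAt (fun x => x - x₀) x₀ := by fun_prop
      simpa [ContinuousAt] using this
    have t1 : Tendsto (fun x => π (x - x₀)) (𝓝 x₀) (𝓝 0) := by
      have := (π.continuous.tendsto 0).comp t0
      rw [map_zero] at this
      exact this
    have t2 : Tendsto (fun x => x₀ + π (x - x₀)) (𝓝 x₀) (𝓝 x₀) := by
      simpa using t1.const_add x₀
    filter_upwards [t0.eventually (Metric.eball_mem_nhds 0 hq),
      t0.eventually (Metric.eball_mem_nhds 0 hp.r_pos),
      t1.eventually (Metric.eball_mem_nhds 0 hp.r_pos), t2.eventually hz] with x b1 b2 b3 b4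
    have s1 := hp.hasSum b2
    have s2 := hp.hasSum b3
    have s3 := hqb.hasSum b1
    rw [add_sub_cancel] at s1
    rw [zero_add] at s3
    have hL : L x = L (x - x₀) := by rw [map_sub, h0, sub_zero]
    have e : f (x₀ + π (x - x₀)) = 0 := b4 (by
      rw [map_add, h0, hπ]
      simp [hv])
    rw [e] at s2
    have s4 := s1.sub s2
    rw [← hasSum_nat_add_iff' 1] at s4
    have s5 := s3.mul_left (L (x - x₀))
    simp only [mul_quotientSeries_apply, hπ] at s5
    rw [hL]
    refine (s5.unique ?_).symm
    convert! s4 using 1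
    rw [Finset.sum_range_one, sub_zero]
    have : p 0 (fun _ => x - x₀) = p 0 (fun _ => π (x - x₀)) := by
      congr 1
      exact Subsingleton.elim _ _
    rw [this, sub_self, sub_zero]

theorem exists_analyticOnNhd_eq_linear_mul {f : E → ℂ} {U : Set E} (hU : IsOpen U)
    (hf : AnalyticOnNhd ℂ f U) (L : E →L[ℂ] ℂ) (hL : L ≠ 0) (hz : ∀ x ∈ U, L x = 0 → f x = 0) :
    ∃ g, AnalyticOnNhd ℂ g U ∧ ∀ x ∈ U, f x = L x * g x := by
  classical
  obtain ⟨w, hw⟩ : ∃ w, L w ≠ 0 := by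
    by_contra! h
    exact hL (ContinuousLinearMap.ext h)
  obtain ⟨v, hv⟩ : ∃ v, L v = 1 := ⟨(L w)⁻¹ • w, by simp [hw]⟩
  refine ⟨fun x => if L x = 0 then fderiv ℂ f x v else f x / L x, fun x hx => ?_, fun x hx => ?_⟩
  · by_cases h0 : L x = 0
    · obtain ⟨g, hg, he⟩ := exists_analyticAt_eq_linear_mul (hf x hx) L hv h0
        (by filter_upwards [hU.mem_nhds hx] with y hy using hz y hy)
      refine hg.congr ?_
      filter_upwards [he.eventually_nhds, hg.eventually_analyticAt] with y h1 h2
      split_ifs with h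
      · have hd := (L.hasFDerivAt (x := y)).mul h2.differentiableAt.hasFDerivAt
        have : fderiv ℂ f y = _ := (hd.congr_of_eventuallyEq h1).fderiv
        rw [this]
        simp [h, hv]
      · rw [h1.self_of_nhds]
        field_simp
    · have h1 : AnalyticAt ℂ (fun x => f x / L x) x := (hf x hx).div (L.analyticAt x) h0
      refine h1.congr ?_
      filter_upwards [L.continuous.continuousAt.eventually_ne h0] with y hy
      rw [if_neg hy]
  · dsimp only
    split_ifs with h
    · rw [hz x hx h, h, zero_mul]
    · field_simp

/-- An analytic function which vanishes on finitely many distinct hyperplanes is divisible by the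
product of the corresponding linear forms. -/
theorem exists_analyticOnNhd_eq_prod_linear_mul {ι : Type*} {U : Set E} (hU : IsOpen U)
    (L : ι → E →L[ℂ] ℂ) (s : Finset ι) (hL : ∀ i ∈ s, L i ≠ 0)
    (hpair : ∀ i ∈ s, ∀ j ∈ s, i ≠ j → ∃ v, L j v = 0 ∧ L i v ≠ 0) :
    ∀ {f : E → ℂ}, AnalyticOnNhd ℂ f U → (∀ i ∈ s, ∀ x ∈ U, L i x = 0 → f x = 0) →
    ∃ g, AnalyticOnNhd ℂ g U ∧ ∀ x ∈ U, f x = (∏ i ∈ s, L i x) * g x := by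
  classical
  induction s using Finset.induction_on with
  | empty => exact fun {f} hf _ => ⟨f, hf, fun x _ => by simp⟩
  | insert i s hi ih =>
    intro f hf hz
    obtain ⟨g, hg, hfg⟩ := exists_analyticOnNhd_eq_linear_mul hU hf (L i)
      (hL i (Finset.mem_insert_self i s)) (hz i (Finset.mem_insert_self i s))
    have hg0 : ∀ j ∈ s, ∀ x ∈ U, L j x = 0 → g x = 0 := by
      intro j hj x hx hjx
      have hfx := hz j (Finset.mem_insert_of_mem hj)
      by_cases hix : L i x = 0
      · obtain ⟨v, hv, hv'⟩ := hpair i (Finset.mem_insert_self i s) j (Finset.mem_insert_of_mem hj)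
          (fun h => hi (h ▸ hj))
        have ht : Tendsto (fun t : ℂ => x + t • v) (𝓝[≠] 0) (𝓝 x) := by
          have : ContinuousAt (fun t : ℂ => x + t • v) 0 := by fun_prop
          simpa [ContinuousAt] using this.tendsto.mono_left (nhdsWithin_le_nhds (s := {0}ᶜ))
        have h1 := (hg x hx).continuousAt.tendsto.comp ht
        refine tendsto_nhds_unique h1 (tendsto_const_nhds.congr' ?_)
        filter_upwards [ht.eventually (hU.mem_nhds hx), self_mem_nhdsWithin] with t htU ht0
        have h2 := hfx _ htU (by rw [map_add, map_smul, hjx, hv]; simp)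
        rw [hfg _ htU, map_add, map_smul, hix, zero_add, smul_eq_mul] at h2
        rcases mul_eq_zero.1 h2 with h2 | h2
        · exact absurd h2 (mul_ne_zero ht0 hv')
        · exact h2.symm
      · have := hfx x hx hjx
        rw [hfg x hx] at this
        exact (mul_eq_zero.1 this).resolve_left hix
    obtain ⟨k, hk, hgk⟩ := ih (fun j hj => hL j (Finset.mem_insert_of_mem hj))
      (fun a ha b hb => hpair a (Finset.mem_insert_of_mem ha) b (Finset.mem_insert_of_mem hb)) hg hg0
    refine ⟨k, hk, fun x hx => ?_⟩
    rw [hfg x hx, hgk x hx, Finset.prod_insert hi, mul_assoc]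

end Division

/-! ### Roots -/

section Roots

variable {n : ℕ}

theorem e_apply (i j : Fin n) : e i j = if j = i then 1 else 0 := by
  simp [e, Pi.single_apply]

theorem pairC_e (v : Fin n → ℂ) (i : Fin n) : pairC v (e i) = v i := by
  simp [pairC, e_apply]

theorem pairC_add (v : Fin n → ℂ) (a b : Fin n → ℤ) : pairC v (a + b) = pairC v a + pairC v b := by
  simp [pairC, mul_add, Finset.sum_add_distrib]

theorem pairC_sub (v : Fin n → ℂ) (a b : Fin n → ℤ) : pairC v (a - b) = pairC v a - pairC v b := by
  simp [pairC, mul_sub, Finset.sum_sub_distrib]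

theorem pairR_e (v : Fin n → ℝ) (i : Fin n) : pairR v (e i) = v i := by
  simp [pairR, e_apply]

theorem pairR_add (v : Fin n → ℝ) (a b : Fin n → ℤ) : pairR v (a + b) = pairR v a + pairR v b := by
  simp [pairR, mul_add, Finset.sum_add_distrib]

theorem pairR_sub (v : Fin n → ℝ) (a b : Fin n → ℤ) : pairR v (a - b) = pairR v a - pairR v b := by
  simp [pairR, mul_sub, Finset.sum_sub_distrib]

theorem normSq_e (i : Fin n) : normSq (e i) = 1 := by
  simp [normSq, e_apply]

theorem normSq_e_add_self (i : Fin n) : normSq (e i + e i) = 4 := by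
  have : ∀ j, (e i + e i) j * (e i + e i) j = if j = i then 4 else 0 := by
    intro j
    simp only [Pi.add_apply, e_apply]
    split_ifs <;> norm_num
  simp only [normSq, this]
  simp

theorem normSq_e_add {i j : Fin n} (h : i ≠ j) : normSq (e i + e j) = 2 := by
  have : ∀ l, (e i + e j) l * (e i + e j) l =
      (if l = i then 1 else 0) + (if l = j then 1 else 0) := by
    intro l
    simp only [Pi.add_apply, e_apply]
    split_ifs <;> simp_all
  simp only [normSq, this]
  simp [Finset.sum_add_distrib]

theorem normSq_e_sub {i j : Fin n} (h : i ≠ j) : normSq (e i - e j) = 2 := by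
  have : ∀ l, (e i - e j) l * (e i - e j) l =
      (if l = i then 1 else 0) + (if l = j then 1 else 0) := by
    intro l
    simp only [Pi.sub_apply, e_apply]
    split_ifs <;> simp_all
  simp only [normSq, this]
  simp [Finset.sum_add_distrib]

/-- The pairs `(i, j)` with `i < j`. -/
def ltPairs (n : ℕ) : Finset (Fin n × Fin n) := Finset.univ.filter (fun q => q.1 < q.2)

theorem mem_ltPairs {q : Fin n × Fin n} : q ∈ ltPairs n ↔ q.1 < q.2 := by simp [ltPairs]

@[to_additive]
theorem prod_ltPairs {M : Type*} [CommMonoid M] (f : Fin n → Fin n → M) :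
    ∏ q ∈ ltPairs n, f q.1 q.2 = ∏ i, ∏ j ∈ Finset.Ioi i, f i j := by
  rw [ltPairs, Finset.prod_filter, Fintype.prod_prod_type]
  refine Finset.prod_congr rfl fun i _ => ?_
  rw [← Finset.prod_filter]
  congr 1
  ext j
  simp

/-- The positive middle roots. -/
def middleRoots (n : ℕ) : Finset (Fin n → ℤ) := (posRoots n).filter (fun a => normSq a = 2)

theorem e_injective : Function.Injective (e : Fin n → Fin n → ℤ) := by
  intro i j h
  by_contra hij
  have := congrFun h i
  simp [e_apply, hij] at this

theorem e_add_self_injective : Function.Injective (fun i : Fin n => e i + e i) := by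
  intro i j h
  by_contra hij
  have := congrFun h i
  simp [e_apply, hij] at this

theorem e_sub_injOn : Set.InjOn (fun q : Fin n × Fin n => e q.1 - e q.2) (ltPairs n) := by
  rintro ⟨i, j⟩ h ⟨i', j'⟩ h' heq
  rw [Finset.mem_coe, mem_ltPairs] at h h'
  have h1 := congrFun heq i
  have h2 := congrFun heq j
  simp only [Pi.sub_apply, e_apply, h.ne, h.ne', if_true, if_false] at h1 h2
  have a1 : i = i' := by
    by_contra hn
    simp only [hn, if_false] at h1
    split_ifs at h1 <;> omega
  have a2 : j = j' := by
    by_contra hn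
    simp only [hn, if_false] at h2
    split_ifs at h2 <;> omega
  rw [a1, a2]

theorem e_add_injOn : Set.InjOn (fun q : Fin n × Fin n => e q.1 + e q.2) (ltPairs n) := by
  rintro ⟨i, j⟩ h ⟨i', j'⟩ h' heq
  rw [Finset.mem_coe, mem_ltPairs] at h h'
  have h1 := congrFun heq i
  have h2 := congrFun heq j
  simp only [Pi.add_apply, e_apply, h.ne, h.ne', if_true, if_false] at h h' h1 h2
  have a1 : i = i' ∨ i = j' := by
    by_contra! hn
    simp [hn.1, hn.2] at h1
  have a2 : j = i' ∨ j = j' := by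
    by_contra! hn
    simp [hn.1, hn.2] at h2
  have := h.ne
  rcases a1 with rfl | rfl <;> rcases a2 with rfl | rfl
  · exact absurd rfl this
  · rfl
  · exact absurd (h.trans h') (lt_irrefl _)
  · exact absurd rfl this

theorem disjoint_e_sub_e_add :
    Disjoint ((ltPairs n).image fun q => e q.1 - e q.2) ((ltPairs n).image fun q => e q.1 + e q.2) := by
  rw [Finset.disjoint_left]
  intro a ha hb
  obtain ⟨q, hq, rfl⟩ := Finset.mem_image.1 ha
  obtain ⟨r, -, hr⟩ := Finset.mem_image.1 hb
  rw [mem_ltPairs] at hq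
  have h2 := congrFun hr q.2
  simp only [Pi.sub_apply, Pi.add_apply, e_apply, hq.ne', if_true, if_false] at h2
  split_ifs at h2 <;> omega

theorem posRoots_eq : posRoots n =
    (Finset.univ.image (fun p : Fin n => e p) ∪ Finset.univ.image (fun p : Fin n => e p + e p)) ∪
      ((ltPairs n).image (fun q => e q.1 - e q.2) ∪ (ltPairs n).image (fun q => e q.1 + e q.2)) := by
  rw [posRoots, ltPairs, ← Finset.union_assoc]

theorem normSq_of_mem_left {a : Fin n → ℤ}
    (ha : a ∈ Finset.univ.image (fun p : Fin n => e p) ∪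
      Finset.univ.image (fun p : Fin n => e p + e p)) : normSq a = 1 ∨ normSq a = 4 := by
  rcases Finset.mem_union.1 ha with h | h
  · obtain ⟨p, -, rfl⟩ := Finset.mem_image.1 h
    exact Or.inl (normSq_e p)
  · obtain ⟨p, -, rfl⟩ := Finset.mem_image.1 h
    exact Or.inr (normSq_e_add_self p)

theorem normSq_of_mem_right {a : Fin n → ℤ}
    (ha : a ∈ (ltPairs n).image (fun q => e q.1 - e q.2) ∪
      (ltPairs n).image (fun q => e q.1 + e q.2)) : normSq a = 2 := by
  rcases Finset.mem_union.1 ha with h | h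
  · obtain ⟨q, hq, rfl⟩ := Finset.mem_image.1 h
    exact normSq_e_sub (mem_ltPairs.1 hq).ne
  · obtain ⟨q, hq, rfl⟩ := Finset.mem_image.1 h
    exact normSq_e_add (mem_ltPairs.1 hq).ne

theorem middleRoots_eq : middleRoots n =
    (ltPairs n).image (fun q => e q.1 - e q.2) ∪ (ltPairs n).image (fun q => e q.1 + e q.2) := by
  ext a
  rw [middleRoots, posRoots_eq, Finset.mem_filter, Finset.mem_union]
  constructor
  · rintro ⟨h | h, h2⟩
    · rcases normSq_of_mem_left h with h3 | h3 <;> omega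
    · exact h
  · exact fun h => ⟨Or.inr h, normSq_of_mem_right h⟩

@[to_additive]
theorem prod_middleRoots {M : Type*} [CommMonoid M] (f : (Fin n → ℤ) → M) :
    ∏ a ∈ middleRoots n, f a = ∏ q ∈ ltPairs n, (f (e q.1 - e q.2) * f (e q.1 + e q.2)) := by
  rw [middleRoots_eq, Finset.prod_union disjoint_e_sub_e_add, Finset.prod_image e_sub_injOn,
    Finset.prod_image e_add_injOn, Finset.prod_mul_distrib]

@[to_additive]
theorem prod_posRoots {M : Type*} [CommMonoid M] (f : (Fin n → ℤ) → M) :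
    ∏ a ∈ posRoots n, f a = (∏ p, (f (e p) * f (e p + e p))) * ∏ a ∈ middleRoots n, f a := by
  rw [posRoots_eq, middleRoots_eq, Finset.prod_union, Finset.prod_union,
    Finset.prod_image e_injective.injOn, Finset.prod_image e_add_self_injective.injOn,
    Finset.prod_mul_distrib]
  · rw [Finset.disjoint_left]
    intro a ha hb
    obtain ⟨p, -, rfl⟩ := Finset.mem_image.1 ha
    obtain ⟨r, -, hr⟩ := Finset.mem_image.1 hb
    have := normSq_e_add_self r
    rw [hr, normSq_e] at this
    omega
  · rw [Finset.disjoint_left]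
    intro a ha hb
    have h1 := normSq_of_mem_right hb
    rcases normSq_of_mem_left ha with h3 | h3 <;> omega

theorem forall_mem_middleRoots {P : (Fin n → ℤ) → Prop} :
    (∀ a ∈ middleRoots n, P a) ↔ ∀ i j : Fin n, i < j → P (e i - e j) ∧ P (e i + e j) := by
  simp only [middleRoots_eq, Finset.mem_union, Finset.mem_image, mem_ltPairs, Prod.exists]
  constructor
  · exact fun h i j hij => ⟨h _ (Or.inl ⟨i, j, hij, rfl⟩), h _ (Or.inr ⟨i, j, hij, rfl⟩)⟩
  · rintro h a (⟨i, j, hij, rfl⟩ | ⟨i, j, hij, rfl⟩)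
    · exact (h i j hij).1
    · exact (h i j hij).2

theorem forall_mem_posRoots {P : (Fin n → ℤ) → Prop} :
    (∀ a ∈ posRoots n, P a) ↔ (∀ p, P (e p) ∧ P (e p + e p)) ∧ ∀ a ∈ middleRoots n, P a := by
  rw [posRoots_eq, middleRoots_eq]
  simp only [Finset.mem_union, Finset.mem_image, Finset.mem_univ, true_and]
  constructor
  · exact fun h => ⟨fun p => ⟨h _ (Or.inl (Or.inl ⟨p, rfl⟩)), h _ (Or.inl (Or.inr ⟨p, rfl⟩))⟩,
      fun a ha => h a (Or.inr ha)⟩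
  · rintro ⟨h1, h2⟩ a ((⟨p, rfl⟩ | ⟨p, rfl⟩) | h)
    · exact (h1 p).1
    · exact (h1 p).2
    · exact h2 a h

theorem normSq_of_mem_middleRoots {a : Fin n → ℤ} (ha : a ∈ middleRoots n) : normSq a = 2 :=
  (Finset.mem_filter.1 ha).2

theorem mem_posRoots_of_mem_middleRoots {a : Fin n → ℤ} (ha : a ∈ middleRoots n) :
    a ∈ posRoots n := (Finset.mem_filter.1 ha).1

theorem mult_e (k : Multiplicity) (p : Fin n) : mult k (e p) = k.1 := by simp [mult, normSq_e]

theorem mult_e_add_self (k : Multiplicity) (p : Fin n) : mult k (e p + e p) = k.2.2 := by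
  simp [mult, normSq_e_add_self]

theorem mult_middle (k : Multiplicity) {a : Fin n → ℤ} (ha : a ∈ middleRoots n) :
    mult k a = k.2.1 := by
  simp [mult, normSq_of_mem_middleRoots ha]

theorem cArg_e (v : Fin n → ℂ) (k : Multiplicity) (p : Fin n) : cArg v k (e p) = 2 * v p := by
  simp [cArg, multHalf, normSq_e, pairC_e]

theorem cArg_e_add_self (v : Fin n → ℂ) (k : Multiplicity) (p : Fin n) :
    cArg v k (e p + e p) = v p + k.1 / 2 := by
  simp only [cArg, multHalf, normSq_e_add_self, pairC_add, pairC_e, if_true]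
  push_cast
  ring

theorem cArg_middle (v : Fin n → ℂ) (k : Multiplicity) {a : Fin n → ℤ} (ha : a ∈ middleRoots n) :
    cArg v k a = pairC v a := by
  simp [cArg, multHalf, normSq_of_mem_middleRoots ha]

theorem rho_apply (k : Multiplicity) (i : Fin n) :
    rho n k i = rho₁ k.1 k.2.2 + k.2.1 * ((n - 1 - i : ℕ) : ℂ) := by
  have h1 : ∑ a ∈ middleRoots n, mult k a * (a i : ℂ) =
      2 * k.2.1 * ((n - 1 - i : ℕ) : ℂ) := by
    rw [Finset.sum_congr rfl fun a ha => by rw [mult_middle k ha], sum_middleRoots,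
      sum_ltPairs (fun p q : Fin n => k.2.1 * ((e p - e q) i : ℂ) + k.2.1 * ((e p + e q) i : ℂ))]
    have : ∀ p q : Fin n, k.2.1 * ((e p - e q) i : ℂ) + k.2.1 * ((e p + e q) i : ℂ) =
        if p = i then 2 * k.2.1 else 0 := by
      intro p q
      simp only [Pi.sub_apply, Pi.add_apply, e_apply, eq_comm (a := i)]
      push_cast
      split_ifs <;> ring
    simp only [this, Finset.sum_const, Fin.card_Ioi, smul_ite, smul_zero, nsmul_eq_mul,
      Finset.sum_ite_eq', Finset.mem_univ, if_true]
    ring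
  have h2 : ∑ p, (mult k (e p) * (e p i : ℂ) + mult k (e p + e p) * ((e p + e p) i : ℂ)) =
      k.1 + 2 * k.2.2 := by
    have : ∀ p, mult k (e p) * (e p i : ℂ) + mult k (e p + e p) * ((e p + e p) i : ℂ) =
        if p = i then k.1 + 2 * k.2.2 else 0 := by
      intro p
      rw [mult_e, mult_e_add_self]
      simp only [Pi.add_apply, e_apply, eq_comm (a := i)]
      push_cast
      split_ifs <;> ring
    simp only [this]
    simp
  rw [rho, sum_posRoots, h1, h2, rho₁]
  ring

theorem noPole_iff (v : Fin n → ℂ) (k : Multiplicity) : NoPole v k ↔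
    (∀ p, ∀ m : ℕ, 2 * v p ≠ -(m : ℂ)) ∧ (∀ p, ∀ m : ℕ, v p + k.1 / 2 ≠ -(m : ℂ)) ∧
      ∀ i j : Fin n, i < j → (∀ m : ℕ, v i - v j ≠ -(m : ℂ)) ∧ ∀ m : ℕ, v i + v j ≠ -(m : ℂ) := by
  rw [NoPole, forall_mem_posRoots]
  have : (∀ a ∈ middleRoots n, ∀ m : ℕ, cArg v k a ≠ -(m : ℂ)) ↔
      ∀ a ∈ middleRoots n, ∀ m : ℕ, pairC v a ≠ -(m : ℂ) :=
    forall₂_congr fun a ha => by rw [cArg_middle v k ha]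
  rw [this, forall_mem_middleRoots]
  simp only [cArg_e, cArg_e_add_self, pairC_sub, pairC_add, pairC_e, forall_and, and_assoc]

theorem cTilde_eq (v : Fin n → ℂ) (k : Multiplicity) : cTilde v k =
    (∏ p, cTilde₁ k.1 k.2.2 (v p)) *
      ∏ a ∈ middleRoots n, Complex.Gamma (pairC v a) / Complex.Gamma (pairC v a + k.2.1) := by
  rw [cTilde, prod_posRoots]
  congr 1
  · refine Finset.prod_congr rfl fun p _ => ?_
    rw [cArg_e, cArg_e_add_self, mult_e, mult_e_add_self, cTilde₁]
  · refine Finset.prod_congr rfl fun a ha => ?_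
    rw [cArg_middle v k ha, mult_middle k ha]

theorem mem_posChamber_iff {y : Fin n → ℝ} : y ∈ posChamber n ↔
    (∀ i, 0 < y i) ∧ ∀ i j, i < j → y j < y i := by
  change (∀ a ∈ posRoots n, 0 < pairR y a) ↔ _
  rw [forall_mem_posRoots, forall_mem_middleRoots]
  simp only [pairR_add, pairR_sub, pairR_e, sub_pos]
  constructor
  · exact fun h => ⟨fun i => (h.1 i).1, fun i j hij => (h.2 i j hij).1⟩
  · exact fun h => ⟨fun i => ⟨h.1 i, add_pos (h.1 i) (h.1 i)⟩,
      fun i j hij => ⟨h.2 i j hij, add_pos (h.1 i) (h.1 j)⟩⟩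

end Roots

/-! ### Generic points -/

section Generic

variable {n : ℕ}

theorem dense_forall_continuousLinearMap_ne {𝕜 E ι : Type*} [RCLike 𝕜] [NormedAddCommGroup E]
    [NormedSpace 𝕜 E] [CompleteSpace E] [Countable ι] (L : ι → E →L[𝕜] 𝕜) (hL : ∀ i, L i ≠ 0)
    (c : ι → 𝕜) : Dense {x | ∀ i, L i x ≠ c i} := by
  rw [Set.ofPred_forall]
  refine dense_iInter_of_isOpen (fun i => ?_) fun i => ?_
  · exact isOpen_ne_fun (L i).continuous continuous_const
  · exact (dense_compl_singleton (c i)).preimage ((L i).isOpenMap_of_ne_zero (hL i))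

/-- The pairing with an integral vector as a continuous linear form on `ℂⁿ`. -/
noncomputable def pairCL (a : Fin n → ℤ) : (Fin n → ℂ) →L[ℂ] ℂ :=
  ∑ i, (a i : ℂ) • ContinuousLinearMap.proj i

theorem pairCL_apply (a : Fin n → ℤ) (v : Fin n → ℂ) : pairCL a v = pairC v a := by
  simp [pairCL, pairC, mul_comm]

theorem pairC_single (a : Fin n → ℤ) (i : Fin n) : pairC (Pi.single i 1) a = a i := by
  simp [pairC, Pi.single_apply]

theorem pairCL_ne_zero {a : Fin n → ℤ} (ha : a ≠ 0) : pairCL a ≠ 0 := by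
  obtain ⟨i, hi⟩ := Function.ne_iff.1 ha
  intro h
  have := pairCL_apply a (Pi.single i 1)
  rw [h, pairC_single] at this
  rw [zero_apply] at this
  exact hi (by exact_mod_cast this.symm)

/-- The pairing with an integral vector as a continuous linear form on `ℝⁿ`. -/
noncomputable def pairRL (a : Fin n → ℤ) : (Fin n → ℝ) →L[ℝ] ℝ :=
  ∑ i, (a i : ℝ) • ContinuousLinearMap.proj i

theorem pairRL_apply (a : Fin n → ℤ) (v : Fin n → ℝ) : pairRL a v = pairR v a := by
  simp [pairRL, pairR, mul_comm]

theorem pairRL_ne_zero {a : Fin n → ℤ} (ha : a ≠ 0) : pairRL a ≠ 0 := by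
  obtain ⟨i, hi⟩ := Function.ne_iff.1 ha
  intro h
  have := pairRL_apply a (Pi.single i 1)
  rw [h] at this
  rw [zero_apply] at this
  simp only [pairR, Pi.single_apply, ite_mul, one_mul, zero_mul, Finset.sum_ite_eq',
    Finset.mem_univ, if_true] at this
  exact hi (by exact_mod_cast this.symm)

theorem isOpen_posChamber : IsOpen (posChamber n) := by
  have : posChamber n = ⋂ a ∈ posRoots n, {y | 0 < pairRL a y} := by
    ext y
    simp [posChamber, pairRL_apply]
  rw [this]
  exact isOpen_biInter_finset fun a _ => isOpen_lt continuous_const (pairRL a).continuous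

theorem posChamber_nonempty : (posChamber n).Nonempty := by
  refine ⟨fun i => (n : ℝ) - i, mem_posChamber_iff.2 ⟨fun i => ?_, fun i j hij => ?_⟩⟩
  · have : (i : ℝ) < n := by exact_mod_cast i.2
    linarith
  · have : (i : ℝ) < j := by exact_mod_cast hij
    linarith

theorem exists_mem_posChamber_pairR_ne_zero :
    ∃ y ∈ posChamber n, ∀ a : Fin n → ℤ, a ≠ 0 → pairR y a ≠ 0 := by
  obtain ⟨y, hy, hd⟩ := (dense_forall_continuousLinearMap_ne
    (fun a : {a : Fin n → ℤ // a ≠ 0} => pairRL a.1) (fun a => pairRL_ne_zero a.2)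
    (fun _ => 0)).inter_open_nonempty _ isOpen_posChamber posChamber_nonempty
  exact ⟨y, hy, fun a ha => by simpa only [pairRL_apply] using hd ⟨a, ha⟩⟩

/-- The transpose of the action of a signed permutation, on integral vectors. -/
def weylTranspose (w : Weyl n) (a : Fin n → ℤ) : Fin n → ℤ :=
  fun j => (w.2 (w.1.symm j) : ℤ) * a (w.1.symm j)

theorem pairC_weylAct (w : Weyl n) (v : Fin n → ℂ) (a : Fin n → ℤ) :
    pairC (weylAct w v) a = pairC v (weylTranspose w a) := by
  simp only [pairC, weylAct, weylTranspose]
  rw [← Equiv.sum_comp w.1 (fun i => v i * _)]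
  refine Finset.sum_congr rfl fun i _ => ?_
  rw [Equiv.symm_apply_apply]
  push_cast
  ring

theorem weylTranspose_ne_zero (w : Weyl n) {a : Fin n → ℤ} (ha : a ≠ 0) : weylTranspose w a ≠ 0 := by
  obtain ⟨i, hi⟩ := Function.ne_iff.1 ha
  refine Function.ne_iff.2 ⟨w.1 i, ?_⟩
  simp only [weylTranspose, Equiv.symm_apply_apply, Pi.zero_apply] at hi ⊢
  exact mul_ne_zero (w.2 i).ne_zero hi

theorem normSq_ne_zero_of_mem_posRoots {a : Fin n → ℤ} (ha : a ∈ posRoots n) : normSq a ≠ 0 := by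
  revert a
  rw [forall_mem_posRoots]
  exact ⟨fun p => ⟨by rw [normSq_e]; decide, by rw [normSq_e_add_self]; decide⟩,
    fun a ha => by rw [normSq_of_mem_middleRoots ha]; decide⟩

theorem ne_zero_of_mem_posRoots {a : Fin n → ℤ} (ha : a ∈ posRoots n) : a ≠ 0 := by
  rintro rfl
  exact normSq_ne_zero_of_mem_posRoots ha (by simp [normSq])

theorem dense_generic (k : Multiplicity) :
    Dense {v : Fin n → ℂ | ∀ w : Weyl n, IsGeneric (weylAct w v) ∧ NoPole (weylAct w v) k} := by
  let ι := {q : Weyl n × (Fin n → ℤ) × Option ℕ // q.2.1 ≠ 0}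
  let c : ι → ℂ := fun q => match q.1.2.2 with
    | none => (normSq q.1.2.1 : ℂ) / 2
    | some m => (normSq q.1.2.1 : ℂ) / 2 * (-(m : ℂ) - 1 / 2 * multHalf k q.1.2.1)
  refine (dense_forall_continuousLinearMap_ne (fun q : ι => pairCL (weylTranspose q.1.1 q.1.2.1))
    (fun q => pairCL_ne_zero (weylTranspose_ne_zero _ q.2)) c).mono fun v hv w => ?_
  simp only [Set.mem_ofPred_eq, pairCL_apply, ← pairC_weylAct] at hv
  constructor
  · intro mu _ hmu h0
    refine hv ⟨(w, mu, none), hmu⟩ ?_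
    simp only [c]
    linear_combination -1 / 2 * h0
  · intro a ha m h0
    refine hv ⟨(w, a, some m), ne_zero_of_mem_posRoots ha⟩ ?_
    have hq : (normSq a : ℂ) ≠ 0 := by exact_mod_cast normSq_ne_zero_of_mem_posRoots ha
    simp only [c]
    rw [cArg] at h0
    rw [← h0]
    field_simp
    ring

theorem dense_noPole_rho : Dense {k : Multiplicity | NoPole (rho n k) k} := by
  let ι := {q : (ℤ × ℤ × ℤ) × ℕ // q.1 ≠ 0}
  let L : ι → Multiplicity →L[ℂ] ℂ := fun q =>
    (q.1.1.1 : ℂ) • ContinuousLinearMap.fst ℂ ℂ (ℂ × ℂ) +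
      ((q.1.1.2.1 : ℂ) • ContinuousLinearMap.fst ℂ ℂ ℂ +
        (q.1.1.2.2 : ℂ) • ContinuousLinearMap.snd ℂ ℂ ℂ).comp (ContinuousLinearMap.snd ℂ ℂ (ℂ × ℂ))
  have hL : ∀ q k, L q k = q.1.1.1 * k.1 + (q.1.1.2.1 * k.2.1 + q.1.1.2.2 * k.2.2) := by
    intro q k
    simp [L]
  refine (dense_forall_continuousLinearMap_ne L (fun q h => q.2 ?_)
    (fun q => -(q.1.2 : ℂ))).mono fun k hk => ?_
  · have h1 := hL q (1, 0, 0)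
    have h2 := hL q (0, 1, 0)
    have h3 := hL q (0, 0, 1)
    rw [h] at h1 h2 h3
    simp only [zero_apply, mul_one, mul_zero, add_zero, zero_add] at h1 h2 h3
    ext
    · exact_mod_cast h1.symm
    · exact_mod_cast h2.symm
    · exact_mod_cast h3.symm
  · simp only [Set.mem_ofPred_eq, hL] at hk
    rw [Set.mem_ofPred_eq, noPole_iff]
    simp only [rho_apply, rho₁]
    refine ⟨fun p m h0 => ?_, fun p m h0 => ?_, fun i j hij => ⟨fun m h0 => ?_, fun m h0 => ?_⟩⟩
    · refine hk ⟨((1, 2 * (n - 1 - p : ℕ), 2), m), by simp⟩ ?_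
      push_cast
      linear_combination h0
    · refine hk ⟨((1, (n - 1 - p : ℕ), 1), m), by simp⟩ ?_
      push_cast
      linear_combination h0
    · refine hk ⟨((0, (n - 1 - i : ℕ) - (n - 1 - j : ℕ), 0), m), ?_⟩ ?_
      · have : (i : ℕ) < j := hij
        have := j.2
        simp only [ne_eq, Prod.mk_eq_zero, not_and, not_true, imp_false]
        omega
      · push_cast
        linear_combination h0
    · refine hk ⟨((1, (n - 1 - i : ℕ) + (n - 1 - j : ℕ), 2), m), by simp⟩ ?_
      push_cast
      linear_combination h0

instance neBot_nhdsWithin_noPole_rho (k : Multiplicity) :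
    (𝓝[{k' : Multiplicity | NoPole (rho n k') k'}] k).NeBot :=
  mem_closure_iff_nhdsWithin_neBot.1 (dense_noPole_rho k)

theorem HasCRhoValue.unique {k : Multiplicity} {v w : ℂ} (hv : HasCRhoValue n k v)
    (hw : HasCRhoValue n k w) : v = w :=
  tendsto_nhds_unique hv hw

theorem mem_regularSet_of_generic {k : Multiplicity} {v : Fin n → ℂ}
    (h : ∀ w : Weyl n, IsGeneric (weylAct w v) ∧ NoPole (weylAct w v) k) (p : Fin n) :
    v p ∈ regularSet := by
  have key : ∀ ε : ℤˣ, ∀ m : ℕ, m ≠ 0 → 2 * (((ε : ℤ) : ℂ) * v p) ≠ m := by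
    intro ε m hm h0
    have h1 := (h (1, fun _ => ε)).1 (m • e p) (AddSubmonoid.nsmul_mem _
      (AddSubmonoid.subset_closure ((((forall_mem_posRoots (P := (· ∈ posRoots n))).1
        (fun _ h => h)).1 p).1)) m) (by
          intro h2
          have := congrFun h2 p
          simp [e_apply, hm] at this)
    refine h1 ?_
    have e1 : normSq (m • e p) = (m : ℤ) * m := by
      simp [normSq, e_apply]
    have e2 : pairC (weylAct (1, fun _ => ε) v) (m • e p) = m * (((ε : ℤ) : ℂ) * v p) := by
      simp [pairC, e_apply, weylAct, mul_comm]
    rw [e1, e2]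
    push_cast
    linear_combination -(m : ℂ) * h0
  change 2 * v p ∈ Complex.integerComplement
  rintro ⟨m, hm⟩
  rcases lt_trichotomy m 0 with h0 | rfl | h0
  · refine key (-1) m.natAbs (by omega) ?_
    have : ((m.natAbs : ℤ) : ℂ) = ((-m : ℤ) : ℂ) := by rw [Int.ofNat_natAbs_of_nonpos h0.le]
    rw [← Int.cast_natCast, this]
    push_cast
    linear_combination hm
  · have h1 := ((noPole_iff _ _).1 (h 1).2).1 p 0
    refine h1 ?_
    simp only [weylAct, Prod.fst_one, Prod.snd_one, Pi.one_apply]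
    push_cast at hm ⊢
    simp only [id]
    linear_combination -hm
  · refine key 1 m.natAbs (by omega) ?_
    have : ((m.natAbs : ℤ) : ℂ) = (m : ℂ) := by rw [Int.natAbs_of_nonneg h0.le]
    rw [← Int.cast_natCast, this]
    push_cast
    linear_combination -hm

end Generic

/-! ### The value of `c̃(ρ(k), k)` -/

section CRho

variable {n : ℕ}

theorem prod_Ioi_sub {M : Type*} [CommMonoid M] (i : Fin n) (g : ℕ → M) :
    ∏ j ∈ Finset.Ioi i, g (n - 1 - j) = ∏ m ∈ Finset.range (n - 1 - i), g m := by
  refine Finset.prod_bij' (fun j _ => n - 1 - (j : ℕ))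
    (fun m hm => (⟨n - 1 - m, by have := i.2; omega⟩ : Fin n)) ?_ ?_ ?_ ?_ ?_
  · intro j hj
    have h1 : (i : ℕ) < j := Fin.lt_def.1 (Finset.mem_Ioi.1 hj)
    have := j.2
    simp only [Finset.mem_range]
    omega
  · intro m hm
    rw [Finset.mem_range] at hm
    rw [Finset.mem_Ioi, Fin.lt_def]
    change (i : ℕ) < n - 1 - m
    omega
  · intro j hj
    have := j.2
    ext
    change n - 1 - (n - 1 - (j : ℕ)) = j
    omega
  · intro m hm
    rw [Finset.mem_range] at hm
    change n - 1 - (n - 1 - m) = m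
    omega
  · exact fun _ _ => rfl

theorem prod_univ_sub {M : Type*} [CommMonoid M] (g : ℕ → M) :
    ∏ i : Fin n, g (n - 1 - i) = ∏ m ∈ Finset.range n, g m := by
  rw [← Finset.prod_range (fun i => g (n - 1 - i)), Finset.prod_range_reflect]

/-- The factors of `c̃(ρ(k), k)` after cancellation of poles. -/
noncomputable def cRhoFactor (k : Multiplicity) (M : ℕ) : ℂ :=
  Real.sqrt Real.pi * 2 ^ (1 - 2 * (k.1 + k.2.2 + k.2.1 * M)) *
    (Complex.Gamma (k.1 + k.2.2 + k.2.1 * M + 1 / 2))⁻¹ *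
    ((M + 1) * Complex.Gamma (k.2.1 + 1) * (Complex.Gamma (k.2.1 * (M + 1) + 1))⁻¹)

theorem prod_range_div_ne_zero {f : ℕ → ℂ} {N : ℕ} (h : ∀ m < N, 0 < m → f m ≠ 0) (hN : 0 < N) :
    ∏ m ∈ Finset.range N, f m / f (m + 1) = f 0 / f N := by
  induction N with
  | zero => omega
  | succ N ih =>
    rw [Finset.prod_range_succ]
    rcases Nat.eq_zero_or_pos N with rfl | h0
    · simp
    · rw [ih (fun m hm => h m (by omega)) h0, div_mul_div_cancel₀ (h N (by omega) h0)]

theorem cTilde_rho_eq (hn : 2 ≤ n) {k : Multiplicity} (hk : NoPole (rho n k) k) :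
    cTilde (rho n k) k = ∏ M ∈ Finset.range n, cRhoFactor k M := by
  have hk' := (noPole_iff _ _).1 hk
  simp only [rho_apply, rho₁] at hk'
  obtain ⟨h1, h2, h3⟩ := hk'
  have hmid : ∏ a ∈ middleRoots n, Complex.Gamma (pairC (rho n k) a) /
      Complex.Gamma (pairC (rho n k) a + k.2.1) =
      ∏ i : Fin n, ∏ j ∈ Finset.Ioi i, (fun M m : ℕ =>
        Complex.Gamma (k.2.1 * (M - m)) / Complex.Gamma (k.2.1 * (M - m) + k.2.1) *
        (Complex.Gamma (k.1 + 2 * k.2.2 + k.2.1 * (M + m)) /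
          Complex.Gamma (k.1 + 2 * k.2.2 + k.2.1 * (M + m) + k.2.1))) (n - 1 - i) (n - 1 - j) := by
    rw [prod_middleRoots, ← prod_ltPairs (fun i j : Fin n => (fun M m : ℕ =>
        Complex.Gamma (k.2.1 * (M - m)) / Complex.Gamma (k.2.1 * (M - m) + k.2.1) *
        (Complex.Gamma (k.1 + 2 * k.2.2 + k.2.1 * (M + m)) /
          Complex.Gamma (k.1 + 2 * k.2.2 + k.2.1 * (M + m) + k.2.1))) (n - 1 - i) (n - 1 - j))]
    refine Finset.prod_congr rfl fun q _ => ?_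
    rw [pairC_sub, pairC_add, pairC_e, pairC_e, rho_apply, rho_apply, rho₁]
    congr 1
    · congr 3 <;> ring
    · congr 2 <;> ring_nf
  rw [cTilde_eq, hmid, ← Finset.prod_mul_distrib, ← prod_univ_sub]
  refine Finset.prod_congr rfl fun p _ => ?_
  rw [prod_Ioi_sub p (fun m => (fun M m : ℕ =>
        Complex.Gamma (k.2.1 * (M - m)) / Complex.Gamma (k.2.1 * (M - m) + k.2.1) *
        (Complex.Gamma (k.1 + 2 * k.2.2 + k.2.1 * (M + m)) /
          Complex.Gamma (k.1 + 2 * k.2.2 + k.2.1 * (M + m) + k.2.1))) (n - 1 - p) m)]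
  have hz : ∀ m : ℕ, k.1 + k.2.2 + k.2.1 * ((n - 1 - p : ℕ) : ℂ) ≠ -(m : ℂ) := by
    intro m hm
    exact h2 p m (by linear_combination hm)
  have g1 : ∀ m : ℕ, k.1 + 2 * k.2.2 + k.2.1 * (((n - 1 - p : ℕ) : ℂ) + (n - 1 - p : ℕ)) ≠
      -(m : ℂ) := fun m hm => h1 p m (by linear_combination hm)
  have g2 : ∀ M < n - 1 - p, ∀ m : ℕ,
      k.1 + 2 * k.2.2 + k.2.1 * (((n - 1 - p : ℕ) : ℂ) + (M : ℕ)) ≠ -(m : ℂ) := by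
    intro M hM m hm
    refine (h3 p ⟨n - 1 - M, by omega⟩ (by rw [Fin.lt_def]; change (p : ℕ) < n - 1 - M; omega)).2 m ?_
    rw [show n - 1 - (n - 1 - M) = M by omega]
    linear_combination hm
  have g3 : ∀ M < n - 1 - p, ∀ m : ℕ,
      k.2.1 * (((n - 1 - p : ℕ) : ℂ) - (M : ℕ)) ≠ -(m : ℂ) := by
    intro M hM m hm
    refine (h3 p ⟨n - 1 - M, by omega⟩ (by rw [Fin.lt_def]; change (p : ℕ) < n - 1 - M; omega)).1 m ?_
    rw [show n - 1 - (n - 1 - M) = M by omega]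
    linear_combination hm
  have g4 : ∀ m : ℕ, k.2.1 ≠ -(m : ℂ) := by
    intro m hm
    refine (h3 ⟨n - 2, by omega⟩ ⟨n - 1, by omega⟩ (by rw [Fin.lt_def]; change n - 2 < n - 1; omega)).1
      m ?_
    change rho₁ k.1 k.2.2 + k.2.1 * ((n - 1 - (n - 2) : ℕ) : ℂ) -
      (rho₁ k.1 k.2.2 + k.2.1 * ((n - 1 - (n - 1) : ℕ) : ℂ)) = _
    rw [show n - 1 - (n - 2) = 1 by omega, show n - 1 - (n - 1) = 0 by omega]
    push_cast
    linear_combination hm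
  have g4' : k.2.1 ≠ 0 := by simpa using g4 0
  rw [rho_apply]
  generalize n - 1 - (p : ℕ) = M at *
  have e1 : cTilde₁ k.1 k.2.2 (rho₁ k.1 k.2.2 + k.2.1 * (M : ℂ)) =
      Complex.Gamma (k.1 + 2 * k.2.2 + k.2.1 * ((M : ℂ) + M)) /
        Complex.Gamma (k.1 + 2 * k.2.2 + k.2.1 * M) * (Real.sqrt Real.pi *
          2 ^ (1 - 2 * (k.1 + k.2.2 + k.2.1 * M)) *
            (Complex.Gamma (k.1 + k.2.2 + k.2.1 * M + 1 / 2))⁻¹) := by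
    rw [← Gamma_div_Gamma_two_mul hz, cTilde₁, rho₁,
      show 2 * (k.1 / 2 + k.2.2 + k.2.1 * (M : ℂ)) + k.1 = 2 * (k.1 + k.2.2 + k.2.1 * M) by ring,
      show 2 * (k.1 / 2 + k.2.2 + k.2.1 * (M : ℂ)) =
        k.1 + 2 * k.2.2 + k.2.1 * ((M : ℂ) + M) by ring,
      show k.1 / 2 + k.2.2 + k.2.1 * (M : ℂ) + k.1 / 2 = k.1 + k.2.2 + k.2.1 * M by ring,
      show k.1 + k.2.2 + k.2.1 * (M : ℂ) + k.2.2 = k.1 + 2 * k.2.2 + k.2.1 * M by ring]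
    rw [div_mul_div_comm, div_mul_div_comm, mul_comm (Complex.Gamma (2 * _))]
  have e2 : Complex.Gamma (k.1 + 2 * k.2.2 + k.2.1 * ((M : ℂ) + M)) /
      Complex.Gamma (k.1 + 2 * k.2.2 + k.2.1 * M) *
      ∏ m ∈ Finset.range M, Complex.Gamma (k.1 + 2 * k.2.2 + k.2.1 * ((M : ℂ) + m)) /
        Complex.Gamma (k.1 + 2 * k.2.2 + k.2.1 * (M + m) + k.2.1) = 1 := by
    rcases Nat.eq_zero_or_pos M with rfl | hM
    · have := Complex.Gamma_ne_zero g1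
      simp only [Nat.cast_zero, add_zero, mul_zero, Finset.range_zero, Finset.prod_empty,
        mul_one] at this ⊢
      exact div_self this
    · have := prod_range_div_ne_zero
        (f := fun m : ℕ => Complex.Gamma (k.1 + 2 * k.2.2 + k.2.1 * ((M : ℂ) + m)))
        (fun m hm _ => Complex.Gamma_ne_zero (g2 m hm)) hM
      rw [Finset.prod_congr rfl (g := fun m : ℕ =>
        Complex.Gamma (k.1 + 2 * k.2.2 + k.2.1 * ((M : ℂ) + m)) /
          Complex.Gamma (k.1 + 2 * k.2.2 + k.2.1 * ((M : ℂ) + (m + 1 : ℕ)))) fun m _ => by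
            congr 2
            push_cast
            ring, this]
      have n1 := Complex.Gamma_ne_zero g1
      have n2 := Complex.Gamma_ne_zero (g2 0 hM)
      simp only [Nat.cast_zero, add_zero] at n2 ⊢
      rw [div_mul_div_cancel₀ n2, div_self n1]
  have e3 : ∏ m ∈ Finset.range M, Complex.Gamma (k.2.1 * ((M : ℂ) - m)) /
      Complex.Gamma (k.2.1 * ((M : ℂ) - m) + k.2.1) =
      (M + 1) * Complex.Gamma (k.2.1 + 1) * (Complex.Gamma (k.2.1 * (M + 1) + 1))⁻¹ := by
    rcases Nat.eq_zero_or_pos M with rfl | hM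
    · have : Complex.Gamma (k.2.1 + 1) ≠ 0 := Complex.Gamma_ne_zero fun m hm =>
        g4 (m + 1) (by push_cast; linear_combination hm)
      simp [this]
    · have := prod_range_div_ne_zero
        (f := fun m : ℕ => (Complex.Gamma (k.2.1 * ((M : ℂ) - m + 1)))⁻¹)
        (fun m hm h0 => by
          have := g3 (m - 1) (by omega)
          rw [Nat.cast_pred h0, ← sub_add] at this
          exact inv_ne_zero (Complex.Gamma_ne_zero this)) hM
      rw [Finset.prod_congr rfl (g := fun m : ℕ => (Complex.Gamma (k.2.1 * ((M : ℂ) - m + 1)))⁻¹ /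
          (Complex.Gamma (k.2.1 * ((M : ℂ) - (m + 1 : ℕ) + 1)))⁻¹) fun m _ => by
            rw [inv_div_inv]
            congr 2
            · push_cast
              ring
            · ring, this]
      have hM1 : (M : ℂ) + 1 ≠ 0 := by exact_mod_cast Nat.succ_ne_zero M
      rw [Complex.Gamma_add_one _ g4', Complex.Gamma_add_one _ (mul_ne_zero g4' hM1), inv_div_inv]
      simp only [Nat.cast_zero, sub_zero, sub_self, zero_add, mul_one, mul_inv]
      generalize Complex.Gamma (k.2.1 * ((M : ℂ) + 1)) = G
      field_simp
  rw [Finset.prod_mul_distrib, e1, e3, cRhoFactor]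
  linear_combination (Real.sqrt Real.pi *
          2 ^ (1 - 2 * (k.1 + k.2.2 + k.2.1 * M)) *
            (Complex.Gamma (k.1 + k.2.2 + k.2.1 * M + 1 / 2))⁻¹) *
      ((M + 1) * Complex.Gamma (k.2.1 + 1) * (Complex.Gamma (k.2.1 * (M + 1) + 1))⁻¹) * e2

theorem hasCRhoValue_prod_cRhoFactor (hn : 2 ≤ n) {k : Multiplicity}
    (hk : ∀ m : ℕ, k.2.1 + 1 ≠ -(m : ℂ)) :
    HasCRhoValue n k (∏ M ∈ Finset.range n, cRhoFactor k M) := by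
  have hc : ContinuousAt (fun k : Multiplicity => ∏ M ∈ Finset.range n, cRhoFactor k M) k := by
    refine tendsto_finsetProd _ fun M _ => ?_
    have hG : ∀ {f : Multiplicity → ℂ}, Continuous f →
        ContinuousAt (fun k => (Complex.Gamma (f k))⁻¹) k := fun {f} hf =>
      (Complex.differentiable_one_div_Gamma.continuous.comp hf).continuousAt
    have h1 : ContinuousAt (fun k : Multiplicity => Complex.Gamma (k.2.1 + 1)) k :=
      ContinuousAt.comp (g := Complex.Gamma) (Complex.differentiableAt_Gamma _ hk).continuousAt
        (by fun_prop)
    have h2 : Continuous fun k : Multiplicity =>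
        (2 : ℂ) ^ (1 - 2 * (k.1 + k.2.2 + k.2.1 * (M : ℂ))) :=
      Continuous.const_cpow (by fun_prop) (Or.inl two_ne_zero)
    exact ((continuousAt_const.mul h2.continuousAt).mul (hG (by fun_prop))).mul
      ((continuousAt_const.mul h1).mul (hG (by fun_prop)))
  exact (hc.tendsto.mono_left nhdsWithin_le_nhds).congr'
    (by filter_upwards [self_mem_nhdsWithin] with k' hk' using (cTilde_rho_eq hn hk').symm)

theorem prod_cRhoFactor_zero (n : ℕ) (ks kl : ℂ) :
    ∏ M ∈ Finset.range n, cRhoFactor (ks, 0, kl) M = cRho₁ ks kl ^ n * (n.factorial : ℂ) := by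
  have : ∀ M : ℕ, cRhoFactor (ks, 0, kl) M = cRho₁ ks kl * ((M + 1 : ℕ) : ℂ) := by
    intro M
    simp [cRhoFactor, cRho₁]
  rw [Finset.prod_congr rfl fun M _ => this M, Finset.prod_mul_distrib, Finset.prod_const,
    Finset.card_range, ← Nat.cast_prod, Finset.prod_range_add_one_eq_factorial]

theorem cRhoFactor_one {ks kl : ℂ} (hc : ∀ m : ℕ, ks + kl + 1 / 2 ≠ -(m : ℂ)) (M : ℕ) :
    cRhoFactor (ks, 1, kl) M *
      (2 ^ (2 * M) * (∏ m ∈ Finset.range M, (ks + kl + 1 / 2 + m)) * (M.factorial : ℂ)) =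
      cRho₁ ks kl := by
  have h1 : Complex.Gamma (ks + kl + M + 1 / 2) =
      (∏ m ∈ Finset.range M, (ks + kl + 1 / 2 + m)) * Complex.Gamma (ks + kl + 1 / 2) := by
    induction M with
    | zero => simp
    | succ M ih =>
      rw [Finset.prod_range_succ, show ks + kl + ((M + 1 : ℕ) : ℂ) + 1 / 2 =
        ks + kl + M + 1 / 2 + 1 by push_cast; ring, Complex.Gamma_add_one, ih]
      · ring
      · intro h
        exact hc M (by linear_combination h)
  have h2 : (∏ m ∈ Finset.range M, (ks + kl + 1 / 2 + m)) ≠ 0 :=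
    Finset.prod_ne_zero_iff.2 fun m _ h => hc m (by linear_combination h)
  have h3 : (2 : ℂ) ^ (1 - 2 * (ks + kl + M)) = 2 ^ (1 - 2 * (ks + kl)) * (2 ^ (2 * M))⁻¹ := by
    rw [show 1 - 2 * (ks + kl + (M : ℂ)) = (1 - 2 * (ks + kl)) - ((2 * M : ℕ) : ℂ) by
      push_cast; ring, Complex.cpow_sub _ _ two_ne_zero, Complex.cpow_natCast, div_eq_mul_inv]
  have h4 : Complex.Gamma (1 * ((M : ℂ) + 1) + 1) = (M + 1) * M.factorial := by
    rw [one_mul, show (M : ℂ) + 1 + 1 = ((M + 1 : ℕ) : ℂ) + 1 by push_cast; ring,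
      Complex.Gamma_nat_eq_factorial, Nat.factorial_succ]
    push_cast
    ring
  have h5 : Complex.Gamma (1 + 1) = 1 := by
    have := Complex.Gamma_nat_eq_factorial 1
    simpa using this
  have hM1 : (M : ℂ) + 1 ≠ 0 := by exact_mod_cast Nat.succ_ne_zero M
  have hM2 : (M.factorial : ℂ) ≠ 0 := by exact_mod_cast M.factorial_ne_zero
  rw [cRhoFactor, cRho₁]
  simp only [one_mul] at h4 ⊢
  rw [h1, h3, h4, h5]
  generalize (∏ m ∈ Finset.range M, (ks + kl + 1 / 2 + (m : ℂ))) = P at h2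
  generalize Complex.Gamma (ks + kl + 1 / 2) = G
  rw [mul_inv]
  field_simp

theorem prod_cRhoFactor_one (n : ℕ) {ks kl : ℂ} (hc : ∀ m : ℕ, ks + kl + 1 / 2 ≠ -(m : ℂ)) :
    (∏ M ∈ Finset.range n, cRhoFactor (ks, 1, kl) M) *
      ∏ M ∈ Finset.range n,
        (2 ^ (2 * M) * (∏ m ∈ Finset.range M, (ks + kl + 1 / 2 + m)) * (M.factorial : ℂ)) =
      cRho₁ ks kl ^ n := by
  rw [← Finset.prod_mul_distrib, Finset.prod_congr rfl fun M _ => cRhoFactor_one hc M,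
    Finset.prod_const, Finset.card_range]

theorem prod_two_pow_ascPochhammer_factorial (n : ℕ) (α : ℂ) :
    ∏ M ∈ Finset.range n,
      (2 ^ (2 * M) * (∏ m ∈ Finset.range M, (α + 1 + m)) * (M.factorial : ℂ)) =
    2 ^ (n * (n - 1)) *
      ∏ i ∈ Finset.Icc 1 (n - 1), ((α + (i : ℂ)) ^ (n - i) * (i.factorial : ℂ)) := by
  induction n with
  | zero => simp
  | succ n ih =>
    rw [Finset.prod_range_succ, ih]
    rcases Nat.eq_zero_or_pos n with rfl | hn
    · simp
    obtain ⟨n, rfl⟩ : ∃ m, n = m + 1 := ⟨n - 1, by omega⟩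
    have h1 : ∏ m ∈ Finset.range (n + 1), (α + 1 + (m : ℂ)) = ∏ i ∈ Finset.Icc 1 (n + 1), (α + i) := by
      rw [show Finset.Icc 1 (n + 1) = Finset.Ico 1 (n + 2) by ext; simp; omega,
        Finset.prod_Ico_eq_prod_range]
      refine Finset.prod_congr rfl fun m _ => ?_
      push_cast
      ring
    have h2 : ∏ i ∈ Finset.Icc 1 (n + 1), ((α + (i : ℂ)) ^ (n + 1 + 1 - i) * (i.factorial : ℂ)) =
        (∏ i ∈ Finset.Icc 1 (n + 1), (α + i)) * ((n + 1).factorial : ℂ) *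
        ∏ i ∈ Finset.Icc 1 n, ((α + (i : ℂ)) ^ (n + 1 - i) * (i.factorial : ℂ)) := by
      rw [Finset.prod_Icc_succ_top (by omega), Finset.prod_Icc_succ_top (by omega)]
      have : ∏ i ∈ Finset.Icc 1 n, ((α + (i : ℂ)) ^ (n + 1 + 1 - i) * (i.factorial : ℂ)) =
          (∏ i ∈ Finset.Icc 1 n, (α + i)) *
            ∏ i ∈ Finset.Icc 1 n, ((α + (i : ℂ)) ^ (n + 1 - i) * (i.factorial : ℂ)) := by
        rw [← Finset.prod_mul_distrib]
        refine Finset.prod_congr rfl fun i hi => ?_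
        have := (Finset.mem_Icc.1 hi).2
        rw [show n + 1 + 1 - i = (n + 1 - i) + 1 by omega, pow_succ]
        ring
      rw [this, show n + 1 + 1 - (n + 1) = 1 by omega]
      ring
    simp only [Nat.add_sub_cancel] at h2 ⊢
    rw [h1, h2, show (n + 1 + 1) * (n + 1) = (n + 1) * n + 2 * (n + 1) by ring, pow_add]
    ring

end CRho

/-! ### Uniqueness of Harish-Chandra series -/

section HCUnique

variable {n : ℕ}

/-- The bilinear pairing of `ℂⁿ` with `ℝⁿ`. -/
noncomputable def dotC (nu : Fin n → ℂ) (v : Fin n → ℝ) : ℂ := ∑ i, nu i * (v i : ℂ)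

/-- `psi` is given on the positive chamber by a convergent series `∑_μ c_μ e^{κ - μ}`. -/
def HasExpansion (kap : Fin n → ℂ) (c : rootCone n → ℂ) (psi : (Fin n → ℝ) → ℂ) : Prop :=
  ∀ y ∈ posChamber n,
    HasSum (fun mu : rootCone n => c mu * expChar (fun i => kap i - ((mu : Fin n → ℤ) i : ℂ)) y)
      (psi y)

theorem dotC_add_smul (nu : Fin n → ℂ) (y v : Fin n → ℝ) (s : ℝ) :
    dotC nu (y + s • v) = dotC nu y + dotC nu v * s := by
  simp only [dotC, Finset.sum_mul, ← Finset.sum_add_distrib]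
  refine Finset.sum_congr rfl fun i _ => ?_
  simp only [Pi.add_apply, Pi.smul_apply, smul_eq_mul]
  push_cast
  ring

theorem expChar_eq (nu : Fin n → ℂ) (y : Fin n → ℝ) : expChar nu y = Complex.exp (dotC nu y) := rfl

theorem expChar_add_smul (nu : Fin n → ℂ) (y v : Fin n → ℝ) (s : ℝ) :
    expChar nu (y + s • v) = expChar nu y * Complex.exp (dotC nu v * s) := by
  rw [expChar_eq, expChar_eq, dotC_add_smul, Complex.exp_add]

theorem dotC_sub_intCast (kap : Fin n → ℂ) (mu : Fin n → ℤ) (v : Fin n → ℝ) :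
    dotC (fun i => kap i - (mu i : ℂ)) v = dotC kap v - (pairR v mu : ℝ) := by
  simp only [dotC, pairR, Complex.ofReal_sum, ← Finset.sum_sub_distrib]
  refine Finset.sum_congr rfl fun i _ => ?_
  push_cast
  ring

theorem dotC_intCast (nu : Fin n → ℂ) (a : Fin n → ℤ) : dotC nu (fun i => (a i : ℝ)) = pairC nu a := by
  simp [dotC, pairC]

theorem HasExpansion.lineDeriv {kap : Fin n → ℂ} {c : rootCone n → ℂ} {psi : (Fin n → ℝ) → ℂ}
    (h : HasExpansion kap c psi) (v : Fin n → ℝ) :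
    HasExpansion kap (fun mu => dotC (fun i => kap i - ((mu : Fin n → ℤ) i : ℂ)) v * c mu)
      (fun y => lineDeriv ℝ psi y v) := by
  intro y hy
  have hcont : Continuous fun s : ℝ => y + s • v := by fun_prop
  have hnear : ∀ᶠ s in 𝓝 (0 : ℝ), y + s • v ∈ posChamber n :=
    hcont.continuousAt.eventually_mem (isOpen_posChamber.mem_nhds (by simpa using hy))
  obtain ⟨ε, hε, hball⟩ := Metric.eventually_nhds_iff.1 hnear
  have key : ∀ s : ℝ, |s| < ε → Summable fun mu : rootCone n =>
      ‖c mu * expChar (fun i => kap i - ((mu : Fin n → ℤ) i : ℂ)) y‖ *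
        Real.exp (pairR v mu * -s) := by
    intro s hs
    have h1 := (h _ (hball (by simpa using hs))).summable.norm.mul_left
      (Real.exp (-(dotC kap v * s).re))
    refine h1.congr fun mu => ?_
    rw [expChar_add_smul, dotC_sub_intCast, ← mul_assoc, norm_mul _ (Complex.exp _),
      Complex.norm_exp, sub_mul, Complex.sub_re, mul_left_comm, ← Real.exp_add]
    congr 2
    rw [← Complex.ofReal_mul, Complex.ofReal_re]
    ring
  have hs1 := key (-(ε / 2)) (by rw [abs_neg, abs_of_pos (by positivity)]; linarith)
  have hs2 := key (ε / 2) (by rw [abs_of_pos (by positivity)]; linarith)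
  simp only [neg_neg] at hs1
  obtain ⟨h1, h2⟩ := hasDerivAt_tsum_mul_exp (dotC kap v) (half_pos hε) hs1 hs2
  have h3 := h2.congr_of_eventuallyEq (f₁ := fun s : ℝ => psi (y + s • v)) (by
    filter_upwards [hnear] with s hs
    rw [← (h _ hs).tsum_eq]
    refine tsum_congr fun mu => ?_
    simp only [expChar_add_smul, dotC_sub_intCast, mul_assoc])
  change HasSum _ (deriv _ 0)
  rw [h3.deriv]
  convert! h1.hasSum using 2 with mu
  simp only [dotC_sub_intCast, mul_assoc]

/-- The eigenvalue of `L(k)` on a term `e^ν` at a point `y`. -/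
noncomputable def laplaceSymbol (k : Multiplicity) (y : Fin n → ℝ) (nu : Fin n → ℂ) : ℂ :=
  ∑ i, nu i ^ 2 + ∑ a ∈ posRoots n,
    mult k a * (((1 + Real.exp (-pairR y a)) / (1 - Real.exp (-pairR y a)) : ℝ) : ℂ) * pairC nu a

theorem HasExpansion.hasSum_sq {kap : Fin n → ℂ} {c : rootCone n → ℂ}
    {psi : (Fin n → ℝ) → ℂ} (h : HasExpansion kap c psi) {y : Fin n → ℝ}
    (hy : y ∈ posChamber n) :
    HasSum (fun mu : rootCone n => (∑ i, (kap i - ((mu : Fin n → ℤ) i : ℂ)) ^ 2) *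
      (c mu * expChar (fun i => kap i - ((mu : Fin n → ℤ) i : ℂ)) y))
      (∑ j : Fin n, _root_.lineDeriv ℝ (fun z => _root_.lineDeriv ℝ psi z (Pi.single j 1)) y
        (Pi.single j 1)) := by
  have h1 := hasSum_sum (s := Finset.univ) fun j _ =>
    ((h.lineDeriv (Pi.single j 1)).lineDeriv (Pi.single j 1)) y hy
  convert! h1 using 2 with mu
  rw [Finset.sum_mul]
  refine Finset.sum_congr rfl fun j _ => ?_
  have : dotC (fun i => kap i - ((mu : Fin n → ℤ) i : ℂ)) (Pi.single j 1) =
      kap j - ((mu : Fin n → ℤ) j : ℂ) := by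
    simp only [dotC, Pi.single_apply]
    rw [Finset.sum_eq_single j (fun i _ h => by simp [h]) (by simp)]
    simp
  simp only [this]
  ring

theorem HasExpansion.hasSum_pairC {kap : Fin n → ℂ} {c : rootCone n → ℂ}
    {psi : (Fin n → ℝ) → ℂ} (h : HasExpansion kap c psi) {y : Fin n → ℝ}
    (hy : y ∈ posChamber n) (a : Fin n → ℤ) :
    HasSum (fun mu : rootCone n => pairC (fun i => kap i - ((mu : Fin n → ℤ) i : ℂ)) a *
      (c mu * expChar (fun i => kap i - ((mu : Fin n → ℤ) i : ℂ)) y))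
      (_root_.lineDeriv ℝ psi y (fun i => (a i : ℝ))) := by
  convert! h.lineDeriv (fun i => (a i : ℝ)) y hy using 2 with mu
  simp only [dotC_intCast, mul_assoc]

theorem HasExpansion.hasSum_laplaceL {kap : Fin n → ℂ} {c : rootCone n → ℂ}
    {psi : (Fin n → ℝ) → ℂ} (h : HasExpansion kap c psi) (k : Multiplicity) {y : Fin n → ℝ}
    (hy : y ∈ posChamber n) :
    HasSum (fun mu : rootCone n => laplaceSymbol k y (fun i => kap i - ((mu : Fin n → ℤ) i : ℂ)) *
      (c mu * expChar (fun i => kap i - ((mu : Fin n → ℤ) i : ℂ)) y)) (laplaceL k psi y) := by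
  have h2 := (h.hasSum_sq hy).add (hasSum_sum (s := posRoots n) fun a _ =>
    (h.hasSum_pairC hy a).mul_left
      (mult k a * (((1 + Real.exp (-pairR y a)) / (1 - Real.exp (-pairR y a)) : ℝ) : ℂ)))
  convert! h2 using 2 with mu
  simp only [laplaceSymbol, add_mul, Finset.sum_mul, mul_assoc]

theorem exists_abs_le_mul_pairR {y : Fin n → ℝ} (hy : y ∈ posChamber n) :
    ∃ C : ℝ, ∀ mu ∈ rootCone n, ∀ i, |(mu i : ℝ)| ≤ C * pairR y mu := by
  refine ⟨∑ a ∈ posRoots n, ∑ i, |(a i : ℝ)| / pairR y a, fun mu hmu => ?_⟩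
  induction hmu using AddSubmonoid.closure_induction with
  | mem a ha =>
    intro i
    have hp := hy a ha
    rw [← div_le_iff₀ hp]
    have h1 : |(a i : ℝ)| / pairR y a ≤ ∑ i, |(a i : ℝ)| / pairR y a :=
      Finset.single_le_sum (f := fun i => |(a i : ℝ)| / pairR y a)
        (fun i _ => div_nonneg (abs_nonneg _) hp.le) (Finset.mem_univ i)
    exact h1.trans (Finset.single_le_sum (f := fun a => ∑ i, |((a : Fin n → ℤ) i : ℝ)| / pairR y a)
      (fun b hb => Finset.sum_nonneg fun i _ => div_nonneg (abs_nonneg _) (hy b hb).le) ha)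
  | zero => simp [pairR]
  | add a b _ _ iha ihb =>
    intro i
    rw [pairR_add, mul_add, Pi.add_apply, Int.cast_add]
    exact (abs_add_le _ _).trans (add_le_add (iha i) (ihb i))

theorem pairR_nonneg_of_mem_rootCone {y : Fin n → ℝ} (hy : y ∈ posChamber n) {mu : Fin n → ℤ}
    (hmu : mu ∈ rootCone n) : 0 ≤ pairR y mu := by
  induction hmu using AddSubmonoid.closure_induction with
  | mem a ha => exact (hy a ha).le
  | zero => simp [pairR]
  | add a b _ _ iha ihb =>
    rw [pairR_add]
    exact add_nonneg iha ihb

theorem eq_zero_of_mem_rootCone_of_pairR_eq_zero {y : Fin n → ℝ} (hy : y ∈ posChamber n)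
    {mu : Fin n → ℤ} (hmu : mu ∈ rootCone n) (h : pairR y mu = 0) : mu = 0 := by
  obtain ⟨C, hC⟩ := exists_abs_le_mul_pairR hy
  funext i
  have := hC mu hmu i
  rw [h, mul_zero] at this
  exact_mod_cast abs_nonpos_iff.1 this

theorem finite_rootCone_pairR_le {y : Fin n → ℝ} (hy : y ∈ posChamber n) (B : ℝ) :
    {mu : rootCone n | pairR y mu ≤ B}.Finite := by
  obtain ⟨C, hC⟩ := exists_abs_le_mul_pairR hy
  obtain ⟨N, hN⟩ := exists_nat_ge (|C| * B)
  refine Set.Finite.of_finite_image (f := Subtype.val) ?_ Subtype.val_injective.injOn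
  refine (Set.finite_Icc (fun _ : Fin n => -(N : ℤ)) (fun _ => (N : ℤ))).subset ?_
  rintro _ ⟨mu, hmu, rfl⟩
  have hb : ∀ i, |(mu : Fin n → ℤ) i| ≤ (N : ℤ) := by
    intro i
    have h0 := hC mu mu.2 i
    have hp := pairR_nonneg_of_mem_rootCone hy mu.2
    have h1 : |((mu : Fin n → ℤ) i : ℝ)| ≤ N :=
      h0.trans ((mul_le_mul (le_abs_self C) hmu hp (abs_nonneg C)).trans hN)
    exact_mod_cast h1
  exact ⟨fun i => (abs_le.1 (hb i)).1, fun i => (abs_le.1 (hb i)).2⟩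

theorem two_mul_pairing_rho (k : Multiplicity) (nu : Fin n → ℂ) :
    2 * ∑ i, rho n k i * nu i = ∑ a ∈ posRoots n, mult k a * pairC nu a := by
  simp only [rho, pairC, Finset.mul_sum, Finset.sum_mul]
  rw [Finset.sum_comm]
  refine Finset.sum_congr rfl fun a _ => Finset.sum_congr rfl fun i _ => ?_
  ring

theorem laplaceSymbol_limit (k : Multiplicity) (lam : Fin n → ℂ) (mu : Fin n → ℤ) :
    (∑ i, (lam i - rho n k i - (mu i : ℂ)) ^ 2 +
      ∑ a ∈ posRoots n, mult k a * 1 * pairC (fun i => lam i - rho n k i - (mu i : ℂ)) a) -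
      ((∑ i, lam i ^ 2) - ∑ i, rho n k i ^ 2) = -2 * pairC lam mu + (normSq mu : ℂ) := by
  simp only [mul_one]
  rw [← two_mul_pairing_rho]
  simp only [pairC, normSq, Finset.mul_sum, Int.cast_sum, ← Finset.sum_add_distrib,
    ← Finset.sum_sub_distrib]
  refine Finset.sum_congr rfl fun i _ => ?_
  push_cast
  ring

theorem pairR_smul (s : ℝ) (y : Fin n → ℝ) (a : Fin n → ℤ) : pairR (s • y) a = s * pairR y a := by
  simp only [pairR, Finset.mul_sum, Pi.smul_apply, smul_eq_mul, mul_assoc]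

theorem smul_mem_posChamber {s : ℝ} (hs : 0 < s) {y : Fin n → ℝ} (hy : y ∈ posChamber n) :
    s • y ∈ posChamber n := fun a ha => by
  rw [pairR_smul]
  exact mul_pos hs (hy a ha)

theorem coeff_eq_zero_of_laplaceSymbol {k : Multiplicity} {lam : Fin n → ℂ} (hlam : IsGeneric lam)
    {d : rootCone n → ℂ} (hd0 : d 0 = 0)
    (hs1 : ∀ y ∈ posChamber n, Summable fun mu : rootCone n =>
      (∑ i, (lam i - rho n k i - ((mu : Fin n → ℤ) i : ℂ)) ^ 2) *
        (d mu * expChar (fun i => lam i - rho n k i - ((mu : Fin n → ℤ) i : ℂ)) y))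
    (hs2 : ∀ y ∈ posChamber n, ∀ a : Fin n → ℤ, Summable fun mu : rootCone n =>
      pairC (fun i => lam i - rho n k i - ((mu : Fin n → ℤ) i : ℂ)) a *
        (d mu * expChar (fun i => lam i - rho n k i - ((mu : Fin n → ℤ) i : ℂ)) y))
    (hs3 : ∀ y ∈ posChamber n, Summable fun mu : rootCone n =>
        (d mu * expChar (fun i => lam i - rho n k i - ((mu : Fin n → ℤ) i : ℂ)) y))
    (heq : ∀ y ∈ posChamber n, ∑' mu : rootCone n,
      (laplaceSymbol k y (fun i => lam i - rho n k i - ((mu : Fin n → ℤ) i : ℂ)) -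
        ((∑ i, lam i ^ 2) - ∑ i, rho n k i ^ 2)) *
        (d mu * expChar (fun i => lam i - rho n k i - ((mu : Fin n → ℤ) i : ℂ)) y) = 0) :
    d = 0 := by
  by_contra hne
  obtain ⟨mu1, hmu1⟩ := Function.ne_iff.1 hne
  obtain ⟨y, hy, hinj⟩ := exists_mem_posChamber_pairR_ne_zero (n := n)
  obtain ⟨mu0, ⟨-, hd⟩, hmin⟩ := Set.exists_min_image
    ({mu : rootCone n | pairR y mu ≤ pairR y mu1} ∩ {mu | d mu ≠ 0}) (fun mu => pairR y mu)
    ((finite_rootCone_pairR_le hy _).inter_of_left _) ⟨mu1, le_refl (pairR y mu1), hmu1⟩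
  have hlt : ∀ mu : rootCone n, d mu ≠ 0 → mu ≠ mu0 → pairR y mu0 < pairR y mu := by
    intro mu hmu hmn
    have h1 : pairR y mu0 ≤ pairR y mu := by
      rcases le_or_gt (pairR y mu) (pairR y mu1) with h | h
      · exact hmin mu ⟨h, hmu⟩
      · exact (hmin mu1 ⟨le_refl (pairR y mu1), hmu1⟩).trans h.le
    refine h1.lt_of_ne fun h => hinj ((mu : Fin n → ℤ) - mu0) ?_ ?_
    · rw [sub_ne_zero]
      exact fun h => hmn (Subtype.ext h)
    · rw [pairR_sub, h, sub_self]
  set kap : Fin n → ℂ := fun i => lam i - rho n k i with hkap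
  set E : ℂ := (∑ i, lam i ^ 2) - ∑ i, rho n k i ^ 2 with hE
  have hexp : ∀ (s : ℝ) (mu : rootCone n),
      expChar (fun i => kap i - ((mu : Fin n → ℤ) i : ℂ)) (s • y) =
        Complex.exp (s * dotC kap y - s * pairR y mu) := by
    intro s mu
    have := expChar_add_smul (fun i => kap i - ((mu : Fin n → ℤ) i : ℂ)) 0 y s
    rw [zero_add] at this
    rw [this, dotC_sub_intCast, expChar_eq]
    simp only [dotC, Pi.zero_apply, Complex.ofReal_zero, mul_zero, Finset.sum_const_zero,
      Complex.exp_zero, one_mul]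
    congr 1
    ring
  let f : ℝ → rootCone n → ℂ := fun s mu =>
    (laplaceSymbol k (s • y) (fun i => kap i - ((mu : Fin n → ℤ) i : ℂ)) - E) *
      (d mu * Complex.exp (-(s * (pairR y mu - pairR y mu0 : ℝ) : ℝ)))
  have hf0 : ∀ s : ℝ, 0 < s → ∑' mu, f s mu = 0 := by
    intro s hs
    have h1 := heq _ (smul_mem_posChamber hs hy)
    have h2 : ∀ mu : rootCone n, f s mu = Complex.exp (-(s * dotC kap y) + s * pairR y mu0) *
        ((laplaceSymbol k (s • y) (fun i => kap i - ((mu : Fin n → ℤ) i : ℂ)) - E) *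
        (d mu * expChar (fun i => kap i - ((mu : Fin n → ℤ) i : ℂ)) (s • y))) := by
      intro mu
      rw [hexp]
      simp only [f]
      rw [mul_left_comm (Complex.exp _), mul_left_comm (Complex.exp _), ← Complex.exp_add]
      congr 3
      push_cast
      ring
    rw [tsum_congr h2, tsum_mul_left, h1, mul_zero]
  have hratio : ∀ a ∈ posRoots n, Tendsto (fun s : ℝ =>
      (((1 + Real.exp (-pairR (s • y) a)) / (1 - Real.exp (-pairR (s • y) a)) : ℝ) : ℂ)) atTop
      (𝓝 1) := by
    intro a ha
    have h1 : Tendsto (fun s : ℝ => Real.exp (-pairR (s • y) a)) atTop (𝓝 0) := by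
      refine Real.tendsto_exp_atBot.comp (tendsto_neg_atTop_atBot.comp ?_)
      simp only [pairR_smul]
      exact tendsto_id.atTop_mul_const (hy a ha)
    have h2 := (h1.const_add 1).div (h1.const_sub 1) (by norm_num)
    rw [add_zero, sub_zero, div_one] at h2
    exact (Complex.continuous_ofReal.tendsto 1).comp h2
  let g : rootCone n → ℂ := fun mu => if mu = mu0 then
    (-2 * pairC lam mu0 + (normSq (mu0 : Fin n → ℤ) : ℂ)) * d mu0 else 0
  have hsym : ∀ mu : rootCone n, Tendsto (fun s : ℝ =>
      laplaceSymbol k (s • y) (fun i => kap i - ((mu : Fin n → ℤ) i : ℂ)) - E) atTop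
      (𝓝 (-2 * pairC lam mu + (normSq (mu : Fin n → ℤ) : ℂ))) := by
    intro mu
    rw [← laplaceSymbol_limit k lam mu]
    exact (tendsto_const_nhds.add (tendsto_finsetSum _ fun a ha =>
      ((hratio a ha).const_mul _).mul_const _)).sub_const _
  have hlim : ∀ mu, Tendsto (fun s => f s mu) atTop (𝓝 (g mu)) := by
    intro mu
    by_cases h0 : d mu = 0
    · have : g mu = 0 := by
        simp only [g]
        split_ifs with h
        · exact absurd (h ▸ h0) hd
        · rfl
      rw [this]
      refine tendsto_const_nhds.congr fun s => ?_
      simp [f, h0]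
    by_cases hm : mu = mu0
    · subst hm
      simp only [f, g, sub_self, mul_zero, neg_zero, Complex.ofReal_zero, Complex.exp_zero, mul_one,
        if_true]
      exact (hsym mu).mul_const _
    · have hpos := sub_pos.2 (hlt mu h0 hm)
      have h1 : Tendsto (fun s : ℝ => Complex.exp (-(s * (pairR y mu - pairR y mu0 : ℝ) : ℝ))) atTop
          (𝓝 0) := by
        have := Real.tendsto_exp_atBot.comp (tendsto_neg_atTop_atBot.comp
          (tendsto_id.atTop_mul_const hpos))
        have := (Complex.continuous_ofReal.tendsto 0).comp this
        rw [Complex.ofReal_zero] at this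
        refine this.congr fun s => ?_
        simp
      have h2 := (hsym mu).mul (h1.const_mul (d mu))
      simp only [g, if_neg hm]
      simpa only [mul_zero] using h2
  let bound : rootCone n → ℝ := fun mu =>
    ‖Complex.exp (-dotC kap y + pairR y mu0)‖ *
    ((‖(∑ i, (kap i - ((mu : Fin n → ℤ) i : ℂ)) ^ 2) *
        (d mu * expChar (fun i => kap i - ((mu : Fin n → ℤ) i : ℂ)) y)‖ +
      ∑ a ∈ posRoots n, ‖mult k a‖ * 2 *
        ‖pairC (fun i => kap i - ((mu : Fin n → ℤ) i : ℂ)) a *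
          (d mu * expChar (fun i => kap i - ((mu : Fin n → ℤ) i : ℂ)) y)‖) +
      ‖E‖ * ‖d mu * expChar (fun i => kap i - ((mu : Fin n → ℤ) i : ℂ)) y‖)
  have hbs : Summable bound :=
    (((hs1 y hy).norm.add (summable_sum fun a _ => (hs2 y hy a).norm.mul_left _)).add
      ((hs3 y hy).norm.mul_left _)).mul_left _
  have hbd : ∀ᶠ s in atTop, ∀ mu, ‖f s mu‖ ≤ bound mu := by
    have h1 : ∀ᶠ s : ℝ in atTop, ∀ a ∈ posRoots n,
        ‖(((1 + Real.exp (-pairR (s • y) a)) / (1 - Real.exp (-pairR (s • y) a)) : ℝ) : ℂ)‖ ≤ 2 := by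
      rw [Filter.eventually_all_finset]
      intro a ha
      have := (hratio a ha).norm
      rw [norm_one] at this
      exact this.eventually_le_const (by norm_num)
    filter_upwards [h1, eventually_ge_atTop 1] with s hs hs1 mu
    by_cases h0 : d mu = 0
    · simp [f, bound, h0]
    have hle : 0 ≤ pairR y mu - pairR y mu0 := by
      by_cases hm : mu = mu0
      · rw [hm, sub_self]
      · exact (sub_pos.2 (hlt mu h0 hm)).le
    have e1 : ‖d mu * Complex.exp (-(s * (pairR y mu - pairR y mu0 : ℝ) : ℝ))‖ ≤
        ‖Complex.exp (-dotC kap y + pairR y mu0)‖ *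
        ‖d mu * expChar (fun i => kap i - ((mu : Fin n → ℤ) i : ℂ)) y‖ := by
      have := hexp 1 mu
      rw [one_smul] at this
      rw [this, norm_mul, norm_mul, mul_left_comm, ← norm_mul (Complex.exp _), ← Complex.exp_add]
      refine mul_le_mul_of_nonneg_left ?_ (norm_nonneg _)
      rw [Complex.norm_exp, Complex.norm_exp]
      refine Real.exp_le_exp.2 ?_
      have : -dotC kap y + (pairR y mu0 : ℂ) + ((1 : ℝ) * dotC kap y - (1 : ℝ) * (pairR y mu : ℂ)) =
          ((-(pairR y mu - pairR y mu0) : ℝ) : ℂ) := by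
        push_cast
        ring
      rw [this, ← Complex.ofReal_neg, Complex.ofReal_re, Complex.ofReal_re]
      nlinarith
    have e2 : ‖laplaceSymbol k (s • y) (fun i => kap i - ((mu : Fin n → ℤ) i : ℂ)) - E‖ ≤
        (‖∑ i, (kap i - ((mu : Fin n → ℤ) i : ℂ)) ^ 2‖ + ∑ a ∈ posRoots n, ‖mult k a‖ * 2 *
          ‖pairC (fun i => kap i - ((mu : Fin n → ℤ) i : ℂ)) a‖) + ‖E‖ := by
      refine (norm_sub_le _ _).trans (add_le_add_left ((norm_add_le _ _).trans
        (add_le_add_right ((norm_sum_le _ _).trans (Finset.sum_le_sum fun a ha => ?_)) _)) _)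
      rw [norm_mul, norm_mul]
      gcongr
      exact hs a ha
    calc ‖f s mu‖ ≤ _ := (norm_mul_le _ _).trans (mul_le_mul e2 e1 (norm_nonneg _) (by positivity))
      _ = bound mu := by
        simp only [bound, norm_mul]
        generalize ‖∑ i, (kap i - ((mu : Fin n → ℤ) i : ℂ)) ^ 2‖ = N
        simp only [add_mul, mul_add, Finset.sum_mul, Finset.mul_sum]
        congr 1
        · congr 1
          · ring
          · exact Finset.sum_congr rfl fun a _ => by ring
        · ring
  have hconv := tendsto_tsum_of_dominated_convergence hbs hlim hbd
  have hz : Tendsto (fun s => ∑' mu, f s mu) atTop (𝓝 0) :=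
    tendsto_const_nhds.congr' (by filter_upwards [eventually_gt_atTop 0] with s hs using (hf0 s hs).symm)
  have hval := tendsto_nhds_unique hconv hz
  rw [tsum_eq_single mu0 (fun mu hm => if_neg hm)] at hval
  simp only [if_true] at hval
  have hm0 : (mu0 : Fin n → ℤ) ≠ 0 := by
    intro h
    have : mu0 = 0 := Subtype.ext h
    exact hd (this ▸ hd0)
  exact mul_ne_zero (hlam mu0 mu0.2 hm0) hd hval

theorem IsHarishChandraSeries.eqOn {k : Multiplicity} {lam : Fin n → ℂ} (hlam : IsGeneric lam)
    {Phi Psi : (Fin n → ℝ) → ℂ} (h1 : IsHarishChandraSeries k lam Phi)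
    (h2 : IsHarishChandraSeries k lam Psi) : Set.EqOn Phi Psi (posChamber n) := by
  obtain ⟨⟨c, hc0, hc⟩, hce⟩ := h1
  obtain ⟨⟨d, hd0, hd⟩, hde⟩ := h2
  change HasExpansion (fun i => lam i - rho n k i) c Phi at hc
  change HasExpansion (fun i => lam i - rho n k i) d Psi at hd
  have hcd : c - d = 0 := by
    refine coeff_eq_zero_of_laplaceSymbol (k := k) hlam ?_ ?_ ?_ ?_ ?_
    · rw [Pi.sub_apply, hc0, hd0, sub_self]
    · intro y hy
      refine ((hc.hasSum_sq hy).sub (hd.hasSum_sq hy)).summable.congr fun mu => ?_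
      rw [Pi.sub_apply]
      ring
    · intro y hy a
      refine ((hc.hasSum_pairC hy a).sub (hd.hasSum_pairC hy a)).summable.congr fun mu => ?_
      rw [Pi.sub_apply]
      ring
    · intro y hy
      refine ((hc y hy).sub (hd y hy)).summable.congr fun mu => ?_
      rw [Pi.sub_apply]
      ring
    · intro y hy
      have e1 := (hc.hasSum_laplaceL k hy).sub ((hc y hy).mul_left
        ((∑ i, lam i ^ 2) - ∑ i, rho n k i ^ 2))
      have e2 := (hd.hasSum_laplaceL k hy).sub ((hd y hy).mul_left
        ((∑ i, lam i ^ 2) - ∑ i, rho n k i ^ 2))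
      have e3 := e1.sub e2
      rw [hce y hy, hde y hy, sub_self, sub_self, sub_self] at e3
      rw [← e3.tsum_eq]
      refine tsum_congr fun mu => ?_
      rw [Pi.sub_apply]
      ring
  intro y hy
  have := hc y hy
  rw [sub_eq_zero.1 hcd] at this
  exact this.unique (hd y hy)

end HCUnique

/-! ### Expansions along the root cone -/

section ConeSeries

variable {n : ℕ}

/-- `f` is given on the positive chamber by a convergent series `∑_μ Γ_μ e^{-μ}` with `Γ_0 = 1`. -/
def HasConeSeries (f : (Fin n → ℝ) → ℂ) : Prop :=
  ∃ Gam : rootCone n → ℂ, Gam 0 = 1 ∧ ∀ y ∈ posChamber n,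
    HasSum (fun mu : rootCone n => Gam mu * Complex.exp (-(pairR y mu : ℝ))) (f y)

theorem hasConeSeries_of_hasSum {a : Fin n → ℤ} (ha : a ∈ posRoots n) {c : ℕ → ℂ} (h0 : c 0 = 1)
    {f : (Fin n → ℝ) → ℂ}
    (h : ∀ y ∈ posChamber n, HasSum (fun m => c m * Complex.exp (-(pairR y a : ℝ)) ^ m) (f y)) :
    HasConeSeries f := by
  let g : ℕ → rootCone n := fun m => m • ⟨a, AddSubmonoid.subset_closure ha⟩
  have hg : ∀ m, (g m : Fin n → ℤ) = (m : ℤ) • a := fun m => by simp [g]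
  have hinj : Function.Injective g := by
    intro m m' hm
    have h1 : (g m : Fin n → ℤ) = g m' := by rw [hm]
    rw [hg, hg] at h1
    exact_mod_cast smul_left_injective ℤ (ne_zero_of_mem_posRoots ha) h1
  refine ⟨Function.extend g c 0, ?_, fun y hy => ?_⟩
  · have : (0 : rootCone n) = g 0 := by simp [g]
    rw [this, hinj.extend_apply, h0]
  · rw [← hinj.hasSum_iff]
    · convert! h y hy using 2 with m
      rw [Function.comp_apply, hinj.extend_apply, ← Complex.exp_nat_mul, hg]
      congr 2
      simp only [pairR, Pi.smul_apply, smul_eq_mul, Int.cast_mul, Int.cast_natCast]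
      push_cast
      rw [mul_neg, Finset.mul_sum, neg_inj]
      refine Finset.sum_congr rfl fun i _ => ?_
      ring
    · intro mu hmu
      rw [Function.extend_apply' _ _ _ (fun ⟨m, hm⟩ => hmu ⟨m, hm⟩)]
      simp

theorem HasConeSeries.mul {f g : (Fin n → ℝ) → ℂ} (hf : HasConeSeries f) (hg : HasConeSeries g) :
    HasConeSeries (fun y => f y * g y) := by
  obtain ⟨b, hb0, hb⟩ := hf
  obtain ⟨c, hc0, hc⟩ := hg
  let s : rootCone n × rootCone n → rootCone n := fun p => p.1 + p.2
  refine ⟨fun mu => ∑' p : s ⁻¹' {mu}, b p.1.1 * c p.1.2, ?_, fun y hy => ?_⟩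
  · obtain ⟨y, hy⟩ := posChamber_nonempty (n := n)
    have : s ⁻¹' {0} = {(0, 0)} := by
      ext ⟨p, q⟩
      simp only [Set.mem_preimage, Set.mem_singleton_iff, s, Prod.mk.injEq]
      constructor
      · intro h
        have h1 : pairR y (p : Fin n → ℤ) + pairR y (q : Fin n → ℤ) = 0 := by
          rw [← pairR_add, ← AddSubmonoid.coe_add, h]
          simp [pairR]
        have h2 := pairR_nonneg_of_mem_rootCone hy p.2
        have h3 := pairR_nonneg_of_mem_rootCone hy q.2
        exact ⟨Subtype.ext (eq_zero_of_mem_rootCone_of_pairR_eq_zero hy p.2 (by linarith)),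
          Subtype.ext (eq_zero_of_mem_rootCone_of_pairR_eq_zero hy q.2 (by linarith))⟩
      · rintro ⟨rfl, rfl⟩
        exact add_zero _
    change ∑' p : (s ⁻¹' {0} : Set _), b p.1.1 * c p.1.2 = 1
    rw [this, tsum_singleton (0, 0) (fun p : rootCone n × rootCone n => b p.1 * c p.2), hb0, hc0,
      one_mul]
  · have hsum := summable_mul_of_summable_norm (hb y hy).summable.norm (hc y hy).summable.norm
    have h1 := (hb y hy).mul (hc y hy) hsum
    have h2 := h1.tsum_fiberwise s
    convert! h2 using 2 with mu
    rw [← tsum_mul_right]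
    refine tsum_congr fun p => ?_
    have hp : (p.1.1 : Fin n → ℤ) + p.1.2 = mu := congrArg Subtype.val (show s p.1 = mu from p.2)
    rw [← hp, pairR_add, Complex.ofReal_add, neg_add, Complex.exp_add]
    ring

theorem HasConeSeries.one : HasConeSeries (fun _ : Fin n → ℝ => (1 : ℂ)) := by
  classical
  refine ⟨Pi.single 0 1, Pi.single_eq_same _ _, fun y _ => ?_⟩
  have h := hasSum_single (f := fun mu : rootCone n =>
    (Pi.single 0 1 : rootCone n → ℂ) mu * Complex.exp (-(pairR y mu : ℝ))) (0 : rootCone n)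
    (fun mu hmu => by rw [Pi.single_eq_of_ne hmu, zero_mul])
  have h0 : pairR y ((0 : rootCone n) : Fin n → ℤ) = 0 := by simp [pairR]
  rw [Pi.single_eq_same, h0, Complex.ofReal_zero, neg_zero, Complex.exp_zero, one_mul] at h
  exact h

theorem HasConeSeries.prod {ι : Type*} (s : Finset ι) {f : ι → (Fin n → ℝ) → ℂ}
    (hf : ∀ i ∈ s, HasConeSeries (f i)) : HasConeSeries (fun y => ∏ i ∈ s, f i y) := by
  classical
  induction s using Finset.induction_on with
  | empty => simpa using HasConeSeries.one
  | insert i s hi ih =>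
    simp only [Finset.prod_insert hi]
    exact (hf i (Finset.mem_insert_self i s)).mul
      (ih fun j hj => hf j (Finset.mem_insert_of_mem hj))

theorem HasConeSeries.exists_expansion {f : (Fin n → ℝ) → ℂ} (hf : HasConeSeries f)
    (kap : Fin n → ℂ) : ∃ Gam : rootCone n → ℂ, Gam 0 = 1 ∧
      HasExpansion kap Gam (fun y => expChar kap y * f y) := by
  obtain ⟨b, hb0, hb⟩ := hf
  refine ⟨b, hb0, fun y hy => ?_⟩
  convert! (hb y hy).mul_left (expChar kap y) using 2 with mu
  rw [expChar_eq, dotC_sub_intCast, sub_eq_add_neg, Complex.exp_add, expChar_eq]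
  ring

theorem hasConeSeries_hcPhi (ks kl : ℂ) {l : ℂ} (hl : l ∈ regularSet) (p : Fin n) :
    HasConeSeries (fun y => Complex.exp (-((l - rho₁ ks kl) * (y p : ℂ))) * hcPhi ks kl l (y p)) := by
  refine hasConeSeries_of_hasSum (a := e p) (((forall_mem_posRoots (P := (· ∈ posRoots n))).1
        (fun _ h => h)).1 p).1 (c := fun m => hcCoeff ks kl m l) (by simp [hcCoeff]) fun y hy => ?_
  rw [hcPhi, ← mul_assoc, ← Complex.exp_add, neg_add_cancel, Complex.exp_zero, one_mul, pairR_e]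
  have hp := (mem_posChamber_iff.1 hy).1 p
  refine Summable.hasSum (Summable.of_norm ?_)
  refine (summable_norm_hcCoeff_mul_pow ks kl hl (Real.exp (-y p)) (Real.exp_pos _).le
    (Real.exp_lt_one_iff.2 (by linarith))).congr fun m => ?_
  rw [norm_mul, norm_pow, Complex.norm_exp]
  simp

theorem hasConeSeries_inv_one_sub {a : Fin n → ℤ} (ha : a ∈ posRoots n) :
    HasConeSeries (fun y => (1 - Complex.exp (-(pairR y a : ℝ)))⁻¹) := by
  refine hasConeSeries_of_hasSum ha (c := fun _ => 1) rfl fun y hy => ?_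
  simp only [one_mul]
  refine hasSum_geometric_of_norm_lt_one ?_
  rw [Complex.norm_exp, Real.exp_lt_one_iff]
  simpa using hy a ha

theorem sum_middleRoots_pairR (y : Fin n → ℝ) :
    ∑ a ∈ middleRoots n, pairR y a / 2 = ∑ i, y i * ((n - 1 - i : ℕ) : ℝ) := by
  rw [sum_middleRoots]
  simp only [pairR_add, pairR_sub, pairR_e]
  rw [Finset.sum_congr rfl (g := fun q => (fun i _ => y i) q.1 q.2) fun q _ => by ring,
    sum_ltPairs (fun i _ => y i)]
  simp [mul_comm]

theorem middleDenominator_eq (y : Fin n → ℝ) : middleDenominator n y =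
    Real.exp (∑ i, y i * ((n - 1 - i : ℕ) : ℝ)) *
      ∏ a ∈ middleRoots n, (1 - Real.exp (-pairR y a)) := by
  rw [← sum_middleRoots_pairR, Real.exp_sum, ← Finset.prod_mul_distrib]
  refine Finset.prod_congr rfl fun a _ => ?_
  rw [mul_sub, mul_one, ← Real.exp_add]
  congr 2
  ring

/-- The product of the Harish-Chandra series of rank one. -/
noncomputable def hcProd (ks kl : ℂ) (lam : Fin n → ℂ) (y : Fin n → ℝ) : ℂ :=
  ∏ i, hcPhi ks kl (lam i) (y i)

theorem exists_expansion_hcProd (ks kl : ℂ) {lam : Fin n → ℂ} (hlam : ∀ i, lam i ∈ regularSet) :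
    ∃ Gam : rootCone n → ℂ, Gam 0 = 1 ∧
      HasExpansion (fun i => lam i - rho n (ks, 0, kl) i) Gam (hcProd ks kl lam) := by
  obtain ⟨Gam, h0, h⟩ := (HasConeSeries.prod Finset.univ fun i _ =>
    hasConeSeries_hcPhi ks kl (hlam i) i).exists_expansion (fun i => lam i - rho n (ks, 0, kl) i)
  refine ⟨Gam, h0, fun y hy => ?_⟩
  convert! h y hy using 1
  dsimp only
  rw [hcProd, Finset.prod_mul_distrib, ← mul_assoc, ← Complex.exp_sum, expChar, ← Complex.exp_add,
    ← Finset.sum_add_distrib, Finset.sum_eq_zero, Complex.exp_zero, one_mul]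
  intro i _
  rw [rho_apply]
  ring

theorem exists_expansion_hcProd_div (ks kl : ℂ) {lam : Fin n → ℂ}
    (hlam : ∀ i, lam i ∈ regularSet) :
    ∃ Gam : rootCone n → ℂ, Gam 0 = 1 ∧
      HasExpansion (fun i => lam i - rho n (ks, 1, kl) i) Gam
        (fun y => hcProd ks kl lam y / (middleDenominator n y : ℂ)) := by
  obtain ⟨Gam, h0, h⟩ := ((HasConeSeries.prod Finset.univ fun i _ =>
    hasConeSeries_hcPhi ks kl (hlam i) i).mul (HasConeSeries.prod (middleRoots n) fun a ha =>
      hasConeSeries_inv_one_sub (mem_posRoots_of_mem_middleRoots ha))).exists_expansion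
        (fun i => lam i - rho n (ks, 1, kl) i)
  refine ⟨Gam, h0, fun y hy => ?_⟩
  convert! h y hy using 1
  dsimp only
  rw [hcProd, Finset.prod_mul_distrib, ← mul_assoc, ← mul_assoc, ← Complex.exp_sum, expChar,
    ← Complex.exp_add, ← Finset.sum_add_distrib, middleDenominator_eq, Finset.prod_inv_distrib]
  have : ∑ i, ((lam i - rho n (ks, 1, kl) i) * (y i : ℂ) + -((lam i - rho₁ ks kl) * (y i : ℂ))) =
      -((∑ i, y i * ((n - 1 - i : ℕ) : ℝ) : ℝ) : ℂ) := by
    push_cast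
    rw [← Finset.sum_neg_distrib]
    refine Finset.sum_congr rfl fun i _ => ?_
    rw [rho_apply]
    ring
  rw [this, Complex.exp_neg]
  push_cast
  rw [div_eq_mul_inv, mul_inv]
  ring

end ConeSeries

/-! ### The radial part of the Laplacian -/

section Laplacian

variable {n : ℕ}

/-- The logarithmic derivative of the Weyl denominator of the middle roots along `e_i`. -/
noncomputable def logDerivDenom (y : Fin n → ℝ) (i : Fin n) : ℂ :=
  ∑ j, Complex.sinh (y i) / (Complex.cosh (y i) - Complex.cosh (y j))

theorem ofReal_coth_half_eq (x : ℝ) :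
    (((1 + Real.exp (-x)) / (1 - Real.exp (-x)) : ℝ) : ℂ) =
      (1 + Complex.exp (-x)) / (1 - Complex.exp (-x)) := by
  push_cast
  rfl

theorem coth_half_add {a b : ℂ} (h1 : 1 - Complex.exp (-(a - b)) ≠ 0)
    (h2 : 1 - Complex.exp (-(a + b)) ≠ 0) :
    (1 + Complex.exp (-(a - b))) / (1 - Complex.exp (-(a - b))) +
      (1 + Complex.exp (-(a + b))) / (1 - Complex.exp (-(a + b))) =
      2 * (Complex.sinh a / (Complex.cosh a - Complex.cosh b)) ∧
    (1 + Complex.exp (-(a + b))) / (1 - Complex.exp (-(a + b))) -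
      (1 + Complex.exp (-(a - b))) / (1 - Complex.exp (-(a - b))) =
      2 * (Complex.sinh b / (Complex.cosh b - Complex.cosh a)) := by
  have ha := Complex.exp_ne_zero (-a)
  have hb := Complex.exp_ne_zero (-b)
  have ea : Complex.exp a = (Complex.exp (-a))⁻¹ := by rw [Complex.exp_neg, inv_inv]
  have eb : Complex.exp b = (Complex.exp (-b))⁻¹ := by rw [Complex.exp_neg, inv_inv]
  have e1 : Complex.exp (-(a - b)) = Complex.exp (-a) * (Complex.exp (-b))⁻¹ := by
    rw [← eb, ← Complex.exp_add]
    ring_nf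
  have e2 : Complex.exp (-(a + b)) = Complex.exp (-a) * Complex.exp (-b) := by
    rw [← Complex.exp_add]
    ring_nf
  rw [e1] at h1 ⊢
  rw [e2] at h2 ⊢
  simp only [Complex.sinh, Complex.cosh, ea, eb]
  generalize Complex.exp (-a) = p at *
  generalize Complex.exp (-b) = q at *
  have h1' : q - p ≠ 0 := by
    intro h
    apply h1
    rw [sub_eq_zero.1 h, mul_inv_cancel₀ ha, sub_self]
  have h3 : (p⁻¹ + p) / 2 - (q⁻¹ + q) / 2 ≠ 0 := by
    have : (p⁻¹ + p) / 2 - (q⁻¹ + q) / 2 = (q - p) * (1 - p * q) / (2 * p * q) := by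
      field_simp
      ring
    rw [this]
    exact div_ne_zero (mul_ne_zero h1' h2) (by simp [ha, hb])
  have h4 : (q⁻¹ + q) / 2 - (p⁻¹ + p) / 2 ≠ 0 := by
    rw [← neg_sub]
    exact neg_ne_zero.2 h3
  have e3 : (p⁻¹ + p) / 2 - (q⁻¹ + q) / 2 = (q - p) * (1 - p * q) / (2 * p * q) := by
    field_simp
    ring
  have e4 : (q⁻¹ + q) / 2 - (p⁻¹ + p) / 2 = -((q - p) * (1 - p * q) / (2 * p * q)) := by
    rw [← e3]
    ring
  rw [e3, e4]
  have e5 : 1 - p * q⁻¹ = (q - p) / q := by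
    field_simp
  rw [e5]
  constructor
  · field_simp
    ring
  · field_simp
    ring

theorem laplaceL_eq {ks km kl : ℂ} {f : (Fin n → ℝ) → ℂ} {y : Fin n → ℝ} (hy : y ∈ posChamber n)
    (hf : DifferentiableAt ℝ f y) :
    laplaceL (ks, km, kl) f y =
      ∑ i, (lineDeriv ℝ (fun z => lineDeriv ℝ f z (Pi.single i 1)) y (Pi.single i 1) +
        (radialCoeff ks kl (y i) + 2 * km * logDerivDenom y i) * lineDeriv ℝ f y (Pi.single i 1)) := by
  have hfd : ∀ v, lineDeriv ℝ f y v = fderiv ℝ f y v := fun v => hf.lineDeriv_eq_fderiv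
  have hcast : ∀ p : Fin n, (fun i => ((e p : Fin n → ℤ) i : ℝ)) = Pi.single p 1 := by
    intro p
    funext i
    simp [e, Pi.single_apply]
  have hadd : ∀ a b : Fin n → ℤ, (fun i => ((a + b) i : ℝ)) = (fun i => (a i : ℝ)) + fun i => (b i : ℝ) := by
    intro a b
    funext i
    simp
  have hsub : ∀ a b : Fin n → ℤ, (fun i => ((a - b) i : ℝ)) = (fun i => (a i : ℝ)) - fun i => (b i : ℝ) := by
    intro a b
    funext i
    simp
  set D : Fin n → ℂ := fun i => fderiv ℝ f y (Pi.single i 1) with hD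
  have hmem := mem_posChamber_iff.1 hy
  have hmid : ∑ a ∈ middleRoots n, mult (ks, km, kl) a *
      (((1 + Real.exp (-pairR y a)) / (1 - Real.exp (-pairR y a)) : ℝ) : ℂ) *
      lineDeriv ℝ f y (fun i => (a i : ℝ)) = ∑ i, 2 * km * logDerivDenom y i * D i := by
    rw [Finset.sum_congr rfl fun a ha => by rw [mult_middle _ ha], sum_middleRoots]
    let G : Fin n → Fin n → ℂ := fun i j =>
      2 * km * (Complex.sinh (y i) / (Complex.cosh (y i) - Complex.cosh (y j)) * D i +
          Complex.sinh (y j) / (Complex.cosh (y j) - Complex.cosh (y i)) * D j)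
    have h1 : ∀ q ∈ ltPairs n,
        (ks, km, kl).2.1 * (((1 + Real.exp (-pairR y (e q.1 - e q.2))) /
          (1 - Real.exp (-pairR y (e q.1 - e q.2))) : ℝ) : ℂ) *
          lineDeriv ℝ f y (fun i => ((e q.1 - e q.2) i : ℝ)) +
        (ks, km, kl).2.1 * (((1 + Real.exp (-pairR y (e q.1 + e q.2))) /
          (1 - Real.exp (-pairR y (e q.1 + e q.2))) : ℝ) : ℂ) *
          lineDeriv ℝ f y (fun i => ((e q.1 + e q.2) i : ℝ)) =
        G q.1 q.2 := by
      rintro ⟨i, j⟩ hq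
      have hij := mem_ltPairs.1 hq
      have hd := hmem.2 i j hij
      have n1 : 1 - Complex.exp (-((y i : ℂ) - y j)) ≠ 0 :=
        one_sub_exp_neg_ne_zero (by simpa using hd)
      have n2 : 1 - Complex.exp (-((y i : ℂ) + y j)) ≠ 0 :=
        one_sub_exp_neg_ne_zero (by simpa using add_pos (hmem.1 i) (hmem.1 j))
      obtain ⟨c1, c2⟩ := coth_half_add n1 n2
      simp only [hadd, hsub, hcast, hfd, map_add, map_sub, pairR_add, pairR_sub, pairR_e,
        ofReal_coth_half_eq, Complex.ofReal_add, Complex.ofReal_sub]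
      simp only [G]
      linear_combination km * D i * c1 + km * D j * c2
    rw [Finset.sum_congr rfl h1, sum_ltPairs G]
    have h2 : ∀ i : Fin n, logDerivDenom y i =
        ∑ j ∈ Finset.Iio i ∪ Finset.Ioi i,
          Complex.sinh (y i) / (Complex.cosh (y i) - Complex.cosh (y j)) := by
      intro i
      have : Finset.Iio i ∪ Finset.Ioi i = Finset.univ.erase i := by
        ext j
        simp [lt_or_lt_iff_ne]
      rw [this, Finset.sum_erase _ (by simp), logDerivDenom]
    have h3 : ∀ i : Fin n, Disjoint (Finset.Iio i) (Finset.Ioi i) := by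
      intro i
      rw [Finset.disjoint_left]
      intro j h h'
      exact lt_asymm (Finset.mem_Iio.1 h) (Finset.mem_Ioi.1 h')
    simp only [G, h2, Finset.sum_union (h3 _), Finset.sum_add_distrib, mul_add, add_mul, Finset.mul_sum,
      Finset.sum_mul]
    rw [add_comm]
    congr 1
    · rw [Finset.sum_sigma', Finset.sum_sigma']
      refine Finset.sum_bij' (fun x _ => ⟨x.2, x.1⟩) (fun x _ => ⟨x.2, x.1⟩) ?_ ?_ ?_ ?_ ?_
      all_goals simp
      intros
      ring
    · refine Finset.sum_congr rfl fun i _ => Finset.sum_congr rfl fun j _ => ?_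
      ring
  rw [laplaceL, sum_posRoots, hmid, ← add_assoc, ← Finset.sum_add_distrib, ← Finset.sum_add_distrib]
  refine Finset.sum_congr rfl fun p _ => ?_
  have e2 : Complex.exp (-((y p : ℂ) + y p)) = Complex.exp (-(y p : ℂ)) ^ 2 := by
    rw [← Complex.exp_nat_mul]
    congr 1
    push_cast
    ring
  simp only [mult_e, mult_e_add_self, hadd, hcast, hfd, map_add, pairR_add, pairR_e,
    ofReal_coth_half_eq, Complex.ofReal_add, e2, radialCoeff, hD]
  ring

theorem hasLineDerivAt_coord {H : ℂ → ℂ} {H' : ℂ} {y : Fin n → ℝ} {i : Fin n}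
    (h : HasDerivAt H H' (y i : ℂ)) :
    HasLineDerivAt ℝ (fun z : Fin n → ℝ => H (z i)) H' y (Pi.single i 1) := by
  have h1 : HasDerivAt (fun t : ℝ => H ((t : ℝ) : ℂ)) H' (y i + 0) := by
    rw [add_zero]
    exact h.comp_ofReal
  have h2 := h1.comp_const_add (y i) 0
  change HasDerivAt _ _ _
  convert! h2 using 2 with t
  simp

theorem hasLineDerivAt_coord_of_ne (H : ℂ → ℂ) (y : Fin n → ℝ) {i j : Fin n} (h : j ≠ i) :
    HasLineDerivAt ℝ (fun z : Fin n → ℝ => H (z j)) 0 y (Pi.single i 1) := by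
  change HasDerivAt _ _ _
  convert! hasDerivAt_const (0 : ℝ) (H (y j)) using 2 with t
  simp [h]

section LineDerivRules

variable {E : Type*} [NormedAddCommGroup E] [NormedSpace ℝ E] {f g : E → ℂ} {f' g' : ℂ} {x v : E}

theorem hasLineDerivAt_mul (hf : HasLineDerivAt ℝ f f' x v) (hg : HasLineDerivAt ℝ g g' x v) :
    HasLineDerivAt ℝ (fun z => f z * g z) (f' * g x + f x * g') x v := by
  have := HasDerivAt.mul (show HasDerivAt (fun t : ℝ => f (x + t • v)) f' 0 from hf)
    (show HasDerivAt (fun t : ℝ => g (x + t • v)) g' 0 from hg)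
  simp only [zero_smul, add_zero] at this
  exact this

theorem hasLineDerivAt_sub (hf : HasLineDerivAt ℝ f f' x v) (hg : HasLineDerivAt ℝ g g' x v) :
    HasLineDerivAt ℝ (fun z => f z - g z) (f' - g') x v :=
  HasDerivAt.sub (show HasDerivAt (fun t : ℝ => f (x + t • v)) f' 0 from hf)
    (show HasDerivAt (fun t : ℝ => g (x + t • v)) g' 0 from hg)

theorem hasLineDerivAt_div (hf : HasLineDerivAt ℝ f f' x v) (hg : HasLineDerivAt ℝ g g' x v)
    (h0 : g x ≠ 0) :
    HasLineDerivAt ℝ (fun z => f z / g z) ((f' * g x - f x * g') / g x ^ 2) x v := by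
  have := HasDerivAt.div (show HasDerivAt (fun t : ℝ => f (x + t • v)) f' 0 from hf)
    (show HasDerivAt (fun t : ℝ => g (x + t • v)) g' 0 from hg) (by simpa using h0)
  simp only [zero_smul, add_zero] at this
  exact this

end LineDerivRules

/-- The derivative of `logDerivDenom` along `e_i`. -/
noncomputable def logDerivDenom' (y : Fin n → ℝ) (i : Fin n) : ℂ :=
  ∑ j, (Complex.cosh (y i) / (Complex.cosh (y i) - Complex.cosh (y j)) -
    Complex.sinh (y i) ^ 2 / (Complex.cosh (y i) - Complex.cosh (y j)) ^ 2)

theorem cosh_injOn_posChamber {y : Fin n → ℝ} (hy : y ∈ posChamber n) {i j : Fin n} (h : i ≠ j) :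
    Complex.cosh (y i) - Complex.cosh (y j) ≠ 0 := by
  obtain ⟨h1, h2⟩ := mem_posChamber_iff.1 hy
  have key : ∀ i j : Fin n, i < j → Real.cosh (y j) < Real.cosh (y i) := by
    intro i j hij
    rw [Real.cosh_lt_cosh, abs_of_pos (h1 i), abs_of_pos (h1 j)]
    exact h2 i j hij
  rw [← Complex.ofReal_cosh, ← Complex.ofReal_cosh, ← Complex.ofReal_sub, Complex.ofReal_ne_zero,
    sub_ne_zero]
  rcases lt_or_gt_of_ne h with h | h
  · exact (key i j h).ne'
  · exact (key j i h).ne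

theorem hasLineDerivAt_logDerivDenom {y : Fin n → ℝ} (hy : y ∈ posChamber n) (i : Fin n) :
    HasLineDerivAt ℝ (fun z => logDerivDenom z i) (logDerivDenom' y i) y (Pi.single i 1) := by
  have h : ∀ j ∈ Finset.univ, HasDerivAt (fun t : ℝ => (fun z : Fin n → ℝ =>
      Complex.sinh (z i) / (Complex.cosh (z i) - Complex.cosh (z j))) (y + t • Pi.single i 1))
      (Complex.cosh (y i) / (Complex.cosh (y i) - Complex.cosh (y j)) -
    Complex.sinh (y i) ^ 2 / (Complex.cosh (y i) - Complex.cosh (y j)) ^ 2) 0 := by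
    intro j _
    by_cases hij : j = i
    · subst hij
      simp only [sub_self, div_zero, ne_eq, OfNat.ofNat_ne_zero, not_false_eq_true, zero_pow]
      exact hasDerivAt_const _ _
    · have hne := cosh_injOn_posChamber hy (Ne.symm hij)
      have h1 := hasLineDerivAt_div (hasLineDerivAt_coord (Complex.hasDerivAt_sinh (y i)))
        (hasLineDerivAt_sub (hasLineDerivAt_coord (Complex.hasDerivAt_cosh (y i)))
          (hasLineDerivAt_coord_of_ne Complex.cosh y hij)) hne
      have e1 : Complex.cosh (y i) / (Complex.cosh (y i) - Complex.cosh (y j)) -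
          Complex.sinh (y i) ^ 2 / (Complex.cosh (y i) - Complex.cosh (y j)) ^ 2 =
          (Complex.cosh (y i) * (Complex.cosh (y i) - Complex.cosh (y j)) -
          Complex.sinh (y i) * (Complex.sinh (y i) - 0)) /
          (Complex.cosh (y i) - Complex.cosh (y j)) ^ 2 := by
        generalize Complex.cosh (y i) - Complex.cosh (y j) = d at *
        field_simp
        ring
      rw [e1]
      exact h1
  exact HasDerivAt.fun_sum h

theorem laplaceL_hcProd_div {ks km kl : ℂ} {lam : Fin n → ℂ} (hlam : ∀ i, lam i ∈ regularSet)
    {D : (Fin n → ℝ) → ℂ} (hD : ∀ y ∈ posChamber n, DifferentiableAt ℝ D y)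
    (hD0 : ∀ y ∈ posChamber n, D y ≠ 0)
    (hDi : ∀ y ∈ posChamber n, ∀ i,
      HasLineDerivAt ℝ D (km * logDerivDenom y i * D y) y (Pi.single i 1))
    {y : Fin n → ℝ} (hy : y ∈ posChamber n) :
    laplaceL (ks, km, kl) (fun y => hcProd ks kl lam y / D y) y =
      (∑ i, (lam i ^ 2 - rho₁ ks kl ^ 2 - (km * logDerivDenom' y i + (km * logDerivDenom y i) ^ 2 +
        km * (radialCoeff ks kl (y i) * logDerivDenom y i)))) * (hcProd ks kl lam y / D y) := by
  have hpos : ∀ z ∈ posChamber n, ∀ i, 0 < ((z i : ℝ) : ℂ).re := fun z hz i => by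
    simpa using (mem_posChamber_iff.1 hz).1 i
  have hdiff : DifferentiableAt ℝ (fun y => hcProd ks kl lam y / D y) y := by
    simp only [div_eq_mul_inv]
    refine DifferentiableAt.fun_mul ?_ ((hD y hy).fun_inv (hD0 y hy))
    refine (HasFDerivAt.finsetProd fun i _ => DifferentiableAt.hasFDerivAt ?_).differentiableAt
    obtain ⟨f₁, f₂, hf, -⟩ := hcPhi_ode ks kl (hlam i)
    have h1 := ((hf _ (hpos y hy i)).1.comp_ofReal).differentiableAt
    exact DifferentiableAt.comp (g := fun x : ℝ => hcPhi ks kl (lam i) x)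
      (f := fun z : Fin n → ℝ => z i) y h1 (by fun_prop)
  rw [laplaceL_eq hy hdiff, Finset.sum_mul]
  refine Finset.sum_congr rfl fun i _ => ?_
  obtain ⟨f₁, f₂, hf, -⟩ := hcPhi_ode ks kl (hlam i)
  let P : (Fin n → ℝ) → ℂ := fun z => ∏ j ∈ Finset.univ.erase i, hcPhi ks kl (lam j) (z j)
  have hP : ∀ z, HasLineDerivAt ℝ P 0 z (Pi.single i 1) := by
    intro z
    change HasDerivAt _ _ _
    convert! hasDerivAt_const (0 : ℝ) (P z) using 2 with t
    refine Finset.prod_congr rfl fun j hj => ?_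
    simp [Finset.ne_of_mem_erase hj]
  have hu : ∀ z, hcProd ks kl lam z = hcPhi ks kl (lam i) (z i) * P z := fun z =>
    (Finset.mul_prod_erase _ _ (Finset.mem_univ i)).symm
  have hline : ∀ z ∈ posChamber n,
      HasLineDerivAt ℝ (fun y => hcProd ks kl lam y / D y)
        ((f₁ (z i) * P z - km * logDerivDenom z i * (hcPhi ks kl (lam i) (z i) * P z)) / D z) z
        (Pi.single i 1) := by
    intro z hz
    have h1 := hasLineDerivAt_div (hasLineDerivAt_mul
      (hasLineDerivAt_coord (hf _ (hpos z hz i)).1) (hP z)) (hDi z hz i) (hD0 z hz)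
    simp only [hu]
    convert! h1 using 1
    have := hD0 z hz
    field_simp
    ring
  have h2 : lineDeriv ℝ (fun z => lineDeriv ℝ (fun y => hcProd ks kl lam y / D y) z (Pi.single i 1)) y
      (Pi.single i 1) = lineDeriv ℝ (fun z => (f₁ (z i) * P z - km * logDerivDenom z i *
        (hcPhi ks kl (lam i) (z i) * P z)) / D z) y (Pi.single i 1) := by
    refine Filter.EventuallyEq.lineDeriv_eq ?_
    filter_upwards [isOpen_posChamber.mem_nhds hy] with z hz using (hline z hz).lineDeriv
  have hconst : HasLineDerivAt ℝ (fun _ : Fin n → ℝ => km) 0 y (Pi.single i 1) :=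
    hasDerivAt_const _ _
  obtain ⟨o1, o2, o3⟩ := hf _ (hpos y hy i)
  have h3 := hasLineDerivAt_div (hasLineDerivAt_sub
    (hasLineDerivAt_mul (hasLineDerivAt_coord o2) (hP y))
    (hasLineDerivAt_mul (hasLineDerivAt_mul hconst (hasLineDerivAt_logDerivDenom hy i))
      (hasLineDerivAt_mul (hasLineDerivAt_coord o1) (hP y)))) (hDi y hy i) (hD0 y hy)
  rw [h2, h3.lineDeriv, (hline y hy).lineDeriv, hu]
  have := hD0 y hy
  generalize D y = d at *
  generalize radialCoeff ks kl (y i) = r at *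
  have e1 : f₂ (y i) = (lam i ^ 2 - rho₁ ks kl ^ 2) * hcPhi ks kl (lam i) (y i) - r * f₁ (y i) := by
    linear_combination o3
  rw [e1]
  field_simp
  ring

end Laplacian

/-! ### Existence of Harish-Chandra series for `k_m = 0` and `k_m = 1` -/

section HCExists

variable {n : ℕ}

theorem middleDenominator_eq_cosh (y : Fin n → ℝ) : (middleDenominator n y : ℂ) =
    ∏ q ∈ ltPairs n, (2 * (Complex.cosh (y q.1) - Complex.cosh (y q.2))) := by
  change ((∏ a ∈ middleRoots n, _ : ℝ) : ℂ) = _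
  rw [prod_middleRoots, Complex.ofReal_prod]
  refine Finset.prod_congr rfl fun q _ => ?_
  have h : ∀ x : ℝ, Real.exp (x / 2) - Real.exp (-(x / 2)) = 2 * Real.sinh (x / 2) := fun x => by
    rw [Real.sinh_eq]
    ring
  rw [h, h, pairR_sub, pairR_add, pairR_e, pairR_e, ← Complex.ofReal_cosh, ← Complex.ofReal_cosh]
  norm_cast
  have e1 : y q.1 = (y q.1 - y q.2) / 2 + (y q.1 + y q.2) / 2 := by ring
  have e2 : y q.2 = (y q.1 + y q.2) / 2 - (y q.1 - y q.2) / 2 := by ring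
  have c1 : Real.cosh (y q.1) = Real.cosh ((y q.1 - y q.2) / 2 + (y q.1 + y q.2) / 2) := by
    rw [← e1]
  have c2 : Real.cosh (y q.2) = Real.cosh ((y q.1 + y q.2) / 2 - (y q.1 - y q.2) / 2) := by
    rw [← e2]
  rw [c1, c2, Real.cosh_add, Real.cosh_sub]
  ring

theorem middleDenominator_pos {y : Fin n → ℝ} (hy : y ∈ posChamber n) :
    0 < middleDenominator n y := by
  refine Finset.prod_pos fun a ha => sub_pos.2 (Real.exp_lt_exp.2 ?_)
  have := hy a (Finset.mem_filter.1 ha).1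
  linarith

theorem differentiable_middleDenominator :
    Differentiable ℝ (fun y : Fin n → ℝ => (middleDenominator n y : ℂ)) := by
  have : Differentiable ℝ (middleDenominator n) := by
    intro y
    refine (HasFDerivAt.finsetProd fun a _ => DifferentiableAt.hasFDerivAt ?_).differentiableAt
    simp only [← pairRL_apply]
    fun_prop
  exact Complex.ofRealCLM.differentiable.comp this

theorem hasLineDerivAt_middleDenominator {y : Fin n → ℝ} (hy : y ∈ posChamber n) (i : Fin n) :
    HasLineDerivAt ℝ (fun y : Fin n → ℝ => (middleDenominator n y : ℂ))
      (logDerivDenom y i * (middleDenominator n y : ℂ)) y (Pi.single i 1) := by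
  let F : Fin n × Fin n → (Fin n → ℝ) → ℂ := fun q z =>
    2 * (Complex.cosh (z q.1) - Complex.cosh (z q.2))
  let A : Fin n → ℂ := fun j => Complex.sinh (y i) / (Complex.cosh (y i) - Complex.cosh (y j))
  let B : Fin n → Fin n → ℂ := fun a b => (if a = i then A b else 0) + if b = i then A a else 0
  have hF0 : ∀ q ∈ ltPairs n, F q y ≠ 0 := fun q hq =>
    mul_ne_zero two_ne_zero (cosh_injOn_posChamber hy (mem_ltPairs.1 hq).ne)
  have hF : ∀ q ∈ ltPairs n, HasLineDerivAt ℝ (F q) (B q.1 q.2 * F q y) y (Pi.single i 1) := by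
    rintro ⟨a, b⟩ hq
    have hab := (mem_ltPairs.1 hq).ne
    have hc : HasLineDerivAt ℝ (fun _ : Fin n → ℝ => (2 : ℂ)) 0 y (Pi.single i 1) :=
      hasDerivAt_const _ _
    have hne := cosh_injOn_posChamber hy hab
    by_cases ha : a = i
    · have hb : b ≠ i := fun hb => hab (ha.trans hb.symm)
      subst ha
      have h1 := hasLineDerivAt_mul hc (hasLineDerivAt_sub
        (hasLineDerivAt_coord (Complex.hasDerivAt_cosh (y a)))
          (hasLineDerivAt_coord_of_ne Complex.cosh y hb))
      have e1 : B a b * F (a, b) y = 0 * (Complex.cosh (y a) - Complex.cosh (y b)) +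
          2 * (Complex.sinh (y a) - 0) := by
        simp only [B, F, A, if_true, if_neg hb]
        field_simp
        ring
      change HasLineDerivAt ℝ (F (a, b)) (B a b * F (a, b) y) y _
      rw [e1]
      exact h1
    · by_cases hb : b = i
      · subst hb
        have h1 := hasLineDerivAt_mul hc (hasLineDerivAt_sub
          (hasLineDerivAt_coord_of_ne Complex.cosh y ha)
          (hasLineDerivAt_coord (Complex.hasDerivAt_cosh (y b))))
        have e1 : B a b * F (a, b) y = 0 * (Complex.cosh (y a) - Complex.cosh (y b)) +
            2 * (0 - Complex.sinh (y b)) := by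
          simp only [B, F, A, if_true, if_neg ha]
          rw [← neg_sub (Complex.cosh (y a)), div_neg]
          field_simp
          ring
        change HasLineDerivAt ℝ (F (a, b)) (B a b * F (a, b) y) y _
        rw [e1]
        exact h1
      · have h1 := hasLineDerivAt_mul hc (hasLineDerivAt_sub
          (hasLineDerivAt_coord_of_ne Complex.cosh y ha)
          (hasLineDerivAt_coord_of_ne Complex.cosh y hb))
        have e1 : B a b * F (a, b) y = 0 * (Complex.cosh (y a) - Complex.cosh (y b)) +
            2 * (0 - 0) := by
          simp [B, ha, hb]
        change HasLineDerivAt ℝ (F (a, b)) (B a b * F (a, b) y) y _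
        rw [e1]
        exact h1
  have hB : ∑ q ∈ ltPairs n, B q.1 q.2 = logDerivDenom y i := by
    have h3 : Disjoint (Finset.Iio i) (Finset.Ioi i) := by
      rw [Finset.disjoint_left]
      intro j h h'
      exact lt_asymm (Finset.mem_Iio.1 h) (Finset.mem_Ioi.1 h')
    have h2 : logDerivDenom y i = ∑ j ∈ Finset.Iio i ∪ Finset.Ioi i, A j := by
      have : Finset.Iio i ∪ Finset.Ioi i = Finset.univ.erase i := by
        ext j
        simp [lt_or_lt_iff_ne]
      rw [this, Finset.sum_erase _ (by simp [A]), logDerivDenom]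
    rw [h2, Finset.sum_union h3, sum_ltPairs B, add_comm]
    simp only [B, Finset.sum_add_distrib]
    congr 1
    · rw [Finset.sum_eq_single i (fun a _ ha => by simp [ha]) (by simp)]
      simp
    · simp only [Finset.sum_ite_eq', Finset.mem_Ioi]
      rw [← Finset.sum_filter]
      congr 1
      ext j
      simp
  have key : ∀ s : Finset (Fin n × Fin n), s ⊆ ltPairs n →
      HasLineDerivAt ℝ (fun z => ∏ q ∈ s, F q z) ((∑ q ∈ s, B q.1 q.2) * ∏ q ∈ s, F q y) y
        (Pi.single i 1) := by
    intro s
    induction s using Finset.induction_on with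
    | empty =>
      intro _
      simp only [Finset.prod_empty, Finset.sum_empty, zero_mul]
      exact hasDerivAt_const _ _
    | insert q s hq ih =>
      intro hs
      simp only [Finset.prod_insert hq, Finset.sum_insert hq]
      have := hasLineDerivAt_mul (hF q (hs (Finset.mem_insert_self q s)))
        (ih ((Finset.subset_insert q s).trans hs))
      convert! this using 1
      ring
  have := key _ (Finset.Subset.refl _)
  rw [hB] at this
  simp only [middleDenominator_eq_cosh]
  exact this

section RationalIdentity

variable {x : Fin n → ℂ}

theorem sum_sum_inv_sub : ∑ i, ∑ j, (x i - x j)⁻¹ = 0 := by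
  have h : ∑ i, ∑ j, (x i - x j)⁻¹ = -∑ i, ∑ j, (x i - x j)⁻¹ := by
    conv_lhs => rw [Finset.sum_comm]
    simp only [← Finset.sum_neg_distrib]
    refine Finset.sum_congr rfl fun i _ => Finset.sum_congr rfl fun j _ => ?_
    rw [← inv_neg, neg_sub]
  exact self_eq_neg.1 h

theorem sum_sum_mul_inv_sub (hx : Function.Injective x) :
    2 * ∑ i, ∑ j, x i * (x i - x j)⁻¹ = n * (n - 1) := by
  have h : ∑ i, ∑ j, x i * (x i - x j)⁻¹ = ∑ i, ∑ j, x j * (x j - x i)⁻¹ := Finset.sum_comm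
  have h2 : 2 * ∑ i, ∑ j, x i * (x i - x j)⁻¹ = ∑ i : Fin n, ∑ j : Fin n, (1 - if i = j then 1 else 0) := by
    rw [two_mul]
    nth_rewrite 2 [h]
    simp only [← Finset.sum_add_distrib]
    refine Finset.sum_congr rfl fun i _ => Finset.sum_congr rfl fun j _ => ?_
    split_ifs with hij
    · simp [hij]
    · have : x i - x j ≠ 0 := sub_ne_zero.2 fun h => hij (hx h)
      rw [← neg_sub (x i) (x j), inv_neg]
      field_simp
      ring
  rw [h2]
  simp only [Finset.sum_sub_distrib, Finset.sum_const, Finset.card_univ, Fintype.card_fin,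
    Finset.sum_ite_eq, Finset.mem_univ, if_true, nsmul_eq_mul, mul_one]
  ring

theorem sum_sum_sum_inv_sub (hx : Function.Injective x) :
    (3 : ℂ) * ∑ i, (x i ^ 2 - 1) * ((∑ j, (x i - x j)⁻¹) ^ 2 - ∑ j, (x i - x j)⁻¹ ^ 2) =
      (n : ℂ) * (n - 1) * (n - 2) := by
  let w : Fin n → Fin n → Fin n → ℂ := fun i j k =>
    (x i ^ 2 - 1) * ((x i - x j)⁻¹ * (x i - x k)⁻¹ - if j = k then (x i - x j)⁻¹ ^ 2 else 0)
  have h0 : ∑ i, (x i ^ 2 - 1) * ((∑ j, (x i - x j)⁻¹) ^ 2 - ∑ j, (x i - x j)⁻¹ ^ 2) =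
      ∑ i, ∑ j, ∑ k, w i j k := by
    refine Finset.sum_congr rfl fun i _ => ?_
    simp only [w, ← Finset.mul_sum, Finset.sum_sub_distrib, Finset.sum_ite_eq, Finset.mem_univ,
      if_true]
    rw [sq (∑ j, _), Finset.sum_mul]
  have h1 : ∑ i, ∑ j, ∑ k, w i j k = ∑ i, ∑ j, ∑ k, w j k i := by
    conv_rhs => rw [Finset.sum_comm]
    exact Finset.sum_congr rfl fun j _ => Finset.sum_comm
  have h2 : ∑ i, ∑ j, ∑ k, w i j k = ∑ i, ∑ j, ∑ k, w k i j := by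
    conv_rhs => rw [Finset.sum_congr rfl fun i _ => Finset.sum_comm, Finset.sum_comm]
  have h3 : ∀ i j k, w i j k + w j k i + w k i j = 1 - (if i = j then 1 else 0) -
      (if j = k then 1 else 0) - (if i = k then 1 else 0) +
      2 * ((if i = j then 1 else 0) * if j = k then 1 else 0) := by
    intro i j k
    simp only [w]
    by_cases hij : i = j
    · subst hij
      by_cases hik : i = k
      · subst hik
        norm_num
      · simp [hik, Ne.symm hik, sq]
    · by_cases hjk : j = k
      · subst hjk
        simp [hij, Ne.symm hij, sq]
      · by_cases hik : i = k
        · subst hik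
          simp [hij, Ne.symm hij, sq]
        · have a1 : x i - x j ≠ 0 := sub_ne_zero.2 fun h => hij (hx h)
          have a2 : x j - x k ≠ 0 := sub_ne_zero.2 fun h => hjk (hx h)
          have a3 : x i - x k ≠ 0 := sub_ne_zero.2 fun h => hik (hx h)
          simp only [hij, hjk, hik, Ne.symm hik, if_false, sub_zero, mul_zero, add_zero]
          rw [← neg_sub (x i) (x j), ← neg_sub (x i) (x k), ← neg_sub (x j) (x k), inv_neg, inv_neg,
            inv_neg]
          field_simp
          ring
  have h4 : 3 * ∑ i, ∑ j, ∑ k, w i j k = ∑ i : Fin n, ∑ j : Fin n, ∑ k : Fin n,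
      (1 - (if i = j then 1 else 0) -
      (if j = k then 1 else 0) - (if i = k then 1 else 0) +
      2 * ((if i = j then 1 else 0) * if j = k then 1 else 0)) := by
    simp only [← h3, Finset.sum_add_distrib]
    rw [← h1, ← h2]
    ring
  rw [h0, h4]
  simp only [Finset.sum_add_distrib, Finset.sum_sub_distrib, Finset.sum_const, Finset.card_univ,
    Fintype.card_fin, Finset.sum_ite_eq, Finset.mem_univ, if_true, nsmul_eq_mul, mul_one,
    ← Finset.mul_sum]
  ring

end RationalIdentity

theorem sum_rho_one_sq (ks kl : ℂ) :
    ∑ i, (rho n (ks, 1, kl) i ^ 2 - rho₁ ks kl ^ 2) =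
      (1 + ks + 2 * kl) * (n * (n - 1) / 2) + n * (n - 1) * (n - 2) / 3 := by
  simp only [rho_apply]
  rw [← Finset.sum_range (fun i => (rho₁ ks kl + 1 * ((n - 1 - i : ℕ) : ℂ)) ^ 2 - rho₁ ks kl ^ 2),
    Finset.sum_range_reflect (fun m : ℕ => (rho₁ ks kl + 1 * (m : ℂ)) ^ 2 - rho₁ ks kl ^ 2)]
  have : ∀ n : ℕ, ∑ m ∈ Finset.range n, ((rho₁ ks kl + 1 * (m : ℂ)) ^ 2 - rho₁ ks kl ^ 2) =
      (1 + ks + 2 * kl) * (n * (n - 1) / 2) + n * (n - 1) * (n - 2) / 3 := by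
    intro n
    induction n with
    | zero => simp
    | succ n ih =>
      rw [Finset.sum_range_succ, ih, rho₁]
      push_cast
      ring
  exact this n

theorem sum_logDerivDenom (ks kl : ℂ) {y : Fin n → ℝ} (hy : y ∈ posChamber n) :
    ∑ i, (logDerivDenom' y i + logDerivDenom y i ^ 2 +
      radialCoeff ks kl (y i) * logDerivDenom y i) =
    ∑ i, (rho n (ks, 1, kl) i ^ 2 - rho₁ ks kl ^ 2) := by
  have hx : Function.Injective fun i => Complex.cosh (y i) := by
    intro i j h
    by_contra hij
    exact cosh_injOn_posChamber hy hij (sub_eq_zero.2 h)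
  have h1 := sum_sum_inv_sub (x := fun i => Complex.cosh (y i))
  have h2 := sum_sum_mul_inv_sub hx
  have h3 := sum_sum_sum_inv_sub hx
  rw [sum_rho_one_sq]
  have h4 : ∀ i, logDerivDenom' y i + logDerivDenom y i ^ 2 +
      radialCoeff ks kl (y i) * logDerivDenom y i =
      (Complex.cosh (y i) ^ 2 - 1) * ((∑ j, (Complex.cosh (y i) - Complex.cosh (y j))⁻¹) ^ 2 -
        ∑ j, (Complex.cosh (y i) - Complex.cosh (y j))⁻¹ ^ 2) +
      (1 + ks + 2 * kl) * ∑ j, Complex.cosh (y i) * (Complex.cosh (y i) - Complex.cosh (y j))⁻¹ +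
      ks * ∑ j, (Complex.cosh (y i) - Complex.cosh (y j))⁻¹ := by
    intro i
    have hr := radialCoeff_mul_sinh ks kl (y := (y i : ℂ))
      (by simpa using (mem_posChamber_iff.1 hy).1 i)
    have e1 : logDerivDenom y i =
        Complex.sinh (y i) * ∑ j, (Complex.cosh (y i) - Complex.cosh (y j))⁻¹ := by
      simp only [logDerivDenom, div_eq_mul_inv, Finset.mul_sum]
    have e2 : logDerivDenom' y i =
        Complex.cosh (y i) * ∑ j, (Complex.cosh (y i) - Complex.cosh (y j))⁻¹ -
        Complex.sinh (y i) ^ 2 * ∑ j, (Complex.cosh (y i) - Complex.cosh (y j))⁻¹ ^ 2 := by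
      simp only [logDerivDenom', div_eq_mul_inv, Finset.mul_sum, ← Finset.sum_sub_distrib, inv_pow]
    rw [e1, e2, ← Finset.mul_sum]
    linear_combination (∑ j, (Complex.cosh (y i) - Complex.cosh (y j))⁻¹) * hr +
      ((∑ j, (Complex.cosh (y i) - Complex.cosh (y j))⁻¹) ^ 2 -
        ∑ j, (Complex.cosh (y i) - Complex.cosh (y j))⁻¹ ^ 2) * Complex.sinh_sq (y i)
  simp only [h4, Finset.sum_add_distrib, ← Finset.mul_sum]
  simp only [← Finset.mul_sum] at h2
  rw [h1]
  linear_combination (1 / 3) * h3 + (1 + ks + 2 * kl) / 2 * h2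

theorem isHarishChandraSeries_zero (ks kl : ℂ) {lam : Fin n → ℂ} (hlam : ∀ i, lam i ∈ regularSet) :
    IsHarishChandraSeries (ks, 0, kl) lam (hcProd ks kl lam) := by
  refine ⟨exists_expansion_hcProd ks kl hlam, fun y hy => ?_⟩
  have h := laplaceL_hcProd_div (km := 0) (ks := ks) (kl := kl) hlam (D := fun _ => 1)
    (fun _ _ => differentiableAt_const _) (fun _ _ => one_ne_zero)
    (fun y _ i => by
      rw [zero_mul, zero_mul]
      exact hasDerivAt_const _ _) hy
  simp only [div_one, zero_mul, add_zero, sub_zero, Finset.sum_sub_distrib, ne_eq,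
    OfNat.ofNat_ne_zero, not_false_eq_true, zero_pow] at h
  simp only [rho_apply, zero_mul, add_zero]
  exact h

theorem isHarishChandraSeries_one (ks kl : ℂ) {lam : Fin n → ℂ} (hlam : ∀ i, lam i ∈ regularSet) :
    IsHarishChandraSeries (ks, 1, kl) lam
      (fun y => hcProd ks kl lam y / (middleDenominator n y : ℂ)) := by
  refine ⟨exists_expansion_hcProd_div ks kl hlam, fun y hy => ?_⟩
  have h := laplaceL_hcProd_div (km := 1) (ks := ks) (kl := kl) hlam
    (D := fun y => (middleDenominator n y : ℂ))
    (fun y _ => differentiable_middleDenominator y)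
    (fun y hy => by exact_mod_cast (middleDenominator_pos hy).ne')
    (fun y hy i => by
      rw [one_mul]
      exact hasLineDerivAt_middleDenominator hy i) hy
  rw [h]
  congr 1
  have e := sum_logDerivDenom ks kl hy
  simp only [one_mul]
  rw [Finset.sum_sub_distrib, e, ← Finset.sum_sub_distrib, ← Finset.sum_sub_distrib]
  refine Finset.sum_congr rfl fun i _ => ?_
  ring

end HCExists

/-! ### The hypergeometric function for `k_m = 0` and `k_m = 1` -/

section Hypergeometric

variable {n : ℕ}

theorem IsHypergeometricFunction.unique {k : Multiplicity} {F G : (Fin n → ℂ) → (Fin n → ℝ) → ℂ}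
    (hF : IsHypergeometricFunction n k F) (hG : IsHypergeometricFunction n k G) : G = F := by
  obtain ⟨c, hc, -, hcs⟩ := hF.eq_sum
  obtain ⟨d, hd, -, hds⟩ := hG.eq_sum
  obtain rfl := hc.unique hd
  have h1 : ∀ y ∈ posChamber n, (fun lam => G lam y) = fun lam => F lam y := by
    intro y hy
    refine Continuous.ext_on (dense_generic k) (hG.holomorphic y).continuous
      (hF.holomorphic y).continuous fun lam hlam => ?_
    obtain ⟨Phi, hPhi, e1⟩ := hcs lam hlam
    obtain ⟨Psi, hPsi, e2⟩ := hds lam hlam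
    rw [e1 y hy, e2 y hy]
    exact Finset.sum_congr rfl fun w _ => by rw [(hPsi w).eqOn (hlam w).1 (hPhi w) hy]
  funext lam
  obtain ⟨y0, hy0⟩ := posChamber_nonempty (n := n)
  refine (hG.analytic lam).eq_of_eventuallyEq (hF.analytic lam) (z₀ := y0) ?_
  filter_upwards [isOpen_posChamber.mem_nhds hy0] with y hy using congrFun (h1 y hy) lam

theorem ne_of_generic {k : Multiplicity} {v : Fin n → ℂ}
    (h : ∀ w : Weyl n, IsGeneric (weylAct w v) ∧ NoPole (weylAct w v) k) (p : Fin n) :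
    (∀ m : ℕ, v p + k.1 / 2 ≠ -(m : ℂ)) ∧ ∀ m : ℕ, -v p + k.1 / 2 ≠ -(m : ℂ) := by
  have h1 := ((noPole_iff _ _).1 (h (1, fun _ => 1)).2).2.1 p
  have h2 := ((noPole_iff _ _).1 (h (1, fun _ => -1)).2).2.1 p
  simp only [weylAct] at h1 h2
  constructor
  · simpa using h1
  · simpa using h2

theorem sum_weyl_eq {ks kl : ℂ} (hc : ∀ m : ℕ, ks + kl + 1 / 2 ≠ -(m : ℂ)) {lam : Fin n → ℂ}
    (hlam : ∀ p, lam p ∈ regularSet) (h1 : ∀ p, ∀ m : ℕ, lam p + ks / 2 ≠ -(m : ℂ))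
    (h2 : ∀ p, ∀ m : ℕ, -lam p + ks / 2 ≠ -(m : ℂ)) {y : Fin n → ℝ} (hy : y ∈ posChamber n)
    (s : Equiv.Perm (Fin n) → ℂ) :
    ∑ w : Weyl n, s w.1 * ((∏ p, cTilde₁ ks kl (weylAct w lam p)) * hcProd ks kl (weylAct w lam) y) =
      cRho₁ ks kl ^ n * ∑ σ : Equiv.Perm (Fin n), s σ * ∏ i, phi₁ ks kl (lam (σ i)) (y i) := by
  rw [Fintype.sum_prod_type, Finset.mul_sum]
  refine Finset.sum_congr rfl fun σ _ => ?_
  dsimp only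
  rw [← Finset.mul_sum, mul_left_comm]
  congr 1
  simp only [hcProd, ← Finset.prod_mul_distrib, weylAct]
  have := Finset.prod_univ_sum (fun _ : Fin n => (Finset.univ : Finset ℤˣ))
    (fun i (ε : ℤˣ) => cTilde₁ ks kl (((ε : ℤ) : ℂ) * lam (σ i)) *
      hcPhi ks kl (((ε : ℤ) : ℂ) * lam (σ i)) (y i))
  rw [Fintype.piFinset_univ] at this
  rw [← this]
  have hn : cRho₁ ks kl ^ n = ∏ _i : Fin n, cRho₁ ks kl := by simp
  rw [hn, ← Finset.prod_mul_distrib]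
  refine Finset.prod_congr rfl fun i _ => ?_
  rw [phi₁_eq_cTilde₁ hc (hlam (σ i)) (h1 (σ i)) (h2 (σ i)) ((mem_posChamber_iff.1 hy).1 i),
    UnitsInt.univ, Finset.sum_pair (by decide)]
  simp

theorem weylAct_mem_regularSet {lam : Fin n → ℂ} (hlam : ∀ p, lam p ∈ regularSet) (w : Weyl n)
    (p : Fin n) : weylAct w lam p ∈ regularSet := by
  rcases Int.units_eq_one_or (w.2 p) with h | h
  · simpa [weylAct, h] using hlam (w.1 p)
  · simpa [weylAct, h] using neg_mem_regularSet (hlam (w.1 p))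

theorem cTilde_zero {ks kl : ℂ} {v : Fin n → ℂ} (hv : NoPole v (ks, 0, kl)) :
    cTilde v (ks, 0, kl) = ∏ p, cTilde₁ ks kl (v p) := by
  rw [cTilde_eq, Finset.prod_eq_one (s := middleRoots n), mul_one]
  intro a ha
  simp only [add_zero]
  refine div_self (Complex.Gamma_ne_zero fun m => ?_)
  rw [← cArg_middle v (ks, 0, kl) ha]
  exact hv a (mem_posRoots_of_mem_middleRoots ha) m

/-- The product `∏_{i < j} (v_i² - v_j²)`. -/
noncomputable def sqVandermonde (v : Fin n → ℂ) : ℂ := ∏ i, ∏ j ∈ Finset.Ioi i, (v i ^ 2 - v j ^ 2)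

theorem prod_middleRoots_pairC (v : Fin n → ℂ) : ∏ a ∈ middleRoots n, pairC v a = sqVandermonde v := by
  rw [prod_middleRoots, sqVandermonde, ← prod_ltPairs (fun i j => v i ^ 2 - v j ^ 2)]
  refine Finset.prod_congr rfl fun q _ => ?_
  rw [pairC_sub, pairC_add, pairC_e, pairC_e]
  ring

theorem sqVandermonde_eq_det (v : Fin n → ℂ) :
    sqVandermonde v = (Matrix.vandermonde fun i => -v i ^ 2).det := by
  rw [Matrix.det_vandermonde, sqVandermonde]
  refine Finset.prod_congr rfl fun i _ => Finset.prod_congr rfl fun j _ => ?_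
  ring

theorem sqVandermonde_weylAct (w : Weyl n) (v : Fin n → ℂ) :
    sqVandermonde (weylAct w v) = ((Equiv.Perm.sign w.1 : ℤ) : ℂ) * sqVandermonde v := by
  rw [sqVandermonde_eq_det, sqVandermonde_eq_det, ← Matrix.det_permute]
  congr 1
  ext i j
  rcases Int.units_eq_one_or (w.2 i) with h | h <;> simp [Matrix.vandermonde, weylAct, h]

theorem cTilde_one {ks kl : ℂ} {v : Fin n → ℂ} (hv : NoPole v (ks, 1, kl)) :
    cTilde v (ks, 1, kl) = (sqVandermonde v)⁻¹ * ∏ p, cTilde₁ ks kl (v p) := by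
  rw [cTilde_eq, mul_comm, ← prod_middleRoots_pairC, ← Finset.prod_inv_distrib]
  congr 1
  refine Finset.prod_congr rfl fun a ha => ?_
  have h := hv a (mem_posRoots_of_mem_middleRoots ha)
  rw [cArg_middle v (ks, 1, kl) ha] at h
  have h0 : pairC v a ≠ 0 := by simpa using h 0
  have h1 := Complex.Gamma_ne_zero h
  dsimp only
  rw [Complex.Gamma_add_one _ h0]
  generalize Complex.Gamma (pairC v a) = G at *
  field_simp

theorem analyticAt_phi₁_left (ks kl l : ℂ) (y : ℝ) : AnalyticAt ℂ (fun l => phi₁ ks kl l y) l :=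
  (analyticAt_phi₁ ks kl l (ofReal_mem_tubeDomain y)).curry_left

theorem isHypergeometricFunction_permanent (hn : 2 ≤ n) {ks kl : ℂ}
    (hc : ∀ m : ℕ, ks + kl + 1 / 2 ≠ -(m : ℂ)) :
    IsHypergeometricFunction n (ks, 0, kl) (fun lam y =>
      1 / (n.factorial : ℂ) * (Matrix.of fun i j : Fin n => phi₁ ks kl (lam i) (y j)).permanent) where
  holomorphic y := by
    intro lam
    simp only [Matrix.permanent, Matrix.of_apply]
    refine (DifferentiableAt.fun_sum fun σ _ => ?_).const_mul _
    refine (HasFDerivAt.finsetProd fun i _ => DifferentiableAt.hasFDerivAt ?_).differentiableAt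
    exact DifferentiableAt.comp (g := fun l => phi₁ ks kl l (y i))
      (f := fun z : Fin n → ℂ => z (σ i)) lam (analyticAt_phi₁_left ks kl _ _).differentiableAt
      (by fun_prop)
  analytic lam y _ := by
    simp only [Matrix.permanent, Matrix.of_apply]
    refine analyticAt_const.mul (Finset.analyticAt_fun_sum _ fun σ _ =>
      Finset.analyticAt_fun_prod _ fun i _ => ?_)
    exact (analyticAt_comp_ofReal (analyticAt_phi₁_right ks kl (lam (σ i))
      (ofReal_mem_tubeDomain (y i)))).comp_of_eq (g := fun t : ℝ => phi₁ ks kl (lam (σ i)) t)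
      ((ContinuousLinearMap.proj (R := ℝ) (φ := fun _ : Fin n => ℝ) i).analyticAt y) rfl
  eq_sum := by
    have hr := cRho₁_ne_zero hc
    have hf : (n.factorial : ℂ) ≠ 0 := by exact_mod_cast n.factorial_ne_zero
    refine ⟨cRho₁ ks kl ^ n * (n.factorial : ℂ), ?_, mul_ne_zero (pow_ne_zero _ hr) hf, ?_⟩
    · rw [← prod_cRhoFactor_zero]
      refine hasCRhoValue_prod_cRhoFactor hn fun m h => ?_
      dsimp only at h
      rw [zero_add, eq_neg_iff_add_eq_zero] at h
      exact Nat.succ_ne_zero m (by exact_mod_cast (add_comm _ _).trans h)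
    · intro lam hlam
      have hreg := mem_regularSet_of_generic hlam
      refine ⟨fun w => hcProd ks kl (weylAct w lam),
        fun w => isHarishChandraSeries_zero ks kl (weylAct_mem_regularSet hreg w), fun y hy => ?_⟩
      have h := sum_weyl_eq hc hreg (fun p => (ne_of_generic hlam p).1)
        (fun p => (ne_of_generic hlam p).2) hy (fun _ => (cRho₁ ks kl ^ n * (n.factorial : ℂ))⁻¹)
      rw [Finset.sum_congr rfl (g := fun w : Weyl n => (cRho₁ ks kl ^ n * (n.factorial : ℂ))⁻¹ *
        ((∏ p, cTilde₁ ks kl (weylAct w lam p)) * hcProd ks kl (weylAct w lam) y)) fun w _ => by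
          rw [cTilde_zero (hlam w).2]
          ring, h, ← Finset.mul_sum]
      have hrn := pow_ne_zero n hr
      simp only [Matrix.permanent, Matrix.of_apply]
      field_simp

end Hypergeometric

/-! ### The case `k_m = 1` -/

section Determinant

variable {n : ℕ}

theorem eq_zero_of_normSq_eq_zero {a : Fin n → ℤ} (h : normSq a = 0) : a = 0 := by
  funext i
  have := (Finset.sum_eq_zero_iff_of_nonneg (fun i _ => mul_self_nonneg (a i))).1 h i
    (Finset.mem_univ i)
  exact mul_self_eq_zero.1 this

theorem exists_pairC_eq_zero_ne_zero {a b : Fin n → ℤ} (ha : a ∈ middleRoots n)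
    (hb : b ∈ middleRoots n) (hab : a ≠ b) :
    ∃ v : Fin n → ℂ, pairC v b = 0 ∧ pairC v a ≠ 0 := by
  have h1 := normSq_of_mem_middleRoots ha
  have h2 := normSq_of_mem_middleRoots hb
  set c : ℤ := ∑ i, a i * b i with hc
  have hsub : normSq (a - b) = 4 - 2 * c := by
    have : normSq (a - b) = normSq a + normSq b - 2 * c := by
      simp only [normSq, hc, Finset.mul_sum, ← Finset.sum_add_distrib, ← Finset.sum_sub_distrib]
      refine Finset.sum_congr rfl fun i _ => ?_
      simp only [Pi.sub_apply]
      ring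
    rw [this, h1, h2]
    ring
  have hadd : normSq (a + b) = 4 + 2 * c := by
    have : normSq (a + b) = normSq a + normSq b + 2 * c := by
      simp only [normSq, hc, Finset.mul_sum, ← Finset.sum_add_distrib]
      refine Finset.sum_congr rfl fun i _ => ?_
      simp only [Pi.add_apply]
      ring
    rw [this, h1, h2]
    ring
  have hc1 : c ≠ 2 := by
    intro h
    have := eq_zero_of_normSq_eq_zero (a := a - b) (by rw [hsub, h]; norm_num)
    exact hab (sub_eq_zero.1 this)
  have hc2 : c ≠ -2 := by
    intro h
    have := eq_zero_of_normSq_eq_zero (a := a + b) (by rw [hadd, h]; norm_num)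
    obtain ⟨y, hy⟩ := posChamber_nonempty (n := n)
    have h3 := hy a (mem_posRoots_of_mem_middleRoots ha)
    have h4 := hy b (mem_posRoots_of_mem_middleRoots hb)
    have h5 := pairR_add y a b
    rw [this] at h5
    simp only [pairR, Pi.zero_apply, Int.cast_zero, mul_zero, Finset.sum_const_zero] at h3 h4 h5
    linarith
  have hp : ∀ d : Fin n → ℤ, pairC (fun i => 2 * (a i : ℂ) - c * (b i : ℂ)) d =
      ((2 * ∑ i, a i * d i - c * ∑ i, b i * d i : ℤ) : ℂ) := by
    intro d
    simp only [pairC, Finset.mul_sum, ← Finset.sum_sub_distrib, Int.cast_sum]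
    refine Finset.sum_congr rfl fun i _ => ?_
    push_cast
    ring
  refine ⟨fun i => 2 * (a i : ℂ) - c * (b i : ℂ), ?_, ?_⟩
  · have : ∑ i, b i * b i = 2 := h2
    rw [hp, ← hc, this]
    push_cast
    ring
  · have e1 : ∑ i, a i * a i = 2 := h1
    have e2 : ∑ i, b i * a i = c := by
      rw [hc]
      exact Finset.sum_congr rfl fun i _ => mul_comm _ _
    rw [hp, e1, e2]
    intro h
    have h' : 2 * 2 - c * c = 0 := by exact_mod_cast h
    have : (c - 2) * (c + 2) = 0 := by linarith
    rcases mul_eq_zero.1 this with h | h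
    · exact hc1 (by linarith)
    · exact hc2 (by linarith)

/-- The pairs `(λ, y)` of points of `ℂⁿ` for which every `y_j` is in `tubeDomain`. -/
def tubeDomainProd (n : ℕ) : Set ((Fin n → ℂ) × (Fin n → ℂ)) := {p | ∀ j, p.2 j ∈ tubeDomain}

theorem isOpen_tubeDomainProd : IsOpen (tubeDomainProd n) := by
  rw [tubeDomainProd, Set.ofPred_forall]
  exact isOpen_iInter_of_finite fun j => isOpen_tubeDomain.preimage (by fun_prop)

theorem ofReal_mem_tubeDomainProd (lam : Fin n → ℂ) (y : Fin n → ℝ) :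
    (lam, fun j => (y j : ℂ)) ∈ tubeDomainProd n := fun j => ofReal_mem_tubeDomain (y j)

/-- The determinant of the rank one hypergeometric functions. -/
noncomputable def detPhi₁ (ks kl : ℂ) (p : (Fin n → ℂ) × (Fin n → ℂ)) : ℂ :=
  (Matrix.of fun i j : Fin n => phi₁ ks kl (p.1 i) (p.2 j)).det

theorem analyticAt_phi₁_coord (ks kl : ℂ) (i j : Fin n) {p : (Fin n → ℂ) × (Fin n → ℂ)}
    (hp : p.2 j ∈ tubeDomain) :
    AnalyticAt ℂ (fun p : (Fin n → ℂ) × (Fin n → ℂ) => phi₁ ks kl (p.1 i) (p.2 j)) p := by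
  let A : (Fin n → ℂ) × (Fin n → ℂ) →L[ℂ] ℂ × ℂ :=
    (ContinuousLinearMap.proj (R := ℂ) (φ := fun _ : Fin n => ℂ) i).prodMap
      (ContinuousLinearMap.proj (R := ℂ) (φ := fun _ : Fin n => ℂ) j)
  have h1 : AnalyticAt ℂ (fun q : ℂ × ℂ => phi₁ ks kl q.1 q.2) (A p) := analyticAt_phi₁ ks kl (p.1 i) hp
  exact h1.comp (A.analyticAt p)

theorem analyticOnNhd_detPhi₁ (ks kl : ℂ) :
    AnalyticOnNhd ℂ (detPhi₁ (n := n) ks kl) (tubeDomainProd n) := by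
  intro p hp
  have h : AnalyticAt ℂ (fun p : (Fin n → ℂ) × (Fin n → ℂ) => ∑ σ : Equiv.Perm (Fin n),
      ((Equiv.Perm.sign σ : ℤ) : ℂ) * ∏ i, phi₁ ks kl (p.1 (σ i)) (p.2 i)) p :=
    Finset.analyticAt_fun_sum _ fun σ _ => analyticAt_const.mul
      (Finset.analyticAt_fun_prod _ fun i _ => analyticAt_phi₁_coord ks kl (σ i) i (hp i))
  refine h.congr (Filter.Eventually.of_forall fun p => ?_)
  simp only [detPhi₁, Matrix.det_apply', Matrix.of_apply]

theorem exists_ne_of_pairC_eq_zero {a : Fin n → ℤ} (ha : a ∈ middleRoots n) {v : Fin n → ℂ}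
    (h : pairC v a = 0) : ∃ i j, i ≠ j ∧ (v i = v j ∨ v i = -v j) := by
  revert a
  rw [forall_mem_middleRoots]
  intro i j hij
  rw [pairC_sub, pairC_add, pairC_e, pairC_e]
  exact ⟨fun h => ⟨i, j, hij.ne, Or.inl (sub_eq_zero.1 h)⟩,
    fun h => ⟨i, j, hij.ne, Or.inr (eq_neg_of_add_eq_zero_left h)⟩⟩

theorem exists_detPhi₁_eq {ks kl : ℂ} (hc : ∀ m : ℕ, ks + kl + 1 / 2 ≠ -(m : ℂ)) :
    ∃ g : (Fin n → ℂ) × (Fin n → ℂ) → ℂ, AnalyticOnNhd ℂ g (tubeDomainProd n) ∧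
      ∀ p ∈ tubeDomainProd n, detPhi₁ ks kl p =
        (sqVandermonde p.1 * ∏ a ∈ middleRoots n, pairC p.2 a) * g p := by
  let L : Bool × (Fin n → ℤ) → (Fin n → ℂ) × (Fin n → ℂ) →L[ℂ] ℂ := fun q =>
    if q.1 then (pairCL q.2).comp (ContinuousLinearMap.snd ℂ _ _)
    else (pairCL q.2).comp (ContinuousLinearMap.fst ℂ _ _)
  have hL1 : ∀ a p, L (true, a) p = pairC p.2 a := fun a p => by simp [L, pairCL_apply]
  have hL2 : ∀ a p, L (false, a) p = pairC p.1 a := fun a p => by simp [L, pairCL_apply]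
  have hz : ∀ a : Fin n → ℤ, pairC 0 a = 0 := fun a => by simp [pairC]
  have hex : ∀ a ∈ middleRoots n, ∃ v : Fin n → ℂ, pairC v a ≠ 0 := by
    intro a ha
    obtain ⟨i, hi⟩ := Function.ne_iff.1 (ne_zero_of_mem_posRoots (mem_posRoots_of_mem_middleRoots ha))
    exact ⟨Pi.single i 1, by rw [pairC_single]; exact_mod_cast hi⟩
  obtain ⟨g, hg, he⟩ := exists_analyticOnNhd_eq_prod_linear_mul isOpen_tubeDomainProd L
    (Finset.univ ×ˢ middleRoots n) (by
      rintro ⟨b, a⟩ hq h0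
      obtain ⟨v, hv⟩ := hex a (Finset.mem_product.1 hq).2
      cases b
      · exact hv (by rw [← hL2 a (v, 0), h0, zero_apply])
      · exact hv (by rw [← hL1 a (0, v), h0, zero_apply])) (by
      rintro ⟨b, a⟩ hq ⟨b', a'⟩ hq' hne
      have ha := (Finset.mem_product.1 hq).2
      have ha' := (Finset.mem_product.1 hq').2
      obtain ⟨v, hv⟩ := hex a ha
      cases b <;> cases b'
      · obtain ⟨u, hu, hu'⟩ := exists_pairC_eq_zero_ne_zero ha ha' (fun h => hne (congrArg (Prod.mk false) h))
        exact ⟨(u, 0), by rw [hL2]; exact hu, by rw [hL2]; exact hu'⟩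
      · exact ⟨(v, 0), by rw [hL1]; exact hz a', by rw [hL2]; exact hv⟩
      · exact ⟨(0, v), by rw [hL2]; exact hz a', by rw [hL1]; exact hv⟩
      · obtain ⟨u, hu, hu'⟩ := exists_pairC_eq_zero_ne_zero ha ha' (fun h => hne (congrArg (Prod.mk true) h))
        exact ⟨(0, u), by rw [hL1]; exact hu, by rw [hL1]; exact hu'⟩)
    (analyticOnNhd_detPhi₁ ks kl) (by
      rintro ⟨b, a⟩ hq p hp h0
      have ha := (Finset.mem_product.1 hq).2
      cases b
      · rw [hL2] at h0
        obtain ⟨i, j, hij, h⟩ := exists_ne_of_pairC_eq_zero ha h0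
        refine Matrix.det_zero_of_row_eq hij ?_
        funext k
        change phi₁ ks kl (p.1 i) (p.2 k) = phi₁ ks kl (p.1 j) (p.2 k)
        rcases h with h | h
        · rw [h]
        · rw [h, phi₁_neg hc _ (hp k)]
      · rw [hL1] at h0
        obtain ⟨i, j, hij, h⟩ := exists_ne_of_pairC_eq_zero ha h0
        refine Matrix.det_zero_of_column_eq hij fun k => ?_
        change phi₁ ks kl (p.1 k) (p.2 i) = phi₁ ks kl (p.1 k) (p.2 j)
        rcases h with h | h
        · rw [h]
        · rw [h, phi₁_neg_right])
  refine ⟨g, hg, fun p hp => ?_⟩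
  rw [he p hp, Finset.prod_product, Fintype.prod_bool]
  simp only [hL1, hL2, prod_middleRoots_pairC]
  rw [mul_comm (sqVandermonde p.2)]

theorem exists_sinh_half_eq : ∃ S : ℂ → ℂ, AnalyticOnNhd ℂ S Set.univ ∧
    (∀ z, 2 * Complex.sinh (z / 2) = z * S z) ∧ ∀ x : ℝ, S x ≠ 0 := by
  have hd : Differentiable ℂ fun z : ℂ => 2 * Complex.sinh (z / 2) := by fun_prop
  obtain ⟨S, hS, he⟩ := exists_analyticOnNhd_eq_linear_mul isOpen_univ
    (fun z _ => hd.analyticAt z) (ContinuousLinearMap.id ℂ ℂ)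
    (fun h => by simpa using congrArg (fun L : ℂ →L[ℂ] ℂ => L 1) h)
    (fun z _ hz => by
      have : z = 0 := hz
      simp [this])
  replace he : ∀ z, 2 * Complex.sinh (z / 2) = z * S z := fun z => he z (Set.mem_univ z)
  refine ⟨S, hS, he, fun x hx => ?_⟩
  rcases eq_or_ne x 0 with rfl | h0
  · have h1 : HasDerivAt (fun z : ℂ => z * S z) (S 0) 0 := by
      have := (hasDerivAt_id' (0 : ℂ)).fun_mul (hS 0 (Set.mem_univ 0)).differentiableAt.hasDerivAt
      simpa using this
    have h2 : HasDerivAt (fun z : ℂ => 2 * Complex.sinh (z / 2)) 1 0 := by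
      have := (((hasDerivAt_id (0 : ℂ)).div_const 2).csinh).const_mul 2
      simpa using this
    simp only [← he] at h1
    have h3 := h1.unique h2
    rw [Complex.ofReal_zero, h3] at hx
    exact one_ne_zero hx
  · have h1 := he x
    rw [hx, mul_zero] at h1
    have h2 : Real.sinh (x / 2) = 0 := by
      have : Complex.sinh ((x / 2 : ℝ) : ℂ) = 0 := by
        push_cast
        simpa using h1
      exact_mod_cast this
    rw [Real.sinh_eq_zero] at h2
    exact h0 (by linarith)

theorem pairC_ofReal (y : Fin n → ℝ) (a : Fin n → ℤ) :
    pairC (fun j => (y j : ℂ)) a = (pairR y a : ℂ) := by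
  simp [pairC, pairR]

theorem middleDenominator_eq_prod {S : ℂ → ℂ} (hS : ∀ z, 2 * Complex.sinh (z / 2) = z * S z)
    (y : Fin n → ℝ) : (middleDenominator n y : ℂ) =
      (∏ a ∈ middleRoots n, pairC (fun j => (y j : ℂ)) a) * ∏ a ∈ middleRoots n, S (pairR y a) := by
  change ((∏ a ∈ middleRoots n, _ : ℝ) : ℂ) = _
  rw [Complex.ofReal_prod, ← Finset.prod_mul_distrib]
  refine Finset.prod_congr rfl fun a _ => ?_
  rw [pairC_ofReal, ← hS, Complex.sinh]
  push_cast
  ring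

theorem exists_isHypergeometricFunction_det (hn : 2 ≤ n) {ks kl : ℂ}
    (hc : ∀ m : ℕ, ks + kl + 1 / 2 ≠ -(m : ℂ)) {C : ℂ}
    (hC : (∏ M ∈ Finset.range n, cRhoFactor (ks, 1, kl) M) * C = cRho₁ ks kl ^ n) :
    ∃ F : (Fin n → ℂ) → (Fin n → ℝ) → ℂ, IsHypergeometricFunction n (ks, 1, kl) F ∧
      ∀ lam y, sqVandermonde lam ≠ 0 → middleDenominator n y ≠ 0 →
        F lam y = C / sqVandermonde lam *
          ((Matrix.of fun i j : Fin n => phi₁ ks kl (lam i) (y j)).det /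
            (middleDenominator n y : ℂ)) := by
  obtain ⟨g, hg, hdet⟩ := exists_detPhi₁_eq (n := n) hc
  obtain ⟨S, hSa, hS, hS0⟩ := exists_sinh_half_eq
  have hr := pow_ne_zero n (cRho₁_ne_zero hc)
  have hc0 : (∏ M ∈ Finset.range n, cRhoFactor (ks, 1, kl) M) ≠ 0 := by
    intro h
    rw [h, zero_mul] at hC
    exact hr hC.symm
  let F : (Fin n → ℂ) → (Fin n → ℝ) → ℂ := fun lam y =>
    C * g (lam, fun j => (y j : ℂ)) / ∏ a ∈ middleRoots n, S (pairR y a)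
  have hF : ∀ lam y, sqVandermonde lam ≠ 0 → middleDenominator n y ≠ 0 →
        F lam y = C / sqVandermonde lam *
          ((Matrix.of fun i j : Fin n => phi₁ ks kl (lam i) (y j)).det /
            (middleDenominator n y : ℂ)) := by
    intro lam y hV hD
    have h1 := hdet _ (ofReal_mem_tubeDomainProd lam y)
    change (Matrix.of fun i j : Fin n => phi₁ ks kl (lam i) (y j)).det = _ at h1
    have hD' : (middleDenominator n y : ℂ) ≠ 0 := by exact_mod_cast hD
    have h2 := middleDenominator_eq_prod hS y
    rw [h2] at hD'
    obtain ⟨h3, h4⟩ := mul_ne_zero_iff.1 hD'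
    rw [h1, h2]
    simp only [F]
    generalize (∏ a ∈ middleRoots n, pairC (fun j => (y j : ℂ)) a) = P at *
    generalize (∏ a ∈ middleRoots n, S (pairR y a)) = Q at *
    field_simp
  refine ⟨F, ⟨fun y lam => ?_, fun lam y _ => ?_, ?_⟩, hF⟩
  · have h1 : AnalyticAt ℂ (fun lam => g (lam, fun j => (y j : ℂ))) lam :=
      (hg _ (ofReal_mem_tubeDomainProd lam y)).curry_left
    simp only [F, div_eq_mul_inv]
    exact (h1.differentiableAt.const_mul C).mul_const _
  · have h1 : AnalyticAt ℂ (fun z => g (lam, z)) (fun j => (y j : ℂ)) :=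
      (hg _ (ofReal_mem_tubeDomainProd lam y)).curry_right
    have h2 : AnalyticAt ℝ (fun y : Fin n → ℝ => g (lam, fun j => (y j : ℂ))) y :=
      (h1.restrictScalars (𝕜 := ℝ)).comp_of_eq
        ((ContinuousLinearMap.pi fun j : Fin n => Complex.ofRealCLM.comp
          (ContinuousLinearMap.proj (R := ℝ) (φ := fun _ : Fin n => ℝ) j)).analyticAt y) rfl
    refine (analyticAt_const.mul h2).div (Finset.analyticAt_fun_prod _ fun a _ => ?_)
      (Finset.prod_ne_zero_iff.2 fun a _ => hS0 _)
    have h3 := analyticAt_comp_ofReal (hSa ((pairR y a : ℝ) : ℂ) (Set.mem_univ _))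
    have h4 : AnalyticAt ℝ (fun y : Fin n → ℝ => pairR y a) y := by
      simp only [← pairRL_apply]
      exact (pairRL a).analyticAt y
    exact h3.comp_of_eq (g := fun x : ℝ => S x) h4 rfl
  · refine ⟨_, hasCRhoValue_prod_cRhoFactor hn fun m h => ?_, hc0, fun lam hlam => ?_⟩
    · dsimp only at h
      rw [eq_neg_iff_add_eq_zero] at h
      have : ((1 + 1 + m : ℕ) : ℂ) = 0 := by
        rw [← h]
        push_cast
        ring
      rw [Nat.cast_eq_zero] at this
      omega
    have hreg := mem_regularSet_of_generic hlam
    refine ⟨fun w y => hcProd ks kl (weylAct w lam) y / (middleDenominator n y : ℂ),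
      fun w => isHarishChandraSeries_one ks kl (weylAct_mem_regularSet hreg w), fun y hy => ?_⟩
    set c₀ := ∏ M ∈ Finset.range n, cRhoFactor (ks, 1, kl) M with hc₀
    have hV : sqVandermonde lam ≠ 0 := by
      rw [← prod_middleRoots_pairC]
      refine Finset.prod_ne_zero_iff.2 fun a ha => ?_
      have h := (hlam (1, fun _ => 1)).2 a (mem_posRoots_of_mem_middleRoots ha) 0
      rw [cArg_middle _ _ ha] at h
      have e0 : weylAct (1, fun _ => 1) lam = lam := by
        funext i
        simp [weylAct]
      simpa [e0] using h
    have hD := (middleDenominator_pos hy).ne'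
    have h := sum_weyl_eq hc hreg (fun p => (ne_of_generic hlam p).1)
      (fun p => (ne_of_generic hlam p).2) hy
      (fun σ => (((Equiv.Perm.sign σ : ℤ) : ℂ) * sqVandermonde lam)⁻¹)
    have e1 : ∀ w : Weyl n, cTilde (weylAct w lam) (ks, 1, kl) / c₀ *
        (hcProd ks kl (weylAct w lam) y / (middleDenominator n y : ℂ)) =
        (c₀ * (middleDenominator n y : ℂ))⁻¹ *
        ((((Equiv.Perm.sign w.1 : ℤ) : ℂ) * sqVandermonde lam)⁻¹ *
        ((∏ p, cTilde₁ ks kl (weylAct w lam p)) * hcProd ks kl (weylAct w lam) y)) := by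
      intro w
      rw [cTilde_one (hlam w).2, sqVandermonde_weylAct, mul_inv c₀]
      ring
    have e2 : ∀ σ : Equiv.Perm (Fin n), (((Equiv.Perm.sign σ : ℤ) : ℂ) * sqVandermonde lam)⁻¹ *
        ∏ i, phi₁ ks kl (lam (σ i)) (y i) = (sqVandermonde lam)⁻¹ *
        (((Equiv.Perm.sign σ : ℤ) : ℂ) * ∏ i, phi₁ ks kl (lam (σ i)) (y i)) := by
      intro σ
      rcases Int.units_eq_one_or (Equiv.Perm.sign σ) with h | h <;> simp [h, mul_comm]
    rw [Finset.sum_congr rfl fun w _ => e1 w, ← Finset.mul_sum, h,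
      Finset.sum_congr rfl fun σ _ => e2 σ, ← Finset.mul_sum, hF lam y hV hD, Matrix.det_apply']
    simp only [Matrix.of_apply]
    rw [← hC]
    have hD' : (middleDenominator n y : ℂ) ≠ 0 := by exact_mod_cast hD
    field_simp

end Determinant

theorem sqVandermonde_half {n : ℕ} (l : Fin n → ℂ) :
    sqVandermonde l = 2 ^ (n * (n - 1)) * sqVandermonde (fun i => l i / 2) := by
  have h : ∀ i j : Fin n, l i ^ 2 - l j ^ 2 = 2 ^ 2 * ((l i / 2) ^ 2 - (l j / 2) ^ 2) := by
    intro i j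
    ring
  have hcard : (∑ i : Fin n, (n - 1 - i)) * 2 = n * (n - 1) := by
    rw [← Finset.sum_range (fun i => n - 1 - i), Finset.sum_range_reflect (fun m => m),
      Finset.sum_range_id_mul_two]
  rw [← hcard]
  simp only [sqVandermonde, h, Finset.prod_mul_distrib, Finset.prod_const, Fin.card_Ioi]
  rw [Finset.prod_pow_eq_pow_sum, ← pow_mul, mul_comm 2]

end BCn

theorem mainTheorem1 (n : ℕ) (hn : 2 ≤ n) (ks kl α β : ℂ)
    (hα : α = ks + kl - 1 / 2) (hβ : β = kl - 1 / 2) (hα₀ : ∀ m : ℕ, α ≠ -(m : ℂ)) :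
    (∃ F : (Fin n → ℂ) → (Fin n → ℝ) → ℂ,
      BCn.IsHypergeometricFunction n (ks, 1, kl) F ∧
      (∀ G, BCn.IsHypergeometricFunction n (ks, 1, kl) G → G = F) ∧
      ∀ (l : Fin n → ℂ) (t : Fin n → ℝ),
        (∏ i, ∏ j ∈ Finset.Ioi i, (l i ^ 2 - l j ^ 2)) ≠ 0 →
        BCn.middleDenominator n (fun j => 2 * t j) ≠ 0 →
        F (fun i => l i / 2) (fun j => 2 * t j) =
          ((2 : ℂ) ^ (2 * n * (n - 1)) *
              ∏ i ∈ Finset.Icc 1 (n - 1), ((α + (i : ℂ)) ^ (n - i) * (Nat.factorial i : ℂ))) /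
            (∏ i, ∏ j ∈ Finset.Ioi i, (l i ^ 2 - l j ^ 2)) *
          ((Matrix.of fun i j : Fin n =>
              BCn.jacobiFunction α β (Complex.I * l i) (t j)).det /
            (BCn.middleDenominator n (fun j => 2 * t j) : ℂ))) ∧
    (∃ F : (Fin n → ℂ) → (Fin n → ℝ) → ℂ,
      BCn.IsHypergeometricFunction n (ks, 0, kl) F ∧
      (∀ G, BCn.IsHypergeometricFunction n (ks, 0, kl) G → G = F) ∧
      ∀ (l : Fin n → ℂ) (t : Fin n → ℝ),
        F (fun i => l i / 2) (fun j => 2 * t j) =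
          1 / (Nat.factorial n : ℂ) *
            (Matrix.of fun i j : Fin n =>
              BCn.jacobiFunction α β (Complex.I * l i) (t j)).permanent) := by
  have hα1 : α + 1 = ks + kl + 1 / 2 := by
    rw [hα]
    ring
  have hc : ∀ m : ℕ, ks + kl + 1 / 2 ≠ -(m : ℂ) := by
    intro m h
    refine hα₀ (m + 1) ?_
    rw [← hα1] at h
    push_cast
    linear_combination h
  have hj : ∀ (l : Fin n → ℂ) (t : Fin n → ℝ), (fun i j : Fin n =>
      BCn.jacobiFunction α β (Complex.I * l i) (t j)) =
      fun i j => BCn.phi₁ ks kl (l i / 2) ((2 * t j : ℝ) : ℂ) := fun l t => by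
    funext i j
    exact BCn.jacobiFunction_eq_phi₁ hα hβ hc (l i) (t j)
  refine ⟨?_, ?_⟩
  · obtain ⟨F, hF, hdet⟩ := BCn.exists_isHypergeometricFunction_det hn hc
      (BCn.prod_cRhoFactor_one n hc)
    refine ⟨F, hF, fun G hG => hF.unique hG, fun l t hl ht => ?_⟩
    have hV := BCn.sqVandermonde_half l
    have hV0 : BCn.sqVandermonde (fun i => l i / 2) ≠ 0 := by
      intro h0
      rw [h0, mul_zero] at hV
      exact hl hV
    rw [hdet _ _ hV0 ht, hj, ← hα1, BCn.prod_two_pow_ascPochhammer_factorial]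
    change _ = _ / BCn.sqVandermonde l * _
    rw [hV, show 2 * n * (n - 1) = n * (n - 1) + n * (n - 1) by ring, pow_add]
    have h2 : (2 : ℂ) ^ (n * (n - 1)) ≠ 0 := pow_ne_zero _ two_ne_zero
    have hD : (BCn.middleDenominator n (fun j => 2 * t j) : ℂ) ≠ 0 := by exact_mod_cast ht
    field_simp
  · have hF := BCn.isHypergeometricFunction_permanent hn hc
    exact ⟨_, hF, fun G hG => hF.unique hG, fun l t => by rw [hj]⟩
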